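/- **Setting.** Let $\mathcal X$ be a nonempty finite alphabet, known in advance. Logarithms are to base 2 and $H(p)$ is the entropy in bits. An $(n,R)$ compression scheme is a pair of maps $\mathrm{enc}:\mathcal X^n\to\{0,1\}^{\lfloor nR\rfloor}$, $\mathrm{dec}:\{0,1\}^{\lfloor nR\rfloor}\to\mathcal X^n$. A *local decoder* is an algorithm that is given $(i,s)$, adaptively probes bits of $\mathrm{enc}(x^n)$ and outputs $x_i^{i+s-1}$ for every $x^n$ with $\mathrm{dec}(\mathrm{enc}(x^n))=x^n$. A *local updater* is an algorithm that is given $(i,s)$ and a new fragment $\tilde x_i^{i+s-1}$ only, adaptively reads and rewrites bits of the stored codeword, and turns $\mathrm{enc}(x^n)$ into $\mathrm{enc}(x^{i-1}\tilde x_i^{i+s-1}x_{i+s}^n)$ for every $x^n$ with $\mathrm{dec}(\mathrm{enc}(x^n))=x^n$. For $X^n$ i.i.d. with law $p$, the average local decodability $\bar r(s)$ is the maximum over $1\le i\le n-s+1$ of the expected number of codeword bits probed to decode the fragment of length $s$ at $i$. The average update efficiency $\bar u(s)$ is the maximum over $i$ of the expected number of codeword bits read plus codeword bits written, when the new fragment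 is independent of $X^n$ and i.i.d. with law $p$. Computational complexity is the number of unit-cost operations of a word RAM with words of $\Theta(\log n)$ bits. **Theorem.** For every $\varepsilon\in(0,1/2)$ there are an encoder, a decoder, a local decoder and a local updater, four fixed word-RAM programs that depend on $\mathcal X$ and $\varepsilon$ only, not on the source distribution (they receive the blocklength $n$ and the codeword length as inputs), which for every $n\ge1$ and every rate $R\in[\varepsilon,\log|\mathcal X|+\varepsilon]$ implement an $(n,R)$ compression scheme with local decoder and local updater such that the following holds. For every probability distribution $p$ on $\mathcal X$ there are constants $\alpha_i,\alpha_i',\alpha_i''>0$, $i=1,2$, depending on $p$ only (not on $n$, $\varepsilon$), such that for every $\varepsilon\in(0,1/2)$ and every rate $R$ with $H(p)+\varepsilon\le R\le\log|\mathcal X|+\varepsilon$, in particular for $R=H(p)+\varepsilon$, the scheme for $\varepsilon$ at rate $R$ satisfies, for $X^n$ i.i.d. with law $p$: 1. $\Pr[\mathrm{dec}(\mathrm{enc}(X^n))\ne X^n]\le 2^{-2^{c\sqrt{\log n}}}$ for all sufficiently large $n$, with a constant $c>0$ depending only on $\varepsilon$ and $p$; 2. for all $1\le s\le n$, $$\bar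 r(s)\le\begin{cases}\alpha_1\frac1{\varepsilon^2}\log\frac1\varepsilon & \text{if } s\le\alpha_1''\frac1{\varepsilon^2}\log\frac1\varepsilon,\\ \alpha_1's & \text{if } s>\alpha_1''\frac1{\varepsilon^2}\log\frac1\varepsilon,\end{cases}\qquad \bar u(s)\le\begin{cases}\alpha_2\frac1{\varepsilon^2}\log\frac1\varepsilon & \text{if } s\le\alpha_2''\frac1{\varepsilon^2}\log\frac1\varepsilon,\\ \alpha_2's & \text{if } s>\alpha_2''\frac1{\varepsilon^2}\log\frac1\varepsilon;\end{cases}$$ 3. encoding and decoding any $x^n$ takes $O(n\log n)$ operations in total ($n\ge2$), and for all $1\le s\le n$ local decoding and local updating of any fragment of length $s$ take an expected number of operations that is $\Theta(s)$, with constants depending only on $\varepsilon$ and $p$. -/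

import Mathlib

open Filter

/-! ### A word RAM with a bit-addressable codeword memory

Programs are structured programs over finitely many registers and arrays.  Every value that is put
in a register is a word, that is, it is reduced modulo `W`.  Each evaluation of a node of an
expression, each instruction and each test costs one time unit.  The codeword is held in a separate
memory of bits, accessed by `probe` and `write` only; these accesses are also counted separately,
with multiplicity. -/

/-- Binary word operations: subtraction is truncated, division rounds down, comparisons
return `0` or `1`. -/
inductive BinOp where
  | add | sub | mul | div | mod | lt | eq

def BinOp.eval : BinOp → ℕ → ℕ → ℕ
  | .add, a, b => a + b
  | .sub, a, b => a - b
  | .mul, a, b => a * b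
  | .div, a, b => a / b
  | .mod, a, b => a % b
  | .lt, a, b => if a < b then 1 else 0
  | .eq, a, b => if a = b then 1 else 0

/-- Expressions over literals and registers. -/
inductive Expr where
  | lit (k : ℕ)
  | reg (r : ℕ)
  | bin (o : BinOp) (e₁ e₂ : Expr)

/-- Value of an expression; all intermediate results are words modulo `W`. -/
def Expr.eval (W : ℕ) (reg : ℕ → ℕ) : Expr → ℕ
  | .lit k => k % W
  | .reg r => reg r
  | .bin o e₁ e₂ => o.eval (e₁.eval W reg) (e₂.eval W reg) % W

/-- Number of nodes of an expression. -/
def Expr.cost : Expr → ℕ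
  | .lit _ => 1
  | .reg _ => 1
  | .bin _ e₁ e₂ => 1 + e₁.cost + e₂.cost

/-- Configuration of the machine: registers, work arrays, read-only input, codeword memory, output,
and the counters for time, codeword bits read and codeword bits written. -/
structure Machine where
  reg : ℕ → ℕ
  mem : ℕ → ℕ → ℕ
  inp : ℕ → ℕ
  code : ℕ → Bool
  out : ℕ → ℕ
  time : ℕ
  reads : ℕ
  writes : ℕ

/-- Elementary instructions. -/
inductive Instr where
  /-- `r := e` -/
  | assign (r : ℕ) (e : Expr)
  /-- `r := a[e]`, for the work array number `a` -/
  | load (r a : ℕ) (e : Expr)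
  /-- `a[e₁] := e₂` -/
  | store (a : ℕ) (e₁ e₂ : Expr)
  /-- `r := input[e]` -/
  | input (r : ℕ) (e : Expr)
  /-- `output[e₁] := e₂` -/
  | output (e₁ e₂ : Expr)
  /-- `r := codeword[e]` (as `0` or `1`) -/
  | probe (r : ℕ) (e : Expr)
  /-- `codeword[e₁] := (e₂ ≠ 0)` -/
  | write (e₁ e₂ : Expr)

/-- Effect of an elementary instruction. -/
def Instr.run (W : ℕ) (σ : Machine) : Instr → Machine
  | .assign r e =>
      { σ with
        reg := Function.update σ.reg r (e.eval W σ.reg % W)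
        time := σ.time + 1 + e.cost }
  | .load r a e =>
      { σ with
        reg := Function.update σ.reg r (σ.mem a (e.eval W σ.reg) % W)
        time := σ.time + 1 + e.cost }
  | .store a e₁ e₂ =>
      { σ with
        mem := Function.update σ.mem a
          (Function.update (σ.mem a) (e₁.eval W σ.reg) (e₂.eval W σ.reg))
        time := σ.time + 1 + e₁.cost + e₂.cost }
  | .input r e =>
      { σ with
        reg := Function.update σ.reg r (σ.inp (e.eval W σ.reg) % W)
        time := σ.time + 1 + e.cost }
  | .output e₁ e₂ =>
      { σ with
        out := Function.update σ.out (e₁.eval W σ.reg) (e₂.eval W σ.reg)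
        time := σ.time + 1 + e₁.cost + e₂.cost }
  | .probe r e =>
      { σ with
        reg := Function.update σ.reg r ((σ.code (e.eval W σ.reg)).toNat % W)
        time := σ.time + 1 + e.cost
        reads := σ.reads + 1 }
  | .write e₁ e₂ =>
      { σ with
        code := Function.update σ.code (e₁.eval W σ.reg) (decide (e₂.eval W σ.reg ≠ 0))
        time := σ.time + 1 + e₁.cost + e₂.cost
        writes := σ.writes + 1 }

/-- Programs. -/
inductive Prog where
  | instr (a : Instr)
  | seq (c₁ c₂ : Prog)
  | ite (e : Expr) (c₁ c₂ : Prog)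
  | loop (e : Expr) (c : Prog)

/-- Charge the cost of testing `e`. -/
def Machine.test (σ : Machine) (e : Expr) : Machine :=
  { σ with time := σ.time + 1 + e.cost }

/-- `Exec W c σ τ`: with words modulo `W`, the program `c` started in `σ` halts in `τ`.
`Prog.loop e c` repeats `c` as long as `e ≠ 0`. -/
inductive Exec (W : ℕ) : Prog → Machine → Machine → Prop where
  | instr (a : Instr) (σ : Machine) : Exec W (.instr a) σ (a.run W σ)
  | seq {c₁ c₂ : Prog} {σ τ ρ : Machine} :
      Exec W c₁ σ τ → Exec W c₂ τ ρ → Exec W (.seq c₁ c₂) σ ρ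
  | ite_true {e : Expr} {c₁ c₂ : Prog} {σ τ : Machine} :
      e.eval W σ.reg ≠ 0 → Exec W c₁ (σ.test e) τ → Exec W (.ite e c₁ c₂) σ τ
  | ite_false {e : Expr} {c₁ c₂ : Prog} {σ τ : Machine} :
      e.eval W σ.reg = 0 → Exec W c₂ (σ.test e) τ → Exec W (.ite e c₁ c₂) σ τ
  | loop_true {e : Expr} {c : Prog} {σ τ ρ : Machine} :
      e.eval W σ.reg ≠ 0 → Exec W c (σ.test e) τ → Exec W (.loop e c) τ ρ →
      Exec W (.loop e c) σ ρ
  | loop_false {e : Expr} {c : Prog} {σ : Machine} :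
      e.eval W σ.reg = 0 → Exec W (.loop e c) σ (σ.test e)

/-- Execution is deterministic. -/
theorem Exec.deterministic {W : ℕ} {c : Prog} {σ τ τ' : Machine}
    (h : Exec W c σ τ) (h' : Exec W c σ τ') : τ = τ' := by
  induction h generalizing τ' with
  | instr a σ => cases h'; rfl
  | seq _ _ ih₁ ih₂ =>
    cases h' with
    | seq k₁ k₂ => cases ih₁ k₁; exact ih₂ k₂
  | ite_true he _ ih =>
    cases h' with
    | ite_true _ k => exact ih k
    | ite_false he' _ => exact absurd he' he
  | ite_false he _ ih =>
    cases h' with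
    | ite_true he' _ => exact absurd he he'
    | ite_false _ k => exact ih k
  | loop_true he _ _ ih₁ ih₂ =>
    cases h' with
    | loop_true _ k₁ k₂ => cases ih₁ k₁; exact ih₂ k₂
    | loop_false he' => exact absurd he' he
  | loop_false he =>
    cases h' with
    | loop_true he' _ _ => exact absurd he he'
    | loop_false _ => rfl

open Classical in
/-- The halting configuration of `c` started in `σ` (and `σ` itself if `c` does not halt). -/
noncomputable def Prog.result (W : ℕ) (c : Prog) (σ : Machine) : Machine :=
  if h : ∃ τ, Exec W c σ τ then h.choose else σ

theorem Exec.result_eq {W : ℕ} {c : Prog} {σ τ : Machine} (h : Exec W c σ τ) :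
    c.result W σ = τ := by
  have h' : ∃ τ, Exec W c σ τ := ⟨τ, h⟩
  rw [Prog.result, dif_pos h']
  exact h'.choose_spec.deterministic h

/-- Initial configuration: the arguments are in registers `0, 1, …`, all other registers and all
work arrays are zero. -/
def Machine.init (W : ℕ) (args : List ℕ) (inp : ℕ → ℕ) (code : ℕ → Bool) : Machine where
  reg := fun r => args.getD r 0 % W
  mem := fun _ _ => 0
  inp := inp
  code := code
  out := fun _ => 0
  time := 0
  reads := 0
  writes := 0

/-! ### Compression schemes, local decoders and local updaters -/

/-- A fixed-length compression scheme for `n` symbols with codewords of `L` bits. -/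
structure CompressionScheme (𝒳 : Type*) (n L : ℕ) where
  enc : (Fin n → 𝒳) → (Fin L → Bool)
  dec : (Fin L → Bool) → (Fin n → 𝒳)

/-- `x` is decoded correctly from its codeword. -/
def CompressionScheme.Decodes {𝒳 : Type*} {n L : ℕ} (C : CompressionScheme 𝒳 n L)
    (x : Fin n → 𝒳) : Prop :=
  C.dec (C.enc x) = x

/-- The sequence `x` with the fragment of length `s` that starts at position `i`
(counted from `0`) replaced by `v`. -/
def splice {𝒳 : Type*} {n s : ℕ} (x : Fin n → 𝒳) (i : ℕ) (v : Fin s → 𝒳) : Fin n → 𝒳 :=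
  fun k => if h : i ≤ k ∧ k < i + s then v ⟨k - i, by omega⟩ else x k

/-- The four programs of a scheme, with the factor `κ` of the word length `κ · (bit length of n)`.
None of them contains the blocklength or the source distribution. -/
structure Algorithms where
  κ : ℕ
  encoder : Prog
  decoder : Prog
  localDecoder : Prog
  localUpdater : Prog

/-- Number of words: words have `κ` times as many bits as the blocklength `n`. -/
def Algorithms.words (A : Algorithms) (n : ℕ) : ℕ := 2 ^ (A.κ * Nat.size n)

section Runs

variable {𝒳 : Type*} {q : ℕ} (sym : 𝒳 ≃ Fin q) (A : Algorithms) {n L : ℕ}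

/-- Symbols as they are presented to the machine, through the numbering `sym` of the alphabet. -/
def symbols {m : ℕ} (x : Fin m → 𝒳) : ℕ → ℕ :=
  fun k => if h : k < m then (sym (x ⟨k, h⟩) : ℕ) else 0

/-- A codeword in the codeword memory. -/
def bits (c : Fin L → Bool) : ℕ → Bool :=
  fun k => if h : k < L then c ⟨k, h⟩ else false

/-- Start of the encoder on `x`, with an empty codeword memory. -/
def encStart (L : ℕ) (x : Fin n → 𝒳) : Machine :=
  Machine.init (A.words n) [n, L] (symbols sym x) (fun _ => false)

/-- Start of the decoder on the codeword `c`. -/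
def decStart (n : ℕ) (c : Fin L → Bool) : Machine :=
  Machine.init (A.words n) [n, L] (fun _ => 0) (bits c)

/-- Start of the local decoder on the codeword `c`, with the query `(i, s)`. -/
def locStart (n : ℕ) (c : Fin L → Bool) (i s : ℕ) : Machine :=
  Machine.init (A.words n) [n, L, i, s] (fun _ => 0) (bits c)

/-- Start of the local updater on the codeword `c`, with new fragment `v` at position `i`. -/
def updStart (n : ℕ) (c : Fin L → Bool) (i : ℕ) {s : ℕ} (v : Fin s → 𝒳) : Machine :=
  Machine.init (A.words n) [n, L, i, s] (symbols sym v) (bits c)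

/-- The four programs halt and realize the scheme `C`: the encoder and the decoder compute `C.enc`
and `C.dec`; from the codeword of a decodable `x`, the local decoder outputs every fragment of `x`,
and the local updater turns the codeword of `x` into the codeword of the updated sequence. -/
structure Implements (C : CompressionScheme 𝒳 n L) : Prop where
  encoder : ∀ x : Fin n → 𝒳, ∃ τ, Exec (A.words n) A.encoder (encStart sym A L x) τ ∧
    ∀ k : Fin L, τ.code k = C.enc x k
  decoder : ∀ c : Fin L → Bool, ∃ τ, Exec (A.words n) A.decoder (decStart A n c) τ ∧
    ∀ k : Fin n, τ.out k = sym (C.dec c k)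
  localDecoder : ∀ (x : Fin n → 𝒳) (i s : ℕ) (_ : 1 ≤ s) (his : i + s ≤ n),
    ∃ τ, Exec (A.words n) A.localDecoder (locStart A n (C.enc x) i s) τ ∧
      (C.Decodes x →
        (∀ j : Fin s, τ.out j = sym (x ⟨i + j, by omega⟩)) ∧
        ∀ k : Fin L, τ.code k = C.enc x k)
  localUpdater : ∀ (x : Fin n → 𝒳) (i s : ℕ) (v : Fin s → 𝒳), 1 ≤ s → i + s ≤ n →
    ∃ τ, Exec (A.words n) A.localUpdater (updStart sym A n (C.enc x) i v) τ ∧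
      (C.Decodes x → ∀ k : Fin L, τ.code k = C.enc (splice x i v) k)

/-- Halting configuration of the local decoder for the fragment `(i, s)` of `x`. -/
noncomputable def locRun (C : CompressionScheme 𝒳 n L) (x : Fin n → 𝒳) (i s : ℕ) : Machine :=
  A.localDecoder.result (A.words n) (locStart A n (C.enc x) i s)

/-- Halting configuration of the local updater for the new fragment `v` of `x` at position `i`. -/
noncomputable def updRun (C : CompressionScheme 𝒳 n L) (x : Fin n → 𝒳) (i : ℕ) {s : ℕ}
    (v : Fin s → 𝒳) : Machine :=
  A.localUpdater.result (A.words n) (updStart sym A n (C.enc x) i v)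

/-- Time to encode `x` plus time to decode its codeword. -/
noncomputable def codingTime (C : CompressionScheme 𝒳 n L) (x : Fin n → 𝒳) : ℕ :=
  (A.encoder.result (A.words n) (encStart sym A L x)).time +
    (A.decoder.result (A.words n) (decStart A n (C.enc x))).time

end Runs

/-! ### Memoryless sources -/

/-- Entropy in bits. -/
noncomputable def entropyBits {𝒳 : Type*} [Fintype 𝒳] (p : 𝒳 → ℝ) : ℝ :=
  ∑ a, Real.negMulLog (p a) / Real.log 2

/-- `𝔼 f(Xⁿ)` for `n` independent symbols drawn from `p`. -/
noncomputable def iidMean {𝒳 : Type*} [Fintype 𝒳] (p : 𝒳 → ℝ) (n : ℕ)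
    (f : (Fin n → 𝒳) → ℝ) : ℝ :=
  ∑ x : Fin n → 𝒳, (∏ k, p (x k)) * f x

section Performance

variable {𝒳 : Type*} [Fintype 𝒳] {q : ℕ} (sym : 𝒳 ≃ Fin q) (A : Algorithms) {n L : ℕ}

open Classical in
/-- Probability of a decoding error. -/
noncomputable def errorProb (p : 𝒳 → ℝ) (C : CompressionScheme 𝒳 n L) : ℝ :=
  iidMean p n fun x => if C.Decodes x then 0 else 1

/-- Average local decodability for fragments of length `s`, `1 ≤ s ≤ n`. -/
noncomputable def avgLocalDecodability (p : 𝒳 → ℝ) (C : CompressionScheme 𝒳 n L) (s : ℕ) : ℝ :=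
  ⨆ i : Fin (n - s + 1), iidMean p n fun x => ((locRun A C x i s).reads : ℝ)

/-- Average update efficiency for fragments of length `s`, `1 ≤ s ≤ n`: codeword bits read plus
codeword bits written, where the new fragment is independent of the source sequence and drawn from
the same distribution. -/
noncomputable def avgUpdateEfficiency (p : 𝒳 → ℝ) (C : CompressionScheme 𝒳 n L) (s : ℕ) : ℝ :=
  ⨆ i : Fin (n - s + 1), iidMean p n fun x => iidMean p s fun v =>
    ((updRun sym A C x i v).reads : ℝ) + ((updRun sym A C x i v).writes : ℝ)

/-- Expected time of the local decoder for the fragment of length `s` at position `i`. -/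
noncomputable def meanLocalDecodeTime (p : 𝒳 → ℝ) (C : CompressionScheme 𝒳 n L) (i s : ℕ) : ℝ :=
  iidMean p n fun x => ((locRun A C x i s).time : ℝ)

/-- Expected time of the local updater for the fragment of length `s` at position `i`. -/
noncomputable def meanLocalUpdateTime (p : 𝒳 → ℝ) (C : CompressionScheme 𝒳 n L) (i s : ℕ) : ℝ :=
  iidMean p n fun x => iidMean p s fun v => ((updRun sym A C x i v).time : ℝ)

end Performance

/-- `(1/ε²) log₂ (1/ε)`. -/
noncomputable def localScale (ε : ℝ) : ℝ := 1 / ε ^ 2 * Real.logb 2 (1 / ε)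

/-!
A sequence is cut into blocks of a length `b` proportional to `localScale ε`. Block `k` is
represented by its rank in an enumeration of all blocks by increasing size of the type class, and
gets a record of fixed length `l + 3`, `l ≈ b * R`: two flags, one spare bit and a payload of `l`
bits. The low `l` bits of the rank go to the payload. The first flag tells that the rank is at
least `2 ^ l`; the high bits of such an overflowing block are put into the spare bits of its own
record and of the records after it, on a first come, first served basis, so that the spare bits of
the records behave like a queue (`queuePos`). Decoding fails only if the queue extends beyond the
last record.

A local decoder has to know the position of the queue at its block. The second flag of every record
tells whether the queue is busy before this record. Where it is not, its position is known; so the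
decoder scans these flags to the left until the first one that is not set, and simulates the queue
from there (`wp_localDecoder`). An update recomputes the records from the first block of the
fragment on until the positions of the old and the new queue agree behind the fragment
(`wp_localUpdater`); where they differ, one of the two queues is busy. The encoder is the local
updater applied to the whole sequence, started from the codeword in which no bit is set, and the
decoder is the local decoder of the whole sequence.

By the method of types a block of a source with law `p` overflows with a probability `δ` that is
exponentially small in `ε² b`, if `entropyBits p + ε ≤ R`: a Rényi entropy of order close to one
exceeds the entropy by little (`overflowProb_le`). For `δ` small against the number `β` of spare
bits that an overflowing block needs, the expectation of the potential `θ ^ backlog * γ ^ (length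
of the busy period)` contracts from block to block (`mean_potential_le`). Hence busy periods have a
bounded exponential moment: they are short in the mean, which bounds the local costs by a constant
number of records for every block of the fragment (`Rare.mean_locRun`, `Rare.mean_updRun`), and
Markov's inequality bounds the probability that the queue outgrows the codeword; this decays
exponentially with the blocklength since a constant fraction of the records, at the end, carries no
block. For updates, the new sequence again has law `p` since exchanging the fragment with an
independent copy preserves the joint law (`iidMean_splice`), so the potential controls both the old
and the new queue.
-/

/-! ### Verification of word RAM programs -/

/-- Total correctness: started in `σ`, the program `c` halts in a configuration that satisfies
`Q`. -/
def WP (W : ℕ) (c : Prog) (Q : Machine → Prop) (σ : Machine) : Prop :=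
  ∃ τ, Exec W c σ τ ∧ Q τ

theorem WP.instr {W : ℕ} {a : Instr} {Q : Machine → Prop} {σ : Machine}
    (h : Q (a.run W σ)) : WP W (.instr a) Q σ := ⟨_, .instr a σ, h⟩

theorem WP.seq {W : ℕ} {c₁ c₂ : Prog} {Q : Machine → Prop} {σ : Machine}
    (h : WP W c₁ (WP W c₂ Q) σ) : WP W (.seq c₁ c₂) Q σ := by
  obtain ⟨τ, h1, ρ, h2, h3⟩ := h
  exact ⟨ρ, .seq h1 h2, h3⟩

theorem WP.ite {W : ℕ} {e : Expr} {c₁ c₂ : Prog} {Q : Machine → Prop} {σ : Machine}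
    (h₁ : e.eval W σ.reg ≠ 0 → WP W c₁ Q (σ.test e))
    (h₂ : e.eval W σ.reg = 0 → WP W c₂ Q (σ.test e)) : WP W (.ite e c₁ c₂) Q σ := by
  by_cases h : e.eval W σ.reg = 0
  · obtain ⟨τ, h1, h2⟩ := h₂ h
    exact ⟨τ, .ite_false h h1, h2⟩
  · obtain ⟨τ, h1, h2⟩ := h₁ h
    exact ⟨τ, .ite_true h h1, h2⟩

/-- A loop that runs exactly `m` times, with an invariant indexed by the iteration. -/
theorem WP.loop {W : ℕ} {e : Expr} {c : Prog} {Q : Machine → Prop} {σ : Machine}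
    (I : ℕ → Machine → Prop) (m : ℕ) (h0 : I 0 σ)
    (hstep : ∀ j < m, ∀ σ, I j σ → e.eval W σ.reg ≠ 0 ∧ WP W c (I (j + 1)) (σ.test e))
    (hend : ∀ σ, I m σ → e.eval W σ.reg = 0 ∧ Q (σ.test e)) : WP W (.loop e c) Q σ := by
  have key : ∀ d j, j + d = m → ∀ σ, I j σ → WP W (.loop e c) Q σ := by
    intro d
    induction d with
    | zero =>
      intro j hj σ hI
      obtain rfl : j = m := by omega
      obtain ⟨h1, h2⟩ := hend σ hI
      exact ⟨_, .loop_false h1, h2⟩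
    | succ d ih =>
      intro j hj σ hI
      obtain ⟨h1, τ, h2, h3⟩ := hstep j (by omega) σ hI
      obtain ⟨ρ, h4, h5⟩ := ih (j + 1) (by omega) τ h3
      exact ⟨ρ, .loop_true h1 h2 h4, h5⟩
  exact key m 0 (by omega) σ h0

theorem Exec.time_lt {W : ℕ} {c : Prog} {σ τ : Machine} (h : Exec W c σ τ) :
    σ.time < τ.time := by
  induction h with
  | instr a σ => cases a <;> simp only [Instr.run] <;> omega
  | seq _ _ h1 h2 => exact h1.trans h2
  | ite_true _ _ h | ite_false _ _ h =>
    simp only [Machine.test] at h; omega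
  | loop_true _ _ _ h1 h2 =>
    simp only [Machine.test] at h1; omega
  | loop_false _ => simp only [Machine.test]; omega

/-- `WP.loop` with the information that a loop of `m` rounds takes at least `m` steps. -/
theorem WP.loop_time {W : ℕ} {e : Expr} {c : Prog} {Q : Machine → Prop} {σ : Machine}
    (I : ℕ → Machine → Prop) (m : ℕ) (h0 : I 0 σ)
    (hstep : ∀ j < m, ∀ σ, I j σ → e.eval W σ.reg ≠ 0 ∧ WP W c (I (j + 1)) (σ.test e))
    (hend : ∀ σ, I m σ → m ≤ σ.time → e.eval W σ.reg = 0 ∧ Q (σ.test e)) :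
    WP W (.loop e c) Q σ := by
  refine WP.loop (fun j τ => I j τ ∧ j ≤ τ.time) m ⟨h0, Nat.zero_le _⟩ ?_
    fun τ hτ => hend τ hτ.1 hτ.2
  rintro j hj τ ⟨hI, ht⟩
  obtain ⟨h1, ρ, h2, h3⟩ := hstep j hj τ hI
  refine ⟨h1, ρ, h2, h3, ?_⟩
  have := h2.time_lt
  simp only [Machine.test] at this
  omega

/-- Sequential composition of programs. -/
infixr:60 " ;; " => Prog.seq

instance : Add Expr := ⟨.bin .add⟩
instance : Sub Expr := ⟨.bin .sub⟩
instance : Mul Expr := ⟨.bin .mul⟩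
instance : Div Expr := ⟨.bin .div⟩
instance : Mod Expr := ⟨.bin .mod⟩

namespace Expr

variable {W : ℕ} {ρ : ℕ → ℕ}

theorem eval_lit (k : ℕ) : (lit k).eval W ρ = k % W := rfl
theorem eval_reg (r : ℕ) : (reg r).eval W ρ = ρ r := rfl
theorem eval_add (a b : Expr) : (a + b).eval W ρ = (a.eval W ρ + b.eval W ρ) % W := rfl
theorem eval_sub (a b : Expr) : (a - b).eval W ρ = (a.eval W ρ - b.eval W ρ) % W := rfl
theorem eval_mul (a b : Expr) : (a * b).eval W ρ = (a.eval W ρ * b.eval W ρ) % W := rfl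
theorem eval_div (a b : Expr) : (a / b).eval W ρ = (a.eval W ρ / b.eval W ρ) % W := rfl
theorem eval_mod (a b : Expr) : (a % b).eval W ρ = (a.eval W ρ % b.eval W ρ) % W := rfl
theorem eval_lt (a b : Expr) : (bin .lt a b).eval W ρ =
    (if a.eval W ρ < b.eval W ρ then 1 else 0) % W := rfl
theorem eval_eq (a b : Expr) : (bin .eq a b).eval W ρ =
    (if a.eval W ρ = b.eval W ρ then 1 else 0) % W := rfl

theorem cost_lit (k : ℕ) : (lit k).cost = 1 := rfl
theorem cost_reg (r : ℕ) : (reg r).cost = 1 := rfl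
theorem cost_add (a b : Expr) : (a + b).cost = 1 + a.cost + b.cost := rfl
theorem cost_sub (a b : Expr) : (a - b).cost = 1 + a.cost + b.cost := rfl
theorem cost_mul (a b : Expr) : (a * b).cost = 1 + a.cost + b.cost := rfl
theorem cost_div (a b : Expr) : (a / b).cost = 1 + a.cost + b.cost := rfl
theorem cost_mod (a b : Expr) : (a % b).cost = 1 + a.cost + b.cost := rfl
theorem cost_bin (o : BinOp) (a b : Expr) : (bin o a b).cost = 1 + a.cost + b.cost := rfl

/-- Lookup in a constant table: the value of `table f e m` is `f v` if `e` has the value `v < m`,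
and `0` otherwise. -/
def table (f : ℕ → ℕ) (e : Expr) : ℕ → Expr
  | 0 => lit 0
  | m + 1 => (bin .eq e (lit m)) * lit (f m) + table f e m

theorem eval_table {f : ℕ → ℕ} {e : Expr} {m v : ℕ} (hW : 1 < W) (he : e.eval W ρ = v)
    (hm : m ≤ W) (hf : ∀ j < m, f j < W) :
    (table f e m).eval W ρ = if v < m then f v else 0 := by
  induction m with
  | zero => simp [table, eval_lit]
  | succ m ih =>
    rw [table, eval_add, eval_mul, eval_eq, eval_lit, eval_lit, he, ih (by omega)
      (fun j hj => hf j (by omega)), Nat.mod_eq_of_lt (show m < W by omega),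
      Nat.mod_eq_of_lt (hf m (by omega))]
    by_cases h : v = m
    · subst h
      simp [Nat.mod_eq_of_lt hW, Nat.mod_eq_of_lt (hf v (by omega))]
    · rw [if_neg h]
      by_cases h' : v < m
      · simp [h', show v < m + 1 by omega, Nat.mod_eq_of_lt (hf v (by omega))]
      · simp [h', show ¬ v < m + 1 by omega]

end Expr

/-- The two configurations differ at most in the registers listed in `rs` and in the counters. -/
structure SameExcept (rs : List ℕ) (σ τ : Machine) : Prop where
  reg : ∀ r, r ∉ rs → τ.reg r = σ.reg r
  mem : τ.mem = σ.mem
  inp : τ.inp = σ.inp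
  code : τ.code = σ.code
  out : τ.out = σ.out
  writes : τ.writes = σ.writes

/-- The number whose `c` lowest binary digits are `f 0, f 1, …`. -/
def bitsVal (f : ℕ → Bool) : ℕ → ℕ
  | 0 => 0
  | c + 1 => (f 0).toNat + 2 * bitsVal (fun u => f (u + 1)) c

theorem bitsVal_lt (f : ℕ → Bool) (c : ℕ) : bitsVal f c < 2 ^ c := by
  induction c generalizing f with
  | zero => simp [bitsVal]
  | succ c ih =>
    have := ih (fun u => f (u + 1))
    have h2 := Bool.toNat_le (f 0)
    rw [bitsVal, pow_succ]; omega

theorem bitsVal_congr {f g : ℕ → Bool} {c : ℕ} (h : ∀ u < c, f u = g u) :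
    bitsVal f c = bitsVal g c := by
  induction c generalizing f g with
  | zero => rfl
  | succ c ih =>
    rw [bitsVal, bitsVal, h 0 (by omega), ih (fun u hu => h (u + 1) (by omega))]

theorem bitsVal_testBit (v c : ℕ) : bitsVal (fun u => v.testBit u) c = v % 2 ^ c := by
  induction c generalizing v with
  | zero => simp [bitsVal, Nat.mod_one]
  | succ c ih =>
    have : (fun u => v.testBit (u + 1)) = fun u => (v / 2).testBit u := by
      funext u; rw [Nat.testBit_succ]
    rw [bitsVal, this, ih, pow_succ', Nat.mod_mul]
    congr 1
    simp [Nat.testBit_zero]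
    rcases Nat.mod_two_eq_zero_or_one v with h | h <;> simp [h]

/-- `bitsVal f c` computed from the most significant digit. -/
theorem bitsVal_shift (f : ℕ → Bool) (c t : ℕ) :
    bitsVal (fun u => f (t + u)) (c + 1) =
      (f t).toNat + 2 * bitsVal (fun u => f (t + 1 + u)) c := by
  rw [bitsVal]
  congr 3
  funext u
  rw [Nat.add_right_comm, Nat.add_assoc]

/-! Registers: `0`–`3` hold the arguments `n, L, i, s`; `4` the record length; `5` the payload
length `l`; `6` the number `2 ^ l`; `7` the number of blocks; `8` the current block; `9` its queue
position; `10` its flag; `11`, `12`, `13`, `23`, `24`, `25` serve the transfer of bit strings. -/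

/-- Reads the number with `reg 12` binary digits, which stand at the positions
`reg 23 + u * reg 24` of the codeword, into register `11`. -/
def readBits : Prog :=
  .instr (.assign 11 (.lit 0)) ;;
  .loop (.reg 12)
    (.instr (.assign 12 (.reg 12 - .lit 1)) ;;
     .instr (.probe 13 (.reg 23 + .reg 12 * .reg 24)) ;;
     .instr (.assign 11 (.lit 2 * .reg 11 + .reg 13)))

/-- Writes the `reg 25` lowest binary digits of the number in register `11` to the positions
`reg 23 + u * reg 24` of the codeword. -/
def writeBits : Prog :=
  .instr (.assign 12 (.lit 0)) ;;
  .loop (.bin .lt (.reg 12) (.reg 25))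
    (.instr (.write (.reg 23 + .reg 12 * .reg 24) (.reg 11 % .lit 2)) ;;
     .instr (.assign 11 (.reg 11 / .lit 2)) ;;
     .instr (.assign 12 (.reg 12 + .lit 1)))

theorem wp_readBits {W p d c : ℕ} {σ : Machine} {Q : Machine → Prop} (hW : 2 < W)
    (h23 : σ.reg 23 = p) (h24 : σ.reg 24 = d) (h12 : σ.reg 12 = c)
    (hp : p + c * d < W) (hc : 2 ^ c ≤ W)
    (hQ : ∀ τ, SameExcept [11, 12, 13] σ τ →
      τ.reg 11 = bitsVal (fun u => σ.code (p + u * d)) c → τ.reads = σ.reads + c →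
      τ.time ≤ σ.time + 20 * (c + 1) → Q τ) :
    WP W readBits Q σ := by
  have hcW : c < W := lt_of_lt_of_le Nat.lt_two_pow_self hc
  refine .seq (.instr (.loop (fun j τ => SameExcept [11, 12, 13] σ τ ∧ τ.reg 12 = c - j ∧
    τ.reg 11 = bitsVal (fun u => σ.code (p + (c - j + u) * d)) j ∧ τ.reads = σ.reads + j ∧
    τ.time ≤ σ.time + 2 + 20 * j) c ?_ ?_ ?_))
  · refine ⟨⟨fun r hr => ?_, rfl, rfl, rfl, rfl, rfl⟩, ?_, ?_, rfl, ?_⟩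
    · simp at hr; simp [Instr.run, hr]
    · simp [Instr.run, h12]
    · simp [Instr.run, bitsVal, Expr.eval]
    · simp [Instr.run, Expr.cost]
  · rintro j hj τ ⟨hf, h1, h2, h3, h4⟩
    have e23 : τ.reg 23 = p := by rw [hf.reg 23 (by decide), h23]
    have e24 : τ.reg 24 = d := by rw [hf.reg 24 (by decide), h24]
    refine ⟨by rw [Expr.eval_reg, h1]; omega, .seq (.instr (.seq (.instr (.instr ?_))))⟩
    have a1 : (c - j - 1) % W = c - j - 1 := Nat.mod_eq_of_lt (by omega)
    have hle : (c - j - 1) * d ≤ c * d := Nat.mul_le_mul (by omega) le_rfl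
    have a2 : ((c - j - 1) * d) % W = (c - j - 1) * d := Nat.mod_eq_of_lt (by omega)
    have a3 : (p + (c - j - 1) * d) % W = p + (c - j - 1) * d := Nat.mod_eq_of_lt (by omega)
    have hb := bitsVal_lt (fun u => σ.code (p + (c - (j + 1) + u) * d)) (j + 1)
    have hb' : 2 ^ (j + 1) ≤ 2 ^ c := Nat.pow_le_pow_right (by norm_num) (by omega)
    have hrec := bitsVal_shift (fun u => σ.code (p + u * d)) j (c - (j + 1))
    simp only [show c - (j + 1) + 1 = c - j by omega] at hrec
    refine ⟨⟨fun r hr => ?_, ?_, ?_, ?_, ?_, ?_⟩, ?_, ?_, ?_, ?_⟩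
    · simp only [List.mem_cons, List.not_mem_nil, or_false, not_or] at hr
      simp only [Instr.run, Function.update_apply, hr, if_false, Machine.test]
      exact hf.reg r (by simp [hr])
    · exact hf.mem
    · exact hf.inp
    · exact hf.code
    · exact hf.out
    · exact hf.writes
    · simp [Instr.run, Machine.test, Expr.eval_sub, Expr.eval_reg, Expr.eval_lit, h1,
        Nat.mod_eq_of_lt (show 1 < W by omega), Nat.sub_sub]
      exact Nat.mod_eq_of_lt (by omega)
    · rw [hrec] at hb ⊢
      set X := bitsVal (fun u => σ.code (p + (c - j + u) * d)) j with hX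
      have hbit := Bool.toNat_le (σ.code (p + (c - (j + 1)) * d))
      simp [Instr.run, Machine.test, Expr.eval_sub, Expr.eval_add, Expr.eval_mul, Expr.eval_reg,
        Expr.eval_lit, h1, h2, e23, e24, hf.code, Nat.mod_eq_of_lt (show 1 < W by omega), a1, a2,
        a3,
        Nat.mod_eq_of_lt hW]
      rw [show c - j - 1 = c - (j + 1) by omega, Nat.mod_eq_of_lt (by omega)]
      omega
    · simp [Instr.run, Machine.test, h3]; omega
    · simp [Instr.run, Machine.test, Expr.cost_add, Expr.cost_sub, Expr.cost_mul, Expr.cost_reg,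
        Expr.cost_lit]; omega
  · rintro τ ⟨hf, h1, h2, h3, h4⟩
    refine ⟨by rw [Expr.eval_reg, h1]; omega, hQ _ ⟨hf.1, hf.2, hf.3, hf.4, hf.5, hf.6⟩ ?_ h3 ?_⟩
    · simp only [Machine.test]; rw [h2]; simp
    · simp [Machine.test, Expr.cost_reg]; omega

theorem wp_writeBits {W p d c v : ℕ} {σ : Machine} {Q : Machine → Prop} (hW : 2 < W)
    (h23 : σ.reg 23 = p) (h24 : σ.reg 24 = d) (h25 : σ.reg 25 = c) (h11 : σ.reg 11 = v)
    (hd : 0 < d) (hp : p + c * d < W) (hv : v < W)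
    (hQ : ∀ τ, (∀ r, r ∉ [11, 12] → τ.reg r = σ.reg r) → τ.mem = σ.mem → τ.inp = σ.inp →
      τ.out = σ.out → τ.reads = σ.reads → τ.writes = σ.writes + c →
      τ.time ≤ σ.time + 30 * (c + 1) →
      (∀ u < c, τ.code (p + u * d) = v.testBit u) →
      (∀ m, (∀ u < c, m ≠ p + u * d) → τ.code m = σ.code m) → Q τ) :
    WP W writeBits Q σ := by
  have hcd : c ≤ c * d := Nat.le_mul_of_pos_right c hd
  refine .seq (.instr (.loop (fun j τ => (∀ r, r ∉ [11, 12] → τ.reg r = σ.reg r) ∧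
    τ.mem = σ.mem ∧ τ.inp = σ.inp ∧ τ.out = σ.out ∧ τ.reads = σ.reads ∧
    τ.writes = σ.writes + j ∧ τ.time ≤ σ.time + 2 + 30 * j ∧ τ.reg 12 = j ∧
    τ.reg 11 = v / 2 ^ j ∧ (∀ u < j, τ.code (p + u * d) = v.testBit u) ∧
    (∀ m, (∀ u < j, m ≠ p + u * d) → τ.code m = σ.code m)) c ?_ ?_ ?_))
  · refine ⟨fun r hr => ?_, rfl, rfl, rfl, rfl, rfl, ?_, ?_, ?_, ?_, ?_⟩
    · simp at hr; simp [Instr.run, hr]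
    · simp [Instr.run, Expr.cost]
    · simp [Instr.run, Expr.eval]
    · simp [Instr.run, h11]
    · simp
    · intro m _; rfl
  · rintro j hj τ ⟨hf, hm, hi, ho, hr, hw, ht, h12, h11', hc1, hc2⟩
    have e23 : τ.reg 23 = p := by rw [hf 23 (by decide), h23]
    have e24 : τ.reg 24 = d := by rw [hf 24 (by decide), h24]
    have e25 : τ.reg 25 = c := by rw [hf 25 (by decide), h25]
    refine ⟨by simp [Expr.eval_lt, Expr.eval_reg, h12, e25, hj,
      Nat.mod_eq_of_lt (show 1 < W by omega)], .seq (.instr (.seq (.instr (.instr ?_))))⟩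
    have hle : j * d ≤ c * d := Nat.mul_le_mul hj.le le_rfl
    have a2 : (j * d) % W = j * d := Nat.mod_eq_of_lt (by omega)
    have a3 : (p + j * d) % W = p + j * d := Nat.mod_eq_of_lt (by omega)
    have a4 : v / 2 ^ j < W := lt_of_le_of_lt (Nat.div_le_self _ _) hv
    have a5 : v / 2 ^ j % 2 < W := by omega
    have a6 : v / 2 ^ j / 2 < W := by omega
    refine ⟨fun r hr => ?_, hm, hi, ho, hr, ?_, ?_, ?_, ?_, ?_, ?_⟩
    · simp only [List.mem_cons, List.not_mem_nil, or_false, not_or] at hr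
      simp only [Instr.run, Function.update_apply, hr, if_false, Machine.test]
      exact hf r (by simp [hr])
    · simp [Instr.run, Machine.test, hw]; omega
    · simp [Instr.run, Machine.test, Expr.cost_add, Expr.cost_mul, Expr.cost_reg,
        Expr.cost_lit, Expr.cost_mod, Expr.cost_div, Expr.cost_bin]; omega
    · simp [Instr.run, Machine.test, Expr.eval_add, Expr.eval_reg, Expr.eval_lit, h12,
        Nat.mod_eq_of_lt (show 1 < W by omega), Nat.mod_eq_of_lt (show j + 1 < W by omega)]
    · simp [Instr.run, Machine.test, Expr.eval_div, Expr.eval_reg, Expr.eval_lit, h11',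
        Nat.mod_eq_of_lt hW, Nat.mod_eq_of_lt a6]
      rw [Nat.div_div_eq_div_mul, pow_succ]
    · intro u hu
      simp only [Instr.run, Machine.test, Expr.eval_add, Expr.eval_mul, Expr.eval_mod,
        Expr.eval_reg, Expr.eval_lit, h12, e23, e24, h11', a2, a3, Nat.mod_eq_of_lt hW,
        Nat.mod_eq_of_lt a5, Function.update_apply]
      by_cases huj : u = j
      · subst huj
        simp [Nat.testBit_eq_decide_div_mod_eq]
      · rw [if_neg, hc1 u (by omega)]
        intro h
        exact huj (Nat.eq_of_mul_eq_mul_right hd (by omega))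
    · intro m hm'
      simp only [Instr.run, Machine.test, Expr.eval_add, Expr.eval_mul, Expr.eval_mod,
        Expr.eval_reg, Expr.eval_lit, h12, e23, e24, h11', a2, a3, Nat.mod_eq_of_lt hW,
        Nat.mod_eq_of_lt a5, Function.update_apply]
      rw [if_neg (hm' j (by omega))]
      exact hc2 m fun u hu => hm' u (by omega)
  · rintro τ ⟨hf, hm, hi, ho, hr, hw, ht, h12, h11', hc1, hc2⟩
    have e25 : τ.reg 25 = c := by rw [hf 25 (by decide), h25]
    refine ⟨by simp [Expr.eval_lt, Expr.eval_reg, h12, e25], hQ _ hf hm hi ho hr hw ?_ hc1 hc2⟩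
    simp [Machine.test, Expr.cost_reg, Expr.cost_bin]; omega

/-! ### The queue of overflowing bits and the codeword -/

/-- Position of the queue after `j` blocks, if it is `p₀` before block `k₀` and if `a k` tells
whether block `k` overflows.  Every overflowing block reserves the next `β` spare bits; block `k`
may only use spare bits of the records `k, k + 1, …`. -/
def queuePos (β : ℕ) (a : ℕ → ℕ) (k₀ p₀ : ℕ) : ℕ → ℕ
  | 0 => p₀
  | j + 1 => max (queuePos β a k₀ p₀ j + β * a (k₀ + j)) (k₀ + j + 1)

theorem queuePos_add (β : ℕ) (a : ℕ → ℕ) (k j : ℕ) :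
    queuePos β a k (queuePos β a 0 0 k) j = queuePos β a 0 0 (k + j) := by
  induction j with
  | zero => rfl
  | succ j ih => rw [← Nat.add_assoc, queuePos, queuePos, ih, Nat.zero_add]

theorem queuePos_congr {β : ℕ} {a a' : ℕ → ℕ} {k₀ p₀ j : ℕ}
    (h : ∀ u < j, a (k₀ + u) = a' (k₀ + u)) :
    queuePos β a k₀ p₀ j = queuePos β a' k₀ p₀ j := by
  induction j with
  | zero => rfl
  | succ j ih => rw [queuePos, queuePos, ih fun u hu => h u (by omega), h j (by omega)]

theorem queuePos_add_le_succ (β : ℕ) (a : ℕ → ℕ) (k₀ p₀ j : ℕ) :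
    queuePos β a k₀ p₀ j + β * a (k₀ + j) ≤ queuePos β a k₀ p₀ (j + 1) := le_max_left _ _

theorem queuePos_mono (β : ℕ) (a : ℕ → ℕ) (k₀ p₀ : ℕ) : Monotone (queuePos β a k₀ p₀) :=
  monotone_nat_of_le_succ fun j =>
    le_trans (Nat.le_add_right _ _) (queuePos_add_le_succ β a k₀ p₀ j)

theorem le_queuePos {β : ℕ} {a : ℕ → ℕ} {k₀ p₀ : ℕ} (h : k₀ ≤ p₀) (j : ℕ) :
    k₀ + j ≤ queuePos β a k₀ p₀ j := by
  cases j with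
  | zero => exact h
  | succ j => exact le_max_right _ _

/-- Position of the queue before block `k`, found by scanning the busy flags `f` to the left. -/
def scanPos (β : ℕ) (a : ℕ → ℕ) (f : ℕ → Bool) : ℕ → ℕ
  | 0 => 0
  | k + 1 => if f (k + 1) then scanPos β a f k + β * a k else k + 1

/-- Length of the scan to the left from block `k`. -/
def scanLen (f : ℕ → Bool) : ℕ → ℕ
  | 0 => 0
  | k + 1 => if f (k + 1) then scanLen f k + 1 else 0

theorem scanLen_le (f : ℕ → Bool) (k : ℕ) : scanLen f k ≤ k := by
  induction k with
  | zero => rfl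
  | succ k ih => rw [scanLen]; split <;> omega

theorem scanPos_le (β : ℕ) {a : ℕ → ℕ} (f : ℕ → Bool) (ha : ∀ k, a k ≤ 1) (k : ℕ) :
    scanPos β a f k ≤ (β + 1) * k := by
  induction k with
  | zero => simp [scanPos]
  | succ k ih =>
    rw [scanPos]
    have := Nat.mul_le_mul_left β (ha k)
    split <;> nlinarith

theorem le_scanPos_add (β : ℕ) (a : ℕ → ℕ) (f : ℕ → Bool) (k : ℕ) :
    k ≤ scanPos β a f k + scanLen f k := by
  induction k with
  | zero => simp
  | succ k ih => rw [scanPos, scanLen]; split <;> omega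

/-- Scanning correct busy flags finds the position of the queue. -/
theorem scanPos_eq {β : ℕ} {a : ℕ → ℕ} {f : ℕ → Bool} {k : ℕ}
    (hf : ∀ j ≤ k, f j = decide (j < queuePos β a 0 0 j)) :
    scanPos β a f k = queuePos β a 0 0 k := by
  induction k with
  | zero => rfl
  | succ k ih =>
    rw [scanPos, hf (k + 1) le_rfl, ih fun j hj => hf j (by omega), queuePos, Nat.zero_add]
    simp only [decide_eq_true_eq]
    split <;> omega

theorem scanPos_congr {β : ℕ} {a a' : ℕ → ℕ} {f f' : ℕ → Bool} {k : ℕ}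
    (ha : ∀ j < k, a j = a' j) (hf : ∀ j ≤ k, f j = f' j) :
    scanPos β a f k = scanPos β a' f' k := by
  induction k with
  | zero => rfl
  | succ k ih =>
    rw [scanPos, scanPos, hf _ le_rfl, ha k (by omega),
      ih (fun j hj => ha j (by omega)) (fun j hj => hf j (by omega))]

theorem scanLen_congr {f f' : ℕ → Bool} {k : ℕ} (hf : ∀ j ≤ k, f j = f' j) :
    scanLen f k = scanLen f' k := by
  induction k with
  | zero => rfl
  | succ k ih => rw [scanLen, scanLen, hf _ le_rfl, ih fun j hj => hf j (by omega)]

/-- `1` if the block with number `r k` does not fit into `l` bits, `0` otherwise. -/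
def overflows (l : ℕ) (r : ℕ → ℕ) (k : ℕ) : ℕ := if 2 ^ l ≤ r k then 1 else 0

theorem overflows_le_one (l : ℕ) (r : ℕ → ℕ) (k : ℕ) : overflows l r k ≤ 1 := by
  rw [overflows]; split <;> omega

theorem overflows_eq_one {l : ℕ} {r : ℕ → ℕ} {k : ℕ} : overflows l r k = 1 ↔ 2 ^ l ≤ r k := by
  rw [overflows]; split <;> simp_all

open Classical in
/-- The codeword of the sequence `r` of block numbers, for `N` blocks and records of `H` bits.
Record `k` consists of the overflow flag of block `k`, the busy flag of the queue, a spare bit and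
the low bits of `r k`.  The high bits of an overflowing number are in the spare bits that the
queue assigns to it. -/
noncomputable def codeImage (H l β N : ℕ) (r : ℕ → ℕ) (m : ℕ) : Bool :=
  if m % H = 0 then decide (2 ^ l ≤ r (m / H))
  else if m % H = 1 then
    decide (m / H < N ∧ m / H < queuePos β (overflows l r) 0 0 (m / H))
  else if m % H = 2 then
    decide (∃ k, 2 ^ l ≤ r k ∧ queuePos β (overflows l r) 0 0 k ≤ m / H ∧
      m / H < queuePos β (overflows l r) 0 0 k + β ∧
      (r k / 2 ^ l).testBit (m / H - queuePos β (overflows l r) 0 0 k) = true)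
  else (r (m / H)).testBit (m % H - 3)

section Record

variable {H l β N : ℕ} {r r' : ℕ → ℕ}

theorem record_div (k : ℕ) {o : ℕ} (h : o < H) : (k * H + o) / H = k := by
  rw [mul_comm, Nat.mul_add_div (by omega), Nat.div_eq_of_lt h, Nat.add_zero]

theorem record_mod (k : ℕ) {o : ℕ} (h : o < H) : (k * H + o) % H = o := by
  rw [mul_comm, Nat.mul_add_mod, Nat.mod_eq_of_lt h]

/-- The spare bits of different blocks are disjoint. -/
theorem queuePos_spare_le {k k' : ℕ} (hk : 2 ^ l ≤ r k) (h : k < k') :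
    queuePos β (overflows l r) 0 0 k + β ≤ queuePos β (overflows l r) 0 0 k' := by
  have h1 := queuePos_add_le_succ β (overflows l r) 0 0 k
  rw [Nat.zero_add, overflows_eq_one.2 hk, Nat.mul_one] at h1
  exact h1.trans (queuePos_mono β _ 0 0 h)

theorem codeImage_flag (hH : 3 ≤ H) (k : ℕ) :
    codeImage H l β N r (k * H) = decide (2 ^ l ≤ r k) := by
  have h1 := record_mod (H := H) k (o := 0) (by omega)
  have h2 := record_div (H := H) k (o := 0) (by omega)
  rw [Nat.add_zero] at h1 h2
  simp only [codeImage, h1, h2, if_true]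

theorem codeImage_busy (hH : 3 ≤ H) {k : ℕ} (hk : k < N) :
    codeImage H l β N r (k * H + 1) = decide (k < queuePos β (overflows l r) 0 0 k) := by
  simp [codeImage, record_mod k (show 1 < H by omega), record_div k (show 1 < H by omega), hk]

theorem codeImage_spare (hH : 3 ≤ H) {k u : ℕ} (hk : 2 ^ l ≤ r k) (hu : u < β) :
    codeImage H l β N r ((queuePos β (overflows l r) 0 0 k + u) * H + 2) =
      (r k / 2 ^ l).testBit u := by
  rw [codeImage, record_mod _ (show 2 < H by omega), record_div _ (show 2 < H by omega)]
  rw [if_neg (by omega), if_neg (by omega), if_pos rfl, Bool.eq_iff_iff,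
    @decide_eq_true_eq _ (Classical.propDecidable _)]
  constructor
  · rintro ⟨k', h1, h2, h3, h4⟩
    obtain rfl : k' = k := by
      rcases lt_trichotomy k k' with h | h | h
      · have := queuePos_spare_le (β := β) hk h; omega
      · exact h.symm
      · have := queuePos_spare_le (β := β) h1 h; omega
    rwa [Nat.add_sub_cancel_left] at h4
  · intro h
    exact ⟨k, hk, by omega, by omega, by rwa [Nat.add_sub_cancel_left]⟩

theorem codeImage_payload {l k u : ℕ} (hu : u < l) :
    codeImage (l + 3) l β N r (k * (l + 3) + 3 + u) = (r k).testBit u := by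
  have h1 := record_mod k (show 3 + u < l + 3 by omega)
  have h2 := record_div k (show 3 + u < l + 3 by omega)
  rw [← Nat.add_assoc] at h1 h2
  simp only [codeImage, h1, h2]
  rw [if_neg (by omega), if_neg (by omega), if_neg (by omega), Nat.add_sub_cancel_left]

/-- The number of block `k` that the decoder reads if the queue is at position `p`. -/
def readBlock (H l β : ℕ) (c : ℕ → Bool) (p k : ℕ) : ℕ :=
  bitsVal (fun u => c (k * H + 3 + u)) l +
    2 ^ l * bitsVal (fun u => c ((p + u) * H + 2)) (β * (c (k * H)).toNat)

theorem readBlock_eq {c : ℕ → Bool} {L k : ℕ} (hc : ∀ m < L, c m = codeImage (l + 3) l β N r m)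
    (hr : r k < 2 ^ (l + β)) (hk : k * (l + 3) + (l + 3) ≤ L)
    (hp : overflows l r k = 1 →
      (queuePos β (overflows l r) 0 0 k + β) * (l + 3) ≤ L) :
    readBlock (l + 3) l β c (queuePos β (overflows l r) 0 0 k) k = r k := by
  have h1 : bitsVal (fun u => c (k * (l + 3) + 3 + u)) l = r k % 2 ^ l := by
    rw [← bitsVal_testBit]
    refine bitsVal_congr fun u hu => ?_
    rw [hc _ (by omega), codeImage_payload hu]
  rw [readBlock, h1, hc _ (by omega), codeImage_flag (by omega)]
  by_cases h : 2 ^ l ≤ r k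
  · have h2 : bitsVal (fun u => c ((queuePos β (overflows l r) 0 0 k + u) * (l + 3) + 2))
        (β * (decide (2 ^ l ≤ r k)).toNat) = r k / 2 ^ l := by
      rw [← Nat.mod_eq_of_lt (show r k / 2 ^ l < 2 ^ β by
        rw [Nat.div_lt_iff_lt_mul (by positivity), ← pow_add, add_comm]; exact hr),
        ← bitsVal_testBit]
      simp only [h, decide_true, Bool.toNat_true, Nat.mul_one]
      refine bitsVal_congr fun u hu => ?_
      have h3 := hp (overflows_eq_one.2 h)
      have h4 : (queuePos β (overflows l r) 0 0 k + u + 1) * (l + 3) ≤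
        (queuePos β (overflows l r) 0 0 k + β) * (l + 3) := Nat.mul_le_mul_right _ (by omega)
      rw [hc _ (by rw [Nat.succ_mul] at h4; omega), codeImage_spare (by omega) h hu]
    rw [h2, Nat.mod_add_div]
  · simp [h, bitsVal, Nat.mod_eq_of_lt (not_le.1 h)]

open Classical in
/-- The codeword `c` after the records `k₀, …, k₀ + m - 1` have been rewritten for the block
numbers `r`, with the queue at position `p₀` before block `k₀`, and the spare bits of the records
`p₀, …, p₁ - 1` have been replaced. -/
noncomputable def rewriteCode (H l β : ℕ) (c : ℕ → Bool) (r : ℕ → ℕ) (k₀ p₀ p₁ m : ℕ)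
    (x : ℕ) : Bool :=
  if x % H = 2 then
    if p₀ ≤ x / H ∧ x / H < p₁ then
      decide (∃ j < m, 2 ^ l ≤ r (k₀ + j) ∧ queuePos β (overflows l r) k₀ p₀ j ≤ x / H ∧
        x / H < queuePos β (overflows l r) k₀ p₀ j + β ∧
        (r (k₀ + j) / 2 ^ l).testBit (x / H - queuePos β (overflows l r) k₀ p₀ j) = true)
    else c x
  else if k₀ ≤ x / H ∧ x / H < k₀ + m then
    if x % H = 0 then decide (2 ^ l ≤ r (x / H))
    else if x % H = 1 then
      decide (x / H < queuePos β (overflows l r) k₀ p₀ (x / H - k₀))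
    else (r (x / H)).testBit (x % H - 3)
  else c x

/-- Rewriting up to a block where the old and the new queue agree gives the codeword of the new
sequence. -/
theorem rewriteCode_eq {c : ℕ → Bool} {L k₀ m : ℕ}
    (hc : ∀ x < L, c x = codeImage H l β N r x)
    (hlt : ∀ k < k₀, r k = r' k) (hge : ∀ k, k₀ + m ≤ k → r k = r' k)
    (hN : k₀ + m ≤ N) (hz : ∀ k, N ≤ k → r k = 0) (hz' : ∀ k, N ≤ k → r' k = 0)
    (hend : k₀ + m < N → queuePos β (overflows l r) 0 0 (k₀ + m) =
      queuePos β (overflows l r') 0 0 (k₀ + m)) {x : ℕ} (hx : x < L) :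
    rewriteCode H l β c r' k₀ (queuePos β (overflows l r) 0 0 k₀)
      (max (queuePos β (overflows l r) 0 0 (k₀ + m))
        (queuePos β (overflows l r') 0 0 (k₀ + m))) m x = codeImage H l β N r' x := by
  have hov : ∀ k, r k = r' k → overflows l r k = overflows l r' k := fun k hk => by
    rw [overflows, overflows, hk]
  -- the two queues agree up to block `k₀` and from block `k₀ + m` on
  have hQlt : ∀ k ≤ k₀, queuePos β (overflows l r) 0 0 k = queuePos β (overflows l r') 0 0 k :=
    fun k hk => queuePos_congr fun u hu => by rw [Nat.zero_add]; exact hov u (hlt u (by omega))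
  have hQge : k₀ + m < N → ∀ k, k₀ + m ≤ k →
      queuePos β (overflows l r) 0 0 k = queuePos β (overflows l r') 0 0 k := by
    intro h k hk
    obtain ⟨j, rfl⟩ := Nat.exists_eq_add_of_le hk
    rw [← queuePos_add β (overflows l r), ← queuePos_add β (overflows l r'), hend h]
    exact queuePos_congr fun u hu => hov _ (hge _ (by omega))
  have hpos : ∀ (r : ℕ → ℕ), (∀ k, N ≤ k → r k = 0) → ∀ k, 2 ^ l ≤ r k → k < N := by
    intro r hz k hk
    by_contra h
    rw [hz k (not_lt.1 h)] at hk
    exact absurd hk (by simp)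
  have hQ : ∀ j, queuePos β (overflows l r') k₀ (queuePos β (overflows l r) 0 0 k₀) j =
      queuePos β (overflows l r') 0 0 (k₀ + j) := fun j => by
    rw [hQlt k₀ le_rfl, queuePos_add]
  have hold := hc x hx
  by_cases h2 : x % H = 2
  · simp only [rewriteCode, if_pos h2, hQ]
    have h20 : ¬ x % H = 0 := by omega
    have h21 : ¬ x % H = 1 := by omega
    simp only [codeImage, if_pos h2, if_neg h20, if_neg h21] at hold ⊢
    split
    · rename_i hp
      rw [decide_eq_decide]
      constructor
      · rintro ⟨j, -, h⟩
        exact ⟨k₀ + j, h⟩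
      · rintro ⟨k, h, h', h'', h'''⟩
        have hk0 : k₀ ≤ k := by
          by_contra hk
          have := queuePos_spare_le (β := β) h (not_le.1 hk)
          rw [← hQlt k₀ le_rfl] at this
          omega
        have hkm : k < k₀ + m := by
          by_contra hk
          have hkN := hpos r' hz' k h
          have h3 := queuePos_mono β (overflows l r') 0 0 (not_lt.1 hk)
          have h4 := hend (by omega)
          rw [h4, max_self] at hp
          omega
        obtain ⟨j, rfl⟩ := Nat.exists_eq_add_of_le hk0
        exact ⟨j, by omega, h, h', h'', h'''⟩
    · rename_i hp
      rw [hold, decide_eq_decide]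
      have key : ∀ k, (k < k₀ ∨ (k₀ + m ≤ k ∧ k₀ + m < N)) → (r k = r' k ∧
        queuePos β (overflows l r) 0 0 k = queuePos β (overflows l r') 0 0 k) := by
        rintro k (hk | ⟨hk, hkN⟩)
        · exact ⟨hlt k hk, hQlt k hk.le⟩
        · exact ⟨hge k hk, hQge hkN k hk⟩
      constructor
      · rintro ⟨k, h, h', h'', h'''⟩
        have hk : k < k₀ ∨ (k₀ + m ≤ k ∧ k₀ + m < N) := by
          by_contra hcon
          have hkN := hpos r hz k h
          have h3 := queuePos_mono β (overflows l r) 0 0 (show k₀ ≤ k by omega)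
          have h4 := queuePos_spare_le (β := β) h (show k < k₀ + m by omega)
          omega
        obtain ⟨e1, e2⟩ := key k hk
        rw [e1] at h h'''
        rw [e2] at h' h'' h'''
        exact ⟨k, h, h', h'', h'''⟩
      · rintro ⟨k, h, h', h'', h'''⟩
        have hk : k < k₀ ∨ (k₀ + m ≤ k ∧ k₀ + m < N) := by
          by_contra hcon
          have hkN := hpos r' hz' k h
          have h3 := queuePos_mono β (overflows l r') 0 0 (show k₀ ≤ k by omega)
          have h4 := queuePos_spare_le (β := β) h (show k < k₀ + m by omega)
          rw [← hQlt k₀ le_rfl] at h3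
          omega
        obtain ⟨e1, e2⟩ := key k hk
        rw [← e1] at h h'''
        rw [← e2] at h' h'' h'''
        exact ⟨k, h, h', h'', h'''⟩
  · simp only [rewriteCode, if_neg h2]
    split
    · rename_i hk
      simp only [codeImage, if_neg h2, hQ, show k₀ + (x / H - k₀) = x / H by omega]
      split
      · rfl
      · split
        · simp [show x / H < N by omega]
        · rfl
    · rename_i hk
      rw [hold]
      simp only [codeImage, if_neg h2]
      have hrx : r (x / H) = r' (x / H) := by
        by_cases h : x / H < k₀
        · exact hlt _ h
        · exact hge _ (by omega)
      rw [hrx]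
      split
      · rfl
      · split
        · by_cases h : x / H < N
          · have : queuePos β (overflows l r) 0 0 (x / H) =
                queuePos β (overflows l r') 0 0 (x / H) := by
              by_cases h' : x / H < k₀
              · exact hQlt _ h'.le
              · exact hQge (by omega) _ (by omega)
            rw [this]
          · simp [h]
        · rfl

end Record

/-! ### The programs -/

/-- The constants of the programs: block length `b`, alphabet size `q`, number `β` of spare bits
for an overflowing block, largest admissible payload length `lmax`, and a numbering `rank` of the
blocks with its inverse `unrank`; blocks are written as numbers below `q ^ b`. -/
structure Coder where
  b : ℕ
  q : ℕ
  β : ℕ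
  lmax : ℕ
  rank : ℕ → ℕ
  unrank : ℕ → ℕ

namespace Coder

/-- Record length and payload length, their power of two, and the range `reg 22, …, reg 14 - 1`
of the blocks that meet the fragment. -/
def setup (D : Coder) : Prog :=
  .instr (.assign 7 (.reg 0 / .lit D.b + .lit 1)) ;;
  .instr (.assign 4 (.reg 1 / (.reg 0 / .lit (D.b - 1)))) ;;
  .instr (.assign 5 (.reg 4 - .lit 3)) ;;
  .instr (.assign 6 (.table (2 ^ ·) (.reg 5) (D.lmax + 1))) ;;
  .instr (.assign 14 ((.reg 2 + .reg 3 - .lit 1) / .lit D.b + .lit 1)) ;;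
  .instr (.assign 22 (.reg 2 / .lit D.b)) ;;
  .instr (.assign 8 (.reg 22))

/-- Scans the busy flags to the left of block `reg 8 = reg 22` and puts the position of the queue
into register `9`. -/
def scanLeft (D : Coder) : Prog :=
  .instr (.assign 26 (.lit 0)) ;;
  .instr (.probe 13 (.reg 8 * .reg 4 + .lit 1)) ;;
  .loop (.reg 13 * .reg 8)
    (.instr (.assign 8 (.reg 8 - .lit 1)) ;;
     .instr (.probe 10 (.reg 8 * .reg 4)) ;;
     .instr (.assign 26 (.reg 26 + .reg 10)) ;;
     .instr (.probe 13 (.reg 8 * .reg 4 + .lit 1))) ;;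
  .instr (.assign 9 (.reg 8 + .lit D.β * .reg 26)) ;;
  .instr (.assign 8 (.reg 22))

/-- Reads block `reg 8`, with the queue at position `reg 9`, into register `16`. -/
def loadBlock (D : Coder) : Prog :=
  .instr (.probe 10 (.reg 8 * .reg 4)) ;;
  .instr (.assign 23 (.reg 8 * .reg 4 + .lit 3)) ;;
  .instr (.assign 24 (.lit 1)) ;;
  .instr (.assign 12 (.reg 5)) ;;
  readBits ;;
  .instr (.assign 15 (.reg 11)) ;;
  .instr (.assign 23 (.reg 9 * .reg 4 + .lit 2)) ;;
  .instr (.assign 24 (.reg 4)) ;;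
  .instr (.assign 12 (.lit D.β * .reg 10)) ;;
  readBits ;;
  .instr (.assign 15 (.reg 15 + .reg 6 * .reg 11)) ;;
  .instr (.assign 16 (.table D.unrank (.reg 15) (D.q ^ D.b)))

/-- The values that the fixed registers hold after `setup`. -/
structure Env (D : Coder) (n L i s l : ℕ) (σ : Machine) : Prop where
  r0 : σ.reg 0 = n
  r1 : σ.reg 1 = L
  r2 : σ.reg 2 = i
  r3 : σ.reg 3 = s
  r4 : σ.reg 4 = l + 3
  r5 : σ.reg 5 = l
  r6 : σ.reg 6 = 2 ^ l
  r7 : σ.reg 7 = n / D.b + 1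
  r14 : σ.reg 14 = (i + s - 1) / D.b + 1
  r22 : σ.reg 22 = i / D.b

theorem Env.congr {D : Coder} {n L i s l : ℕ} {σ τ : Machine} (h : Env D n L i s l σ)
    (hr : ∀ r ∈ [0, 1, 2, 3, 4, 5, 6, 7, 14, 22], τ.reg r = σ.reg r) : Env D n L i s l τ :=
  ⟨by rw [hr _ (by simp), h.r0], by rw [hr _ (by simp), h.r1], by rw [hr _ (by simp), h.r2],
    by rw [hr _ (by simp), h.r3], by rw [hr _ (by simp), h.r4], by rw [hr _ (by simp), h.r5],
    by rw [hr _ (by simp), h.r6], by rw [hr _ (by simp), h.r7], by rw [hr _ (by simp), h.r14],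
    by rw [hr _ (by simp), h.r22]⟩

/-- All numbers that occur are at most `S`, and products of two of them are words. -/
structure Room (D : Coder) (W n L l S : ℕ) : Prop where
  word : 16 * (S * S) ≤ W
  two_le : 2 ≤ S
  b_pos : 2 ≤ D.b
  q_pos : 1 ≤ D.q
  n_le : n ≤ S
  L_le : L ≤ S
  l_le : l ≤ D.lmax
  lmax_le : 2 ^ D.lmax ≤ S
  recLen : L / (n / (D.b - 1)) = l + 3
  fits : (n / D.b + 1) * (l + 3) ≤ L
  b_le : D.b ≤ S
  q_le : D.q ≤ S
  pow_le : D.q ^ D.b ≤ S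
  β_le : 2 ^ D.β ≤ S
  pos_le : (D.β + 1) * (n / D.b + 1) + D.β ≤ S
  rank_lt : ∀ v < D.q ^ D.b, D.rank v < D.q ^ D.b
  unrank_lt : ∀ v, D.unrank v < D.q ^ D.b
  unrank_eq_zero : ∀ v, D.q ^ D.b ≤ v → D.unrank v = 0

variable {D : Coder} {W n L i s l S : ℕ} {σ : Machine} {Q : Machine → Prop}

/-- The overflow flag of block `k` in the codeword `c` with records of `H` bits. -/
def flag (H : ℕ) (c : ℕ → Bool) (k : ℕ) : ℕ := (c (k * H)).toNat

/-- The busy flag of record `k`. -/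
def busy (H : ℕ) (c : ℕ → Bool) (k : ℕ) : Bool := c (k * H + 1)

theorem flag_le (H : ℕ) (c : ℕ → Bool) (k : ℕ) : flag H c k ≤ 1 := Bool.toNat_le _

theorem Room.lt_word (h : Room D W n L l S) {x : ℕ} (hx : x ≤ 15 * (S * S)) : x < W := by
  have := h.word
  have := Nat.mul_le_mul h.two_le h.two_le
  omega

theorem Room.le_word (h : Room D W n L l S) {x : ℕ} (hx : x ≤ 7 * S) : x < W := by
  refine h.lt_word (hx.trans ?_)
  have := Nat.mul_le_mul_right S h.two_le
  omega

theorem Room.H_le (h : Room D W n L l S) : l + 3 ≤ S :=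
  h.recLen ▸ (Nat.div_le_self _ _).trans h.L_le

theorem Room.pow_l_le (h : Room D W n L l S) : 2 ^ l ≤ S :=
  (Nat.pow_le_pow_right (by norm_num) h.l_le).trans h.lmax_le

theorem wp_setup (h : Room D W n L l S) (hi : i + s ≤ n) (hs : 1 ≤ s)
    (h0 : σ.reg 0 = n) (h1 : σ.reg 1 = L) (h2 : σ.reg 2 = i) (h3 : σ.reg 3 = s)
    (hQ : ∀ τ, Env D n L i s l τ → τ.reg 8 = i / D.b → τ.mem = σ.mem → τ.inp = σ.inp →
      τ.code = σ.code → τ.out = σ.out → τ.reads = σ.reads → τ.writes = σ.writes →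
      τ.time ≤ σ.time + 50 + (Expr.table (2 ^ ·) (.reg 5) (D.lmax + 1)).cost → Q τ) :
    WP W D.setup Q σ := by
  have hn := h.n_le
  have hb := h.b_le
  have hl := h.l_le
  have hH := h.H_le
  have m1 : ∀ x ≤ 7 * S, x % W = x := fun x hx => Nat.mod_eq_of_lt (h.le_word hx)
  have hS2 := h.two_le
  have d1 : n / D.b ≤ n := Nat.div_le_self _ _
  have d2 : n / (D.b - 1) ≤ n := Nat.div_le_self _ _
  have d3 : (i + s - 1) / D.b ≤ i + s - 1 := Nat.div_le_self _ _
  have d4 : i / D.b ≤ i := Nat.div_le_self _ _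
  have d5 : 2 ^ l ≤ S := h.pow_l_le
  have hlm : 2 ^ D.lmax < W := h.le_word (by have := h.lmax_le; omega)
  have ht : ∀ ρ : ℕ → ℕ, ρ 5 = l → (Expr.table (2 ^ ·) (.reg 5) (D.lmax + 1)).eval W ρ = 2 ^ l := by
    intro ρ hρ
    rw [Expr.eval_table (v := l) (h.le_word (by omega)) (show Expr.eval W ρ (.reg 5) = l from hρ)
      (le_trans Nat.lt_two_pow_self hlm.le)]
    · rw [if_pos (by omega)]
    · intro j hj
      exact lt_of_le_of_lt (Nat.pow_le_pow_right (by norm_num) (by omega)) hlm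
  refine .seq (.instr (.seq (.instr (.seq (.instr (.seq (.instr (.seq (.instr (.seq
    (.instr (.instr ?_))))))))))))
  refine hQ _ ⟨?_, ?_, ?_, ?_, ?_, ?_, ?_, ?_, ?_, ?_⟩ ?_ rfl rfl rfl rfl rfl rfl ?_
  · simp [Instr.run, h0]
  · simp [Instr.run, h1]
  · simp [Instr.run, h2]
  · simp [Instr.run, h3]
  · simp [Instr.run, Expr.eval_div, Expr.eval_lit, Expr.eval_reg, h0, h1,
      m1 (D.b - 1) (by omega), m1 (n / (D.b - 1)) (by omega), h.recLen, m1 (l + 3) (by omega)]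
  · simp [Instr.run, Expr.eval_div, Expr.eval_sub, Expr.eval_lit, Expr.eval_reg, h0, h1,
      m1 (D.b - 1) (by omega), m1 (n / (D.b - 1)) (by omega), h.recLen, m1 (l + 3) (by omega),
      m1 3 (by omega), m1 l (by omega)]
  · simp only [Instr.run]
    rw [Function.update_of_ne (by norm_num), Function.update_of_ne (by norm_num),
      Function.update_of_ne (by norm_num), Function.update_self, ht, m1 _ (by omega)]
    simp [Expr.eval_div, Expr.eval_sub, Expr.eval_lit, Expr.eval_reg, h0, h1,
      m1 (D.b - 1) (by omega), m1 (n / (D.b - 1)) (by omega), h.recLen, m1 (l + 3) (by omega),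
      m1 3 (by omega), m1 l (by omega)]
  · simp [Instr.run, Expr.eval_div, Expr.eval_add, Expr.eval_lit, Expr.eval_reg, h0,
      m1 D.b (by omega), m1 (n / D.b) (by omega), m1 1 (by omega), m1 (n / D.b + 1) (by omega)]
  · simp [Instr.run, Expr.eval_div, Expr.eval_add, Expr.eval_sub, Expr.eval_lit, Expr.eval_reg, h2,
      h3, m1 D.b (by omega), m1 1 (by omega), m1 (i + s) (by omega), m1 (i + s - 1) (by omega),
      m1 ((i + s - 1) / D.b) (by omega), m1 ((i + s - 1) / D.b + 1) (by omega)]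
  · simp [Instr.run, Expr.eval_div, Expr.eval_lit, Expr.eval_reg, h2, m1 D.b (by omega),
      m1 (i / D.b) (by omega)]
  · simp [Instr.run, Expr.eval_div, Expr.eval_lit, Expr.eval_reg, h2, m1 D.b (by omega),
      m1 (i / D.b) (by omega)]
  · simp [Instr.run, Expr.cost_add, Expr.cost_sub, Expr.cost_div, Expr.cost_reg, Expr.cost_lit]
    omega

/-- The scan starts from arbitrary codeword bits: what it computes is the position of the queue only
if the busy flags are correct, see `scanPos_eq`. -/
theorem wp_scanLeft (h : Room D W n L l S) (hi : i ≤ n) (hE : Env D n L i s l σ)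
    (h8 : σ.reg 8 = i / D.b)
    (hQ : ∀ τ, SameExcept [8, 9, 10, 13, 26] σ τ → τ.reg 8 = i / D.b →
      τ.reg 9 = scanPos D.β (flag (l + 3) σ.code) (busy (l + 3) σ.code) (i / D.b) →
      τ.reads = σ.reads + 1 + 2 * scanLen (busy (l + 3) σ.code) (i / D.b) →
      τ.time ≤ σ.time + 50 * (scanLen (busy (l + 3) σ.code) (i / D.b) + 1) → Q τ) :
    WP W D.scanLeft Q σ := by
  have hH := h.H_le
  have hS2 := h.two_le
  have hfit := h.fits
  have hL := h.L_le
  have hn := h.n_le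
  have m1 : ∀ x ≤ 7 * S, x % W = x := fun x hx => Nat.mod_eq_of_lt (h.le_word hx)
  have m2 : ∀ x ≤ 15 * (S * S), x % W = x := fun x hx => Nat.mod_eq_of_lt (h.lt_word hx)
  have hk1n : i / D.b ≤ n / D.b := Nat.div_le_div_right hi
  have hnb : n / D.b ≤ n := Nat.div_le_self _ _
  have hpos := h.pos_le
  set k₁ := i / D.b with hk₁
  set a := flag (l + 3) σ.code with ha
  set f := busy (l + 3) σ.code with hf
  have hrec : ∀ k ≤ k₁, k * (l + 3) + (l + 3) ≤ S := by
    intro k hk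
    have : (k + 1) * (l + 3) ≤ (n / D.b + 1) * (l + 3) := Nat.mul_le_mul_right _ (by omega)
    rw [Nat.succ_mul] at this
    omega
  have hlen := scanLen_le f k₁
  refine .seq (.instr (.seq (.instr (.seq (.loop (fun j τ =>
    SameExcept [8, 10, 13, 26] σ τ ∧ τ.reg 8 = k₁ - j ∧ τ.reg 13 = (f (k₁ - j)).toNat ∧
    scanLen f k₁ = scanLen f (k₁ - j) + j ∧ τ.reg 26 ≤ j ∧
    scanPos D.β a f k₁ = scanPos D.β a f (k₁ - j) + D.β * τ.reg 26 ∧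
    τ.reads = σ.reads + 1 + 2 * j ∧ τ.time ≤ σ.time + 10 + 40 * j) (scanLen f k₁) ?_ ?_ ?_)))))
  · refine ⟨⟨fun r hr => ?_, rfl, rfl, rfl, rfl, rfl⟩, ?_, ?_, ?_, ?_, ?_, ?_, ?_⟩
    · simp at hr; simp [Instr.run, hr]
    · simp [Instr.run, h8]
    · have := hrec k₁ le_rfl
      have hb := Bool.toNat_le (σ.code (k₁ * (l + 3) + 1))
      simp [Instr.run, Expr.eval_add, Expr.eval_mul, Expr.eval_reg, Expr.eval_lit, h8, hE.r4,
        m1 (k₁ * (l + 3)) (by omega), m1 1 (by omega), m1 (k₁ * (l + 3) + 1) (by omega), hf, busy]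
      exact m1 _ (by omega)
    · simp
    · simp [Instr.run, Expr.eval]
    · simp [Instr.run, Expr.eval]
    · simp [Instr.run]
    · simp [Instr.run, Expr.cost_add, Expr.cost_mul, Expr.cost_reg, Expr.cost_lit]
  · rintro j hj τ ⟨hs, e8, e13, hL1, e26, hP, hR, hT⟩
    obtain ⟨k, hk⟩ : ∃ k, k₁ - j = k + 1 := by
      refine Nat.exists_eq_succ_of_ne_zero fun h0 => ?_
      rw [h0, scanLen] at hL1; omega
    have hfk : f (k + 1) = true := by
      by_contra hfk
      rw [hk, scanLen, if_neg hfk] at hL1; omega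
    rw [hk, scanLen, if_pos hfk] at hL1
    rw [hk, scanPos, if_pos hfk] at hP
    rw [hk] at e8
    rw [hk, hfk] at e13
    have hk' : k₁ - (j + 1) = k := by omega
    have e4 : τ.reg 4 = l + 3 := by rw [hs.reg 4 (by decide), hE.r4]
    refine ⟨?_, .seq (.instr (.seq (.instr (.seq (.instr (.instr ?_))))))⟩
    · simp only [Expr.eval_mul, Expr.eval_reg, e8, e13, Bool.toNat_true]
      rw [m1 _ (by omega)]; omega
    have := hrec k (by omega)
    have hb := Bool.toNat_le (σ.code (k * (l + 3) + 1))
    have hb' := Bool.toNat_le (σ.code (k * (l + 3)))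
    have hak : a k = (σ.code (k * (l + 3))).toNat := rfl
    refine ⟨⟨fun r hr => ?_, ?_, ?_, ?_, ?_, ?_⟩, ?_, ?_, ?_, ?_, ?_, ?_, ?_⟩
    · simp only [List.mem_cons, List.not_mem_nil, or_false, not_or] at hr
      simp only [Instr.run, Function.update_apply, hr, if_false, Machine.test]
      exact hs.reg r (by simp [hr])
    · exact hs.mem
    · exact hs.inp
    · exact hs.code
    · exact hs.out
    · exact hs.writes
    · simp [Instr.run, Machine.test, Expr.eval_sub, Expr.eval_reg, Expr.eval_lit, e8, hk',
        m1 1 (by omega), m1 k (by omega)]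
    · simp [Instr.run, Machine.test, Expr.eval_sub, Expr.eval_add, Expr.eval_mul, Expr.eval_reg,
        Expr.eval_lit, e8, hk', e4, hs.code, m1 1 (by omega), m1 k (by omega),
        m1 (k * (l + 3)) (by omega), m1 (k * (l + 3) + 1) (by omega), hf, busy]
      exact m1 _ (by omega)
    · rw [hk']; omega
    · simp [Instr.run, Machine.test, Expr.eval_sub, Expr.eval_add, Expr.eval_mul, Expr.eval_reg,
        Expr.eval_lit, e8, e4, hs.code, m1 1 (by omega), m1 k (by omega),
        m1 (k * (l + 3)) (by omega)]
      rw [m1 _ (by omega)]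
      omega
    · rw [hP, hk', hak]
      simp [Instr.run, Machine.test, Expr.eval_sub, Expr.eval_add, Expr.eval_mul, Expr.eval_reg,
        Expr.eval_lit, e8, e4, hs.code, m1 1 (by omega), m1 k (by omega),
        m1 (k * (l + 3)) (by omega)]
      rw [m1 _ (by omega)]
      ring
    · simp [Instr.run, Machine.test, hR]; ring
    · simp [Instr.run, Machine.test, Expr.cost_add, Expr.cost_sub, Expr.cost_mul, Expr.cost_reg,
        Expr.cost_lit]; omega
  · rintro τ ⟨hs, e8, e13, hL1, e26, hP, hR, hT⟩
    set m := scanLen f k₁ with hm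
    have hzero : scanLen f (k₁ - m) = 0 := by omega
    have h_idle : (f (k₁ - m)).toNat * (k₁ - m) = 0 ∧ scanPos D.β a f (k₁ - m) = k₁ - m := by
      generalize k₁ - m = k at hzero
      cases k with
      | zero => simp [scanPos]
      | succ k =>
        rw [scanLen] at hzero
        by_cases hfk : f (k + 1) = true
        · rw [if_pos hfk] at hzero; omega
        · rw [scanPos, if_neg hfk]; simp [hfk]
    rw [h_idle.2] at hP
    have hle := scanPos_le D.β f (flag_le (l + 3) σ.code) k₁
    rw [← ha] at hle
    have hmul : (D.β + 1) * k₁ ≤ (D.β + 1) * (n / D.b + 1) := Nat.mul_le_mul_left _ (by omega)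
    have hβ : D.β ≤ S := by omega
    refine ⟨?_, .seq (.instr (.instr (hQ _ ⟨fun r hr => ?_, hs.mem, hs.inp, hs.code, hs.out,
      hs.writes⟩ ?_ ?_ ?_ ?_)))⟩
    · simp only [Expr.eval_mul, Expr.eval_reg, e8, e13, h_idle.1, Nat.zero_mod]
    · simp only [List.mem_cons, List.not_mem_nil, or_false, not_or] at hr
      simp only [Instr.run, Function.update_apply, hr, if_false, Machine.test]
      exact hs.reg r (by simp [hr])
    · simp [Instr.run, Machine.test, Expr.eval_reg, hs.reg 22, hE.r22]
      exact m1 _ (by omega)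
    · simp [Instr.run, Machine.test, Expr.eval_add, Expr.eval_mul, Expr.eval_reg, Expr.eval_lit,
        e8, m1 D.β (by omega), m1 (D.β * τ.reg 26) (by omega),
        m1 (k₁ - m + D.β * τ.reg 26) (by omega)]
      exact hP.symm
    · simp [Instr.run, Machine.test, hR]
    · simp [Instr.run, Machine.test, Expr.cost_add, Expr.cost_mul, Expr.cost_reg, Expr.cost_lit]
      omega

/-- A bound for the time of `loadBlock`. -/
def loadTime (D : Coder) : ℕ :=
  20 * (D.lmax + 1) + 20 * (D.β + 1) + (Expr.table D.unrank (.reg 15) (D.q ^ D.b)).cost + 50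

theorem wp_loadBlock {k p : ℕ} (h : Room D W n L l S) (hE : Env D n L i s l σ)
    (h8 : σ.reg 8 = k) (hk : k ≤ n / D.b) (h9 : σ.reg 9 = p) (hp : p ≤ (D.β + 1) * (n / D.b + 1))
    (hQ : ∀ τ, SameExcept [10, 11, 12, 13, 15, 16, 23, 24] σ τ →
      τ.reg 10 = flag (l + 3) σ.code k →
      τ.reg 16 = D.unrank (readBlock (l + 3) l D.β σ.code p k) →
      τ.reads = σ.reads + 1 + l + D.β * flag (l + 3) σ.code k →
      τ.time ≤ σ.time + D.loadTime → Q τ) :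
    WP W D.loadBlock Q σ := by
  have hH := h.H_le
  have hS2 := h.two_le
  have hfit := h.fits
  have hL := h.L_le
  have hn := h.n_le
  have hpos := h.pos_le
  have hl := h.l_le
  have hpl := h.pow_l_le
  have hpb := h.pow_le
  have hβ2 := h.β_le
  have m1 : ∀ x ≤ 7 * S, x % W = x := fun x hx => Nat.mod_eq_of_lt (h.le_word hx)
  have m2 : ∀ x ≤ 15 * (S * S), x % W = x := fun x hx => Nat.mod_eq_of_lt (h.lt_word hx)
  have hSS : 2 * S ≤ S * S := Nat.mul_le_mul_right S hS2
  have hrec : k * (l + 3) + (l + 3) ≤ S := by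
    have : (k + 1) * (l + 3) ≤ (n / D.b + 1) * (l + 3) := Nat.mul_le_mul_right _ (by omega)
    rw [Nat.succ_mul] at this
    omega
  have hspare : (p + D.β) * (l + 3) ≤ S * S := Nat.mul_le_mul (by omega) hH
  rw [Nat.add_mul] at hspare
  have ha1 := flag_le (l + 3) σ.code k
  have haβ : D.β * flag (l + 3) σ.code k ≤ D.β := by
    have := Nat.mul_le_mul_left D.β ha1; omega
  have hflag : (σ.code (k * (l + 3))).toNat = flag (l + 3) σ.code k := rfl
  refine .seq (.instr (.seq (.instr (.seq (.instr (.seq (.instr (.seq (wp_readBits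
    (p := k * (l + 3) + 3) (d := 1) (c := l) (h.le_word (by omega)) ?_ ?_ ?_ ?_ ?_ ?_)))))))))
  · simp [Instr.run, Expr.eval_add, Expr.eval_mul, Expr.eval_reg, Expr.eval_lit, h8, hE.r4,
      m1 (k * (l + 3)) (by omega), m1 3 (by omega), m1 (k * (l + 3) + 3) (by omega)]
  · simp [Instr.run, Expr.eval_lit, m1 1 (by omega)]
  · simp [Instr.run, Expr.eval_reg, hE.r5, m1 l (by omega)]
  · exact h.le_word (by omega)
  · exact (h.le_word (by omega)).le
  intro τ hs hacc hreads htime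
  have e10 : τ.reg 10 = flag (l + 3) σ.code k := by
    rw [hs.reg 10 (by decide)]
    simp [Instr.run, Expr.eval_mul, Expr.eval_reg, h8, hE.r4, m1 (k * (l + 3)) (by omega), hflag,
      m1 (flag (l + 3) σ.code k) (by omega)]
  have hregs : ∀ r, r ∉ [10, 11, 12, 13, 23, 24] → τ.reg r = σ.reg r := by
    intro r hr
    simp only [List.mem_cons, List.not_mem_nil, or_false, not_or] at hr
    rw [hs.reg r (by simp [hr])]
    simp [Instr.run, hr]
  have ecode : τ.code = σ.code := hs.code
  have hlo := bitsVal_lt (fun u => σ.code (k * (l + 3) + 3 + u)) l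
  have eacc : τ.reg 11 = bitsVal (fun u => σ.code (k * (l + 3) + 3 + u)) l := by
    rw [hacc]; simp [Instr.run]
  have ereads : τ.reads = σ.reads + 1 + l := by rw [hreads]; rfl
  have etime : τ.time ≤ σ.time + 20 + 20 * (l + 1) := by
    refine htime.trans ?_
    simp [Instr.run, Expr.cost_add, Expr.cost_mul, Expr.cost_reg, Expr.cost_lit]
  refine .seq (.instr (.seq (.instr (.seq (.instr (.seq (.instr (.seq (wp_readBits
    (p := p * (l + 3) + 2) (d := l + 3) (c := D.β * flag (l + 3) σ.code k)
    (h.le_word (by omega)) ?_ ?_ ?_ ?_ ?_ ?_)))))))))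
  · have : p * (l + 3) ≤ S * S := by omega
    simp [Instr.run, Expr.eval_add, Expr.eval_mul, Expr.eval_reg, Expr.eval_lit,
      hregs 9, hregs 4, h9, hE.r4, m2 (p * (l + 3)) (by omega), m1 2 (by omega),
      m2 (p * (l + 3) + 2) (by omega)]
  · simp [Instr.run, Expr.eval_reg, hregs 4, hE.r4, m1 (l + 3) (by omega)]
  · simp [Instr.run, Expr.eval_mul, Expr.eval_lit, Expr.eval_reg, e10, m1 D.β (by omega),
      m1 (D.β * flag (l + 3) σ.code k) (by omega)]
  · have := Nat.mul_le_mul_right (l + 3) haβ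
    exact h.lt_word (by omega)
  · exact (Nat.pow_le_pow_right (by norm_num) haβ).trans (h.le_word (by omega)).le
  intro τ' hs' hacc' hreads' htime'
  have eacc' : τ'.reg 11 = bitsVal (fun u => σ.code ((p + u) * (l + 3) + 2))
      (D.β * flag (l + 3) σ.code k) := by
    rw [hacc']
    refine bitsVal_congr fun u _ => ?_
    simp only [Instr.run, ecode]
    congr 1; ring
  have hhi := bitsVal_lt (fun u => σ.code ((p + u) * (l + 3) + 2)) (D.β * flag (l + 3) σ.code k)
  have hhi' : 2 ^ (D.β * flag (l + 3) σ.code k) ≤ 2 ^ D.β :=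
    Nat.pow_le_pow_right (by norm_num) haβ
  have e15 : τ'.reg 15 = bitsVal (fun u => σ.code (k * (l + 3) + 3 + u)) l := by
    rw [hs'.reg 15 (by decide)]
    simp [Instr.run, Expr.eval_reg, eacc]
    exact m1 _ (by omega)
  have e6 : τ'.reg 6 = 2 ^ l := by
    rw [hs'.reg 6 (by decide)]
    simp [Instr.run, hregs 6, hE.r6]
  have hprod : 2 ^ l * bitsVal (fun u => σ.code ((p + u) * (l + 3) + 2))
      (D.β * flag (l + 3) σ.code k) ≤ S * S := Nat.mul_le_mul hpl (by omega)
  have hread : (Expr.reg 15 + Expr.reg 6 * Expr.reg 11).eval W τ'.reg =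
      readBlock (l + 3) l D.β σ.code p k ∧ readBlock (l + 3) l D.β σ.code p k < W := by
    rw [Expr.eval_add, Expr.eval_mul, Expr.eval_reg, Expr.eval_reg, Expr.eval_reg, e15, e6, eacc',
      readBlock, hflag]
    set B := bitsVal (fun u => σ.code ((p + u) * (l + 3) + 2)) (D.β * flag (l + 3) σ.code k)
    set B' := bitsVal (fun u => σ.code (k * (l + 3) + 3 + u)) l
    rw [m2 (2 ^ l * B) (by omega), m2 (B' + 2 ^ l * B) (by omega)]
    exact ⟨rfl, h.lt_word (by omega)⟩
  refine .seq (.instr (.instr ?_))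
  refine hQ _ ⟨fun r hr => ?_, ?_, ?_, ?_, ?_, ?_⟩ ?_ ?_ ?_ ?_
  · simp only [List.mem_cons, List.not_mem_nil, or_false, not_or] at hr
    simp only [Instr.run, Function.update_apply, hr, if_false]
    rw [hs'.reg r (by simp [hr])]
    simp only [Instr.run, Function.update_apply, hr, if_false]
    exact hregs r (by simp [hr])
  · exact hs'.mem.trans hs.mem
  · exact hs'.inp.trans hs.inp
  · exact hs'.code.trans hs.code
  · exact hs'.out.trans hs.out
  · exact hs'.writes.trans hs.writes
  · simp only [Instr.run]
    rw [Function.update_of_ne (by norm_num), Function.update_of_ne (by norm_num),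
      hs'.reg 10 (by decide)]
    simp [Instr.run, e10]
  · simp only [Instr.run]
    rw [Function.update_self, Expr.eval_table (v := readBlock (l + 3) l D.β σ.code p k)
      (h.le_word (by omega)) _ (h.le_word (by omega)).le
      (fun j _ => lt_of_lt_of_le (h.unrank_lt j) (h.le_word (by omega)).le)]
    · have hu := h.unrank_lt (readBlock (l + 3) l D.β σ.code p k)
      split
      · exact m1 _ (by omega)
      · rename_i hge
        rw [h.unrank_eq_zero _ (not_lt.1 hge), Nat.zero_mod]
    · rw [Expr.eval_reg, Function.update_self, hread.1, Nat.mod_eq_of_lt hread.2]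
  · simp only [Instr.run, hreads', ereads]
  · simp only [Instr.run, Expr.cost_add, Expr.cost_mul, Expr.cost_reg, Expr.cost_lit] at htime' ⊢
    rw [loadTime]
    omega

end Coder

namespace Coder

/-! ### The local decoder -/

/-- Outputs the symbols of the block in register `16` that belong to the fragment. -/
def outputBlock (D : Coder) : Prog :=
  .instr (.assign 12 (.lit 0)) ;;
  .loop (.bin .lt (.reg 12) (.lit D.b))
    (.instr (.assign 20 (.reg 8 * .lit D.b + .reg 12)) ;;
     .ite ((.lit 1 - .bin .lt (.reg 20) (.reg 2)) * .bin .lt (.reg 20) (.reg 2 + .reg 3))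
       (.instr (.output (.reg 20 - .reg 2) (.reg 16 % .lit D.q)))
       (.instr (.assign 13 (.lit 0))) ;;
     .instr (.assign 16 (.reg 16 / .lit D.q)) ;;
     .instr (.assign 12 (.reg 12 + .lit 1)))

/-- The position of the queue before block `reg 8 + 1`, if `p` is its position before block
`reg 8` and `e` the overflow flag of this block; the maximum is `u + (v - u)`. -/
def advance (D : Coder) (p : ℕ) (e : Expr) : Expr :=
  (.reg p + .lit D.β * e) + ((.reg 8 + .lit 1) - (.reg p + .lit D.β * e))

/-- Finds the position of the queue at the first block of the fragment, then reads and outputs the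
blocks that meet the fragment. -/
def localDecoder (D : Coder) : Prog :=
  D.setup ;; D.scanLeft ;;
  .loop (.bin .lt (.reg 8) (.reg 14))
    (D.loadBlock ;; D.outputBlock ;;
     .instr (.assign 9 (D.advance 9 (.reg 10))) ;;
     .instr (.assign 8 (.reg 8 + .lit 1)))

variable {D : Coder} {W n L i s l S : ℕ} {σ : Machine} {Q : Machine → Prop}

theorem wp_outputBlock {k v : ℕ} (h : Room D W n L l S) (hE : Env D n L i s l σ)
    (hi : i + s ≤ n) (h8 : σ.reg 8 = k) (hk : k ≤ n / D.b) (h16 : σ.reg 16 = v) (hv : v ≤ S)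
    (hQ : ∀ τ, (∀ r, r ∉ [12, 13, 16, 20] → τ.reg r = σ.reg r) → τ.inp = σ.inp →
      τ.code = σ.code → τ.reads = σ.reads → τ.time ≤ σ.time + 60 * (D.b + 1) →
      (∀ x, τ.out x = if k * D.b ≤ i + x ∧ i + x < k * D.b + D.b ∧ x < s then
        v / D.q ^ (i + x - k * D.b) % D.q else σ.out x) → Q τ) :
    WP W D.outputBlock Q σ := by
  have hS2 := h.two_le
  have hn := h.n_le
  have hb := h.b_le
  have hq := h.q_le
  have hq1 := h.q_pos
  have m1 : ∀ x ≤ 7 * S, x % W = x := fun x hx => Nat.mod_eq_of_lt (h.le_word hx)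
  have hkb : k * D.b ≤ n := le_trans (Nat.mul_le_mul_right _ hk) (Nat.div_mul_le_self _ _)
  refine .seq (.instr (.loop (fun t τ => (∀ r, r ∉ [12, 13, 16, 20] → τ.reg r = σ.reg r) ∧
    τ.inp = σ.inp ∧ τ.code = σ.code ∧ τ.reads = σ.reads ∧ τ.time ≤ σ.time + 2 + 50 * t ∧
    τ.reg 12 = t ∧ τ.reg 16 = v / D.q ^ t ∧
    (∀ x, τ.out x = if k * D.b ≤ i + x ∧ i + x < k * D.b + t ∧ x < s then
        v / D.q ^ (i + x - k * D.b) % D.q else σ.out x)) D.b ?_ ?_ ?_))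
  · refine ⟨fun r hr => ?_, rfl, rfl, rfl, ?_, ?_, ?_, fun x => ?_⟩
    · simp at hr; simp [Instr.run, hr]
    · simp [Instr.run, Expr.cost]
    · simp [Instr.run, Expr.eval]
    · simp [Instr.run, h16]
    · rw [if_neg (by omega)]; rfl
  · rintro t ht τ ⟨hr, hinp, hcode, hreads, htime, h12, h16', hout⟩
    have e2 : τ.reg 2 = i := by rw [hr 2 (by decide), hE.r2]
    have e3 : τ.reg 3 = s := by rw [hr 3 (by decide), hE.r3]
    have e8 : τ.reg 8 = k := by rw [hr 8 (by decide), h8]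
    have hvt : v / D.q ^ t ≤ v := Nat.div_le_self _ _
    have hvt' : v / D.q ^ t / D.q ≤ v / D.q ^ t := Nat.div_le_self _ _
    have hvq : v / D.q ^ t % D.q ≤ v / D.q ^ t := Nat.mod_le _ _
    have e20 : (Expr.reg 8 * Expr.lit D.b + Expr.reg 12).eval W τ.reg = k * D.b + t := by
      rw [Expr.eval_add, Expr.eval_mul, Expr.eval_reg, Expr.eval_reg, Expr.eval_lit, e8, h12,
        m1 D.b (by omega), m1 (k * D.b) (by omega), m1 _ (by omega)]
    refine ⟨by simp [Expr.eval_lt, Expr.eval_reg, Expr.eval_lit, h12, m1 D.b (by omega), ht,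
      m1 1 (by omega)], .seq (.instr (.seq (.ite (fun hc => .instr ?_) (fun hc => .instr ?_))))⟩
    · have hc' : i ≤ k * D.b + t ∧ k * D.b + t < i + s := by
        simp only [Expr.eval_mul, Expr.eval_sub, Expr.eval_add, Expr.eval_lt, Expr.eval_lit,
          Expr.eval_reg, Instr.run, Function.update_self, Machine.test, e20,
          Function.update_of_ne (show (2 : ℕ) ≠ 20 by norm_num),
          Function.update_of_ne (show (3 : ℕ) ≠ 20 by norm_num), e2, e3, m1 (i + s) (by omega),
          m1 1 (by omega), m1 (k * D.b + t) (by omega)] at hc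
        by_contra hcon
        apply hc
        by_cases h1 : k * D.b + t < i
        · simp [h1, m1 1 (by omega)]
        · simp [show ¬ (k * D.b + t < i + s) by omega]
      refine .seq (.instr (.instr ⟨fun r hr' => ?_, hinp, hcode, hreads, ?_, ?_, ?_, fun x => ?_⟩))
      · simp only [List.mem_cons, List.not_mem_nil, or_false, not_or] at hr'
        simp only [Instr.run, Function.update_apply, hr', if_false, Machine.test]
        exact hr r (by simp [hr'])
      · simp [Instr.run, Machine.test, Expr.cost_add, Expr.cost_sub, Expr.cost_mul, Expr.cost_reg,
          Expr.cost_lit, Expr.cost_div, Expr.cost_mod, Expr.cost_bin]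
        omega
      · simp [Instr.run, Machine.test, Expr.eval_add, Expr.eval_reg, Expr.eval_lit, h12,
          m1 1 (by omega), m1 (t + 1) (by omega)]
      · simp [Instr.run, Machine.test, Expr.eval_div, Expr.eval_reg, Expr.eval_lit, h16',
          m1 D.q (by omega), m1 _ (hvt'.trans (by omega))]
        rw [Nat.div_div_eq_div_mul, pow_succ]
      · simp only [Instr.run, Machine.test, Expr.eval_sub, Expr.eval_mod, Expr.eval_lit,
          Expr.eval_reg, Function.update_self,
          Function.update_of_ne (show (2 : ℕ) ≠ 20 by norm_num),
          Function.update_of_ne (show (16 : ℕ) ≠ 20 by norm_num), e20, e2, h16',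
          m1 D.q (by omega), m1 _ (hvq.trans (by omega)), m1 (k * D.b + t) (by omega),
          m1 (k * D.b + t - i) (by omega)]
        by_cases hx : x = k * D.b + t - i
        · subst hx
          rw [Function.update_self, if_pos (by omega),
            show i + (k * D.b + t - i) - k * D.b = t by omega]
        · rw [Function.update_of_ne hx, hout]
          congr 1
          rw [eq_iff_iff]; omega
    · have hc' : ¬ (i ≤ k * D.b + t ∧ k * D.b + t < i + s) := by
        rintro ⟨h1, h2⟩
        simp [Expr.eval_mul, Expr.eval_sub, Expr.eval_add, Expr.eval_lt, Expr.eval_lit,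
          Expr.eval_reg, Instr.run, Machine.test, e20, e2, e3, m1 (i + s) (by omega),
          m1 1 (by omega), m1 (k * D.b + t) (by omega), h2, not_lt.2 h1] at hc
      refine .seq (.instr (.instr ⟨fun r hr' => ?_, hinp, hcode, hreads, ?_, ?_, ?_, fun x => ?_⟩))
      · simp only [List.mem_cons, List.not_mem_nil, or_false, not_or] at hr'
        simp only [Instr.run, Function.update_apply, hr', if_false, Machine.test]
        exact hr r (by simp [hr'])
      · simp [Instr.run, Machine.test, Expr.cost_add, Expr.cost_sub, Expr.cost_mul, Expr.cost_reg,
          Expr.cost_lit, Expr.cost_div, Expr.cost_bin]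
        omega
      · simp [Instr.run, Machine.test, Expr.eval_add, Expr.eval_reg, Expr.eval_lit, h12,
          m1 1 (by omega), m1 (t + 1) (by omega)]
      · simp [Instr.run, Machine.test, Expr.eval_div, Expr.eval_reg, Expr.eval_lit, h16',
          m1 D.q (by omega), m1 _ (hvt'.trans (by omega))]
        rw [Nat.div_div_eq_div_mul, pow_succ]
      · simp only [Instr.run, Machine.test, hout]
        congr 1
        rw [eq_iff_iff]; omega
  · rintro τ ⟨hr, hinp, hcode, hreads, htime, h12, h16', hout⟩
    refine ⟨by simp [Expr.eval_lt, Expr.eval_reg, Expr.eval_lit, h12, m1 D.b (by omega)],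
      hQ _ hr hinp hcode hreads ?_ hout⟩
    simp [Machine.test, Expr.cost_reg, Expr.cost_lit, Expr.cost_bin]; omega

theorem eval_advance {ρ : ℕ → ℕ} {p k x a : ℕ} {e : Expr} (h : Room D W n L l S)
    (h8 : ρ 8 = k) (hk : k ≤ n / D.b) (hp : ρ p = x) (hx : x ≤ (D.β + 1) * k) (he : e.eval W ρ = a)
    (ha : a ≤ 1) : (D.advance p e).eval W ρ = max (x + D.β * a) (k + 1) ∧
      max (x + D.β * a) (k + 1) ≤ (D.β + 1) * (k + 1) ∧ (D.β + 1) * (k + 1) ≤ S := by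
  have m1 : ∀ x ≤ 7 * S, x % W = x := fun x hx => Nat.mod_eq_of_lt (h.le_word hx)
  have hS2 := h.two_le
  have hpos := h.pos_le
  have h1 : (D.β + 1) * (k + 1) ≤ (D.β + 1) * (n / D.b + 1) := Nat.mul_le_mul_left _ (by omega)
  have h2 : D.β * a ≤ D.β := by
    have := Nat.mul_le_mul_left D.β ha; omega
  have h4 : k ≤ D.β * k + k := Nat.le_add_left _ _
  have h3 : (D.β + 1) * (k + 1) = D.β * k + k + D.β + 1 := by ring
  rw [Nat.add_mul, Nat.one_mul] at hx
  refine ⟨?_, max_le (by omega) (by omega), by omega⟩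
  simp only [advance, Expr.eval_add, Expr.eval_sub, Expr.eval_mul, Expr.eval_lit, Expr.eval_reg,
    h8, hp, he]
  rw [m1 D.β (by omega), m1 (D.β * a) (by omega), m1 (x + D.β * a) (by omega),
    m1 1 (by omega), m1 (k + 1) (by omega), m1 (k + 1 - _) (by omega), m1 _ (by omega)]
  omega

theorem queuePos_le_mul {β : ℕ} {a : ℕ → ℕ} {k₀ p₀ : ℕ} (ha : ∀ k, a k ≤ 1)
    (hp : p₀ ≤ (β + 1) * k₀) (j : ℕ) : queuePos β a k₀ p₀ j ≤ (β + 1) * (k₀ + j) := by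
  induction j with
  | zero => exact hp
  | succ j ih =>
    have := Nat.mul_le_mul_left β (ha (k₀ + j))
    have h4 : k₀ + j ≤ (β + 1) * (k₀ + j) := Nat.le_mul_of_pos_left _ (by omega)
    have h3 : (β + 1) * (k₀ + (j + 1)) = (β + 1) * (k₀ + j) + β + 1 := by ring
    rw [queuePos, h3]
    exact max_le (by omega) (by omega)

/-- The queue position before block `k` that is found from the codeword `c` by scanning left from
block `k₀` and then advancing block by block. -/
def foundPos (D : Coder) (l : ℕ) (c : ℕ → Bool) (k₀ : ℕ) (j : ℕ) : ℕ :=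
  queuePos D.β (flag (l + 3) c) k₀ (scanPos D.β (flag (l + 3) c) (busy (l + 3) c) k₀) j

/-- The symbol at position `x` as decoded from the codeword `c`, scanning left from block `k₀`. -/
def foundSymbol (D : Coder) (l : ℕ) (c : ℕ → Bool) (k₀ x : ℕ) : ℕ :=
  D.unrank (readBlock (l + 3) l D.β c (D.foundPos l c k₀ (x / D.b - k₀)) (x / D.b)) /
    D.q ^ (x % D.b) % D.q

/-- A bound for the time per block of the local decoder. -/
def decodeTime (D : Coder) : ℕ :=
  D.loadTime + 60 * (D.b + 1) + 100 + (Expr.table (2 ^ ·) (.reg 5) (D.lmax + 1)).cost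

theorem wp_localDecoder (h : Room D W n L l S) (hi : i + s ≤ n) (hs : 1 ≤ s)
    (h0 : σ.reg 0 = n) (h1 : σ.reg 1 = L) (h2 : σ.reg 2 = i) (h3 : σ.reg 3 = s)
    (hQ : ∀ τ m, i / D.b + m = (i + s - 1) / D.b + 1 → τ.code = σ.code →
      (∀ x < s, τ.out x = D.foundSymbol l σ.code (i / D.b) (i + x)) →
      τ.reads = σ.reads + 1 + 2 * scanLen (busy (l + 3) σ.code) (i / D.b) +
        ∑ j ∈ Finset.range m, (1 + l + D.β * flag (l + 3) σ.code (i / D.b + j)) →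
      m ≤ τ.time →
      τ.time ≤ σ.time +
        D.decodeTime * (scanLen (busy (l + 3) σ.code) (i / D.b) + m + 1) → Q τ) :
    WP W D.localDecoder Q σ := by
  refine .seq (wp_setup h hi hs h0 h1 h2 h3 fun σ₁ hE₁ e8₁ _ _ hc₁ ho₁ hr₁ _ ht₁ => ?_)
  refine .seq (wp_scanLeft h (by omega) hE₁ e8₁ fun σ₂ hs₂ e8₂ e9₂ hr₂ ht₂ => ?_)
  have hS2 := h.two_le
  have hn := h.n_le
  have hb2 := h.b_pos
  have hnb : n / D.b ≤ n := Nat.div_le_self _ _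
  have m1 : ∀ x ≤ 7 * S, x % W = x := fun x hx => Nat.mod_eq_of_lt (h.le_word hx)
  have hle : i / D.b ≤ (i + s - 1) / D.b := Nat.div_le_div_right (by omega)
  have hle' : (i + s - 1) / D.b ≤ n / D.b := Nat.div_le_div_right (by omega)
  have hE₂ : Env D n L i s l σ₂ := hE₁.congr fun r hr => hs₂.reg r (by
    simp at hr ⊢; omega)
  have hi0 : i / D.b * D.b ≤ i := Nat.div_mul_le_self _ _
  rw [hc₁] at e9₂ hr₂ ht₂
  have hc₂ : σ₂.code = σ.code := by rw [hs₂.code, hc₁]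
  have hp0 := scanPos_le D.β (busy (l + 3) σ.code) (flag_le (l + 3) σ.code) (i / D.b)
  have hdt : D.decodeTime = D.loadTime + 60 * (D.b + 1) + 100 +
    (Expr.table (2 ^ ·) (.reg 5) (D.lmax + 1)).cost := rfl
  have hfp : ∀ j, D.foundPos l σ.code (i / D.b) j ≤ (D.β + 1) * (i / D.b + j) :=
    queuePos_le_mul (flag_le _ _) hp0
  refine .loop_time (fun j τ => Env D n L i s l τ ∧ τ.reg 8 = i / D.b + j ∧
    τ.reg 9 = D.foundPos l σ.code (i / D.b) j ∧ τ.code = σ.code ∧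
    τ.reads = σ₂.reads + ∑ u ∈ Finset.range j, (1 + l + D.β * flag (l + 3) σ.code (i / D.b + u)) ∧
    τ.time ≤ σ₂.time + D.decodeTime * j ∧
    (∀ x < s, i + x < (i / D.b + j) * D.b →
      τ.out x = D.foundSymbol l σ.code (i / D.b) (i + x))) ((i + s - 1) / D.b + 1 - i / D.b)
    ?_ ?_ ?_
  · exact ⟨hE₂, e8₂, e9₂, hc₂, by simp, by simp, fun x _ hx => absurd hx (by simp; omega)⟩
  · rintro j hj τ ⟨hE, e8, e9, hc, hr, ht, hout⟩
    have hkn : i / D.b + j ≤ n / D.b := by omega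
    have hfl := flag_le (l + 3) σ.code (i / D.b + j)
    refine ⟨by rw [Expr.eval_lt, Expr.eval_reg, Expr.eval_reg, e8, hE.r14, if_pos (by omega),
      m1 1 (by omega)]; norm_num, ?_⟩
    refine .seq (wp_loadBlock (k := i / D.b + j) (p := D.foundPos l σ.code (i / D.b) j) h
      (hE.congr fun r _ => rfl) e8 hkn e9 ((hfp j).trans (Nat.mul_le_mul_left _ (by omega)))
      fun τ₁ hs₁ e10 e16 hr₁ ht₁ => ?_)
    have hcode₁ : τ₁.code = σ.code := by rw [hs₁.code]; exact hc
    have htc : (τ.test (.bin .lt (.reg 8) (.reg 14))).code = σ.code := hc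
    rw [htc] at e10 e16 hr₁
    refine .seq (wp_outputBlock (k := i / D.b + j) h (hE.congr fun r hr => hs₁.reg r (by
      simp at hr ⊢; omega)) hi (by rw [hs₁.reg 8 (by decide)]; exact e8) hkn e16
      ((h.unrank_lt _).le.trans h.pow_le) fun τ₂ hreg₂ _ hc₂' hr₂' ht₂' hout₂ => ?_)
    have f8 : τ₂.reg 8 = i / D.b + j := by
      rw [hreg₂ 8 (by decide), hs₁.reg 8 (by decide)]; exact e8
    have f9 : τ₂.reg 9 = D.foundPos l σ.code (i / D.b) j := by
      rw [hreg₂ 9 (by decide), hs₁.reg 9 (by decide)]; exact e9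
    have f10 : τ₂.reg 10 = flag (l + 3) σ.code (i / D.b + j) := by
      rw [hreg₂ 10 (by decide)]; exact e10
    obtain ⟨g1, g2, g3⟩ := eval_advance (ρ := τ₂.reg) (p := 9) (e := .reg 10) h f8 hkn f9 (hfp j)
      f10 hfl
    refine .seq (.instr (.instr ⟨?_, ?_, ?_, ?_, ?_, ?_, ?_⟩))
    · refine hE.congr fun r hr => ?_
      have hr' : r ≠ 8 ∧ r ≠ 9 ∧ r ∉ [12, 13, 16, 20] ∧ r ∉ [10, 11, 12, 13, 15, 16, 23, 24] := by
        simp at hr ⊢; omega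
      simp only [Instr.run, Function.update_apply, hr', if_false]
      rw [hreg₂ r hr'.2.2.1, hs₁.reg r hr'.2.2.2]
      rfl
    · simp [Instr.run, Expr.eval_add, Expr.eval_reg, Expr.eval_lit, f8, m1 1 (by omega),
        Nat.add_assoc]
      exact m1 _ (by omega)
    · simp only [Instr.run]
      rw [Function.update_of_ne (by norm_num), Function.update_self, g1, m1 _ (by omega)]
      rfl
    · rw [← hc]; simp only [Instr.run]; rw [hc₂', hcode₁, hc]
    · simp only [Instr.run]
      rw [hr₂', hr₁, Finset.sum_range_succ]
      simp only [Machine.test]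
      rw [hr]; ring
    · simp only [Instr.run, Machine.test, advance, Expr.cost_add, Expr.cost_sub, Expr.cost_mul,
        Expr.cost_reg, Expr.cost_lit, Expr.cost_bin] at ht₁ ht₂' ⊢
      rw [Nat.mul_succ]
      omega
    · intro x hx hxj
      simp only [Instr.run]
      rw [hout₂ x]
      by_cases hlt : i + x < (i / D.b + j) * D.b
      · rw [if_neg (by omega), hs₁.out]
        exact hout x hx hlt
      · have hxj' : i + x < (i / D.b + j) * D.b + D.b := by
          rw [← Nat.add_assoc, Nat.succ_mul] at hxj; exact hxj
        have hdiv : (i + x) / D.b = i / D.b + j := by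
          rw [Nat.div_eq_iff (by omega)]
          rw [mul_comm] at hxj' hlt
          constructor <;> rw [mul_comm] <;> omega
        have hmod : (i + x) % D.b = i + x - (i / D.b + j) * D.b := by
          have := Nat.div_add_mod' (i + x) D.b
          rw [hdiv] at this; omega
        rw [if_pos ⟨by omega, hxj', hx⟩, foundSymbol, hdiv, hmod, Nat.add_sub_cancel_left]
  · rintro τ ⟨hE, e8, e9, hc, hr, ht, hout⟩ htm
    refine ⟨by rw [Expr.eval_lt, Expr.eval_reg, Expr.eval_reg, e8, hE.r14, if_neg (by omega),
      Nat.zero_mod],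
      hQ _ ((i + s - 1) / D.b + 1 - i / D.b) (by omega) hc (fun x hx => hout x hx ?_) ?_ ?_ ?_⟩
    · rw [show i / D.b + ((i + s - 1) / D.b + 1 - i / D.b) = (i + s - 1) / D.b + 1 by omega]
      have := Nat.lt_div_mul_add (a := i + s - 1) (b := D.b) (by omega)
      rw [Nat.succ_mul]; omega
    · simp only [Machine.test]; rw [hr, hr₂, hr₁]
    · simp only [Machine.test]; omega
    · simp only [Machine.test, Expr.cost_bin, Expr.cost_reg]
      set m := (i + s - 1) / D.b + 1 - i / D.b
      set len := scanLen (busy (l + 3) σ.code) (i / D.b)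
      have h50 : 50 * len ≤ D.decodeTime * len := Nat.mul_le_mul_right _ (by omega)
      rw [Nat.mul_add, Nat.mul_add, Nat.mul_one]
      have hbm : D.loadTime + 60 * (D.b + 1) ≥ 60 := by omega
      omega

end Coder

namespace Coder

/-! ### The local updater -/

/-- The number with the `q`-ary digits `d 0, d 1, …, d (c - 1)`, the lowest first. -/
def digitsVal (q : ℕ) (d : ℕ → ℕ) (c : ℕ) : ℕ := ∑ u ∈ Finset.range c, q ^ u * d u

theorem digitsVal_lt {q : ℕ} {d : ℕ → ℕ} (hd : ∀ u, d u < q) (c : ℕ) :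
    digitsVal q d c < q ^ c := by
  induction c with
  | zero => simp [digitsVal]
  | succ c ih =>
    rw [digitsVal, Finset.sum_range_succ, pow_succ]
    have h1 : q ^ c * (d c + 1) ≤ q ^ c * q := Nat.mul_le_mul_left _ (hd c)
    rw [Nat.mul_succ] at h1
    rw [digitsVal] at ih
    omega

theorem digitsVal_digit {q : ℕ} {d : ℕ → ℕ} (hd : ∀ u, d u < q) {c t : ℕ} (ht : t < c) :
    digitsVal q d c / q ^ t % q = d t := by
  have hq : 0 < q := lt_of_le_of_lt (Nat.zero_le _) (hd 0)
  have h1 : ∀ e, digitsVal q d (t + 1 + e) % q ^ (t + 1) = digitsVal q d (t + 1) := by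
    intro e
    induction e with
    | zero => exact Nat.mod_eq_of_lt (digitsVal_lt hd _)
    | succ e ih =>
      rw [← Nat.add_assoc, digitsVal, Finset.sum_range_succ, pow_add, mul_assoc,
        Nat.add_mul_mod_self_left]
      exact ih
  obtain ⟨e, rfl⟩ := Nat.exists_eq_add_of_le (show t + 1 ≤ c from ht)
  rw [← Nat.mod_mul_right_div_self, ← pow_succ, h1, digitsVal, Finset.sum_range_succ, ← digitsVal,
    Nat.add_mul_div_left _ _ (by positivity), Nat.div_eq_of_lt (digitsVal_lt hd t), Nat.zero_add]

/-- Digit `u` of block `k` after the update: a symbol of the new fragment, an old symbol, or `0`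
beyond the end of the sequence. -/
def newDigit (D : Coder) (n i s : ℕ) (inp : ℕ → ℕ) (v k u : ℕ) : ℕ :=
  if i ≤ k * D.b + u ∧ k * D.b + u < i + s then inp (k * D.b + u - i)
  else if k * D.b + u < n then v / D.q ^ u % D.q else 0

/-- Puts the number of the updated block into register `18`. -/
def updateBlock (D : Coder) : Prog :=
  .instr (.assign 12 (.lit 0)) ;;
  .instr (.assign 18 (.lit 0)) ;;
  .instr (.assign 19 (.lit 1)) ;;
  .loop (.bin .lt (.reg 12) (.lit D.b))
    (.instr (.assign 20 (.reg 8 * .lit D.b + .reg 12)) ;;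
     .instr (.input 13 (.reg 20 - .reg 2)) ;;
     .instr (.assign 28
       ((.lit 1 - .bin .lt (.reg 20) (.reg 2)) * .bin .lt (.reg 20) (.reg 2 + .reg 3))) ;;
     .instr (.assign 18 (.reg 18 + .reg 19 * (.reg 28 * .reg 13 +
       (.lit 1 - .reg 28) * (.bin .lt (.reg 20) (.reg 0) * (.reg 16 % .lit D.q))))) ;;
     .instr (.assign 19 (.reg 19 * .lit D.q)) ;;
     .instr (.assign 16 (.reg 16 / .lit D.q)) ;;
     .instr (.assign 12 (.reg 12 + .lit 1)))

/-- Computes the new block numbers, in array `0`, from the first block of the fragment on until the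
old queue and the new queue agree; registers `9` and `17` hold their positions. -/
def recompute (D : Coder) : Prog :=
  .instr (.assign 17 (.reg 9)) ;;
  .instr (.assign 21 (.reg 9)) ;;
  .loop ((.bin .lt (.reg 8) (.reg 14) + (.lit 1 - .bin .eq (.reg 9) (.reg 17))) *
      .bin .lt (.reg 8) (.reg 7))
    (D.loadBlock ;; D.updateBlock ;;
     .instr (.assign 27 (.table D.rank (.reg 18) (D.q ^ D.b))) ;;
     .instr (.store 0 (.reg 8) (.reg 27)) ;;
     .instr (.assign 9 (D.advance 9 (.reg 10))) ;;
     .instr (.assign 17 (D.advance 17 (.lit 1 - .bin .lt (.reg 27) (.reg 6)))) ;;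
     .instr (.assign 8 (.reg 8 + .lit 1)))

/-- Writes the record and the spare bits of block `reg 8`. -/
def storeBlock (D : Coder) : Prog :=
  .instr (.load 27 0 (.reg 8)) ;;
  .instr (.assign 10 (.lit 1 - .bin .lt (.reg 27) (.reg 6))) ;;
  .instr (.write (.reg 8 * .reg 4) (.reg 10)) ;;
  .instr (.write (.reg 8 * .reg 4 + .lit 1) (.bin .lt (.reg 8) (.reg 17))) ;;
  .instr (.assign 23 (.reg 8 * .reg 4 + .lit 3)) ;;
  .instr (.assign 24 (.lit 1)) ;;
  .instr (.assign 25 (.reg 5)) ;;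
  .instr (.assign 11 (.reg 27)) ;;
  writeBits ;;
  .instr (.assign 23 (.reg 17 * .reg 4 + .lit 2)) ;;
  .instr (.assign 24 (.reg 4)) ;;
  .instr (.assign 25 (.lit D.β * .reg 10)) ;;
  .instr (.assign 11 (.reg 27 / .reg 6)) ;;
  writeBits

/-- Clears the spare bits in question and writes the new records. -/
def rewrite (D : Coder) : Prog :=
  .instr (.assign 29 (.reg 8)) ;;
  .instr (.assign 23 (.reg 21 * .reg 4 + .lit 2)) ;;
  .instr (.assign 24 (.reg 4)) ;;
  .instr (.assign 25 ((.reg 9 + (.reg 17 - .reg 9)) - .reg 21)) ;;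
  .instr (.assign 11 (.lit 0)) ;;
  writeBits ;;
  .instr (.assign 8 (.reg 22)) ;;
  .instr (.assign 17 (.reg 21)) ;;
  .loop (.bin .lt (.reg 8) (.reg 29))
    (D.storeBlock ;;
     .instr (.assign 17 (D.advance 17 (.reg 10))) ;;
     .instr (.assign 8 (.reg 8 + .lit 1)))

/-- Finds the position of the queue at the first block of the fragment, computes the new block
numbers as far as they or the queue change, then rewrites these records. -/
def localUpdater (D : Coder) : Prog :=
  D.setup ;; D.scanLeft ;; D.recompute ;; D.rewrite

variable {D : Coder} {W n L i s l S : ℕ} {σ : Machine} {Q : Machine → Prop}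

theorem newDigit_lt {inp : ℕ → ℕ} (hq : 1 ≤ D.q) (hinp : ∀ x, inp x < D.q) (v k u : ℕ) :
    D.newDigit n i s inp v k u < D.q := by
  rw [newDigit]
  split
  · exact hinp _
  · split
    · exact Nat.mod_lt _ (by omega)
    · omega

theorem wp_updateBlock {k v : ℕ} (h : Room D W n L l S) (hE : Env D n L i s l σ)
    (hi : i + s ≤ n) (hinp : ∀ x, σ.inp x < D.q) (h8 : σ.reg 8 = k) (hk : k ≤ n / D.b)
    (h16 : σ.reg 16 = v) (hv : v ≤ S)
    (hQ : ∀ τ, SameExcept [12, 13, 16, 18, 19, 20, 28] σ τ → τ.reads = σ.reads →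
      τ.time ≤ σ.time + 100 * (D.b + 1) →
      τ.reg 18 = digitsVal D.q (D.newDigit n i s σ.inp v k) D.b → Q τ) :
    WP W D.updateBlock Q σ := by
  have hS2 := h.two_le
  have hn := h.n_le
  have hb := h.b_le
  have hq := h.q_le
  have hq1 := h.q_pos
  have hSS : 2 * S ≤ S * S := Nat.mul_le_mul_right S hS2
  have m1 : ∀ x ≤ 7 * S, x % W = x := fun x hx => Nat.mod_eq_of_lt (h.le_word hx)
  have m2 : ∀ x ≤ 15 * (S * S), x % W = x := fun x hx => Nat.mod_eq_of_lt (h.lt_word hx)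
  have hkb : k * D.b ≤ n := le_trans (Nat.mul_le_mul_right _ hk) (Nat.div_mul_le_self _ _)
  have hd := newDigit_lt (n := n) (i := i) (s := s) hq1 hinp v k
  refine .seq (.instr (.seq (.instr (.seq (.instr (.loop (fun t τ =>
    SameExcept [12, 13, 16, 18, 19, 20, 28] σ τ ∧
    τ.reads = σ.reads ∧ τ.time ≤ σ.time + 6 + 80 * t ∧
    τ.reg 12 = t ∧ τ.reg 16 = v / D.q ^ t ∧ τ.reg 19 = D.q ^ t ∧
    τ.reg 18 = digitsVal D.q (D.newDigit n i s σ.inp v k) t) D.b ?_ ?_ ?_))))))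
  · refine ⟨⟨fun r hr => ?_, rfl, rfl, rfl, rfl, rfl⟩, rfl, ?_, ?_, ?_, ?_, ?_⟩
    · simp at hr; simp [Instr.run, hr]
    · simp [Instr.run, Expr.cost]
    · simp [Instr.run, Expr.eval]
    · simp [Instr.run, h16]
    · simp [Instr.run, Expr.eval, m1 1 (by omega)]
    · simp [Instr.run, Expr.eval, digitsVal]
  · rintro t ht τ ⟨hs, hreads, htime, h12, h16', h19, h18⟩
    have e0 : τ.reg 0 = n := by rw [hs.reg 0 (by decide), hE.r0]
    have e2 : τ.reg 2 = i := by rw [hs.reg 2 (by decide), hE.r2]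
    have e3 : τ.reg 3 = s := by rw [hs.reg 3 (by decide), hE.r3]
    have e8 : τ.reg 8 = k := by rw [hs.reg 8 (by decide), h8]
    have hvt : v / D.q ^ t ≤ v := Nat.div_le_self _ _
    have hvt' : v / D.q ^ t / D.q ≤ v / D.q ^ t := Nat.div_le_self _ _
    have hvq : v / D.q ^ t % D.q ≤ v / D.q ^ t := Nat.mod_le _ _
    have hx := hinp (k * D.b + t - i)
    have hpt : D.q ^ t ≤ S := (Nat.pow_le_pow_right hq1 ht.le).trans h.pow_le
    have hpq : D.q ^ t * D.q ≤ S * S := Nat.mul_le_mul hpt hq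
    have hpd : D.q ^ t * D.newDigit n i s σ.inp v k t ≤ S * S :=
      Nat.mul_le_mul hpt ((hd t).le.trans hq)
    have hdv : digitsVal D.q (D.newDigit n i s σ.inp v k) t ≤ S := (digitsVal_lt hd t).le.trans hpt
    refine ⟨by simp [Expr.eval_lt, Expr.eval_reg, Expr.eval_lit, h12, m1 D.b (by omega), ht,
      m1 1 (by omega)], .seq (.instr (.seq (.instr (.seq (.instr (.seq (.instr (.seq (.instr
      (.seq (.instr (.instr ?_))))))))))))⟩
    refine ⟨⟨fun r hr => ?_, hs.mem, hs.inp, hs.code, hs.out, hs.writes⟩, hreads, ?_, ?_, ?_, ?_,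
      ?_⟩
    · simp only [List.mem_cons, List.not_mem_nil, or_false, not_or] at hr
      simp only [Instr.run, Function.update_apply, hr, if_false, Machine.test]
      exact hs.reg r (by simp [hr])
    · simp [Instr.run, Machine.test, Expr.cost_add, Expr.cost_sub, Expr.cost_mul, Expr.cost_reg,
        Expr.cost_lit, Expr.cost_div, Expr.cost_mod, Expr.cost_bin]
      omega
    · simp [Instr.run, Machine.test, Expr.eval_add, Expr.eval_reg, Expr.eval_lit, h12,
        m1 1 (by omega), m1 (t + 1) (by omega)]
    · simp [Instr.run, Machine.test, Expr.eval_div, Expr.eval_reg, Expr.eval_lit, h16',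
        m1 D.q (by omega), m1 _ (hvt'.trans (by omega))]
      rw [Nat.div_div_eq_div_mul, pow_succ]
    · simp [Instr.run, Machine.test, Expr.eval_mul, Expr.eval_reg, Expr.eval_lit, h19,
        m1 D.q (by omega), m2 (D.q ^ t * D.q) (by omega)]
      rw [pow_succ]
    · rw [digitsVal, Finset.sum_range_succ, ← digitsVal]
      simp [Instr.run, Machine.test, Expr.eval_add, Expr.eval_mul, Expr.eval_sub, Expr.eval_mod,
        Expr.eval_lt, Expr.eval_reg, Expr.eval_lit, e0, e2, e3, e8, h12, h16', h18, h19, hs.inp,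
        m1 D.b (by omega), m1 (k * D.b) (by omega), m1 (k * D.b + t) (by omega),
        m1 (k * D.b + t - i) (by omega), m1 (σ.inp (k * D.b + t - i)) (by omega),
        m1 1 (by omega), m1 D.q (by omega), m1 (v / D.q ^ t % D.q) (by omega),
        m1 (i + s) (by omega)]
      rw [newDigit] at hpd ⊢
      by_cases c1 : k * D.b + t < i
      · by_cases c3 : k * D.b + t < n
        · simp [c1, c3, not_le.2 c1, show k * D.b + t < i + s by omega, m1 1 (by omega)] at hpd ⊢
          exact m2 _ (by omega)
        · omega
      · by_cases c2 : k * D.b + t < i + s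
        · simp [c1, c2, not_lt.1 c1, m1 1 (by omega)] at hpd ⊢
          exact m2 _ (by omega)
        · by_cases c3 : k * D.b + t < n
          · simp [c2, c3, m1 1 (by omega)] at hpd ⊢
            exact m2 _ (by omega)
          · simp [c2, c3] at hpd ⊢
            exact m2 _ (by omega)
  · rintro τ ⟨hs, hreads, htime, h12, h16', h19, h18⟩
    refine ⟨by simp [Expr.eval_lt, Expr.eval_reg, Expr.eval_lit, h12, m1 D.b (by omega)],
      hQ _ ⟨hs.reg, hs.mem, hs.inp, hs.code, hs.out, hs.writes⟩ hreads ?_ h18⟩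
    simp [Machine.test, Expr.cost_reg, Expr.cost_lit, Expr.cost_bin]; omega

end Coder

namespace Coder

variable {D : Coder} {W n L i s l S : ℕ} {σ : Machine} {Q : Machine → Prop}

/-- The number of block `k` after the update, computed from the codeword `c`. -/
def newRank (D : Coder) (n i s l : ℕ) (inp : ℕ → ℕ) (c : ℕ → Bool) (k₀ k : ℕ) : ℕ :=
  D.rank (digitsVal D.q (D.newDigit n i s inp
    (D.unrank (readBlock (l + 3) l D.β c (D.foundPos l c k₀ (k - k₀)) k)) k) D.b)

/-- The position of the queue after the update, computed from the codeword `c`. -/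
def newPos (D : Coder) (n i s l : ℕ) (inp : ℕ → ℕ) (c : ℕ → Bool) (k₀ j : ℕ) : ℕ :=
  queuePos D.β (overflows l (D.newRank n i s l inp c k₀)) k₀
    (scanPos D.β (flag (l + 3) c) (busy (l + 3) c) k₀) j

/-- The updater has to go on after `j` blocks: either the fragment goes on, or the old queue and the
new queue still differ. -/
def Unsettled (D : Coder) (n i s l : ℕ) (inp : ℕ → ℕ) (c : ℕ → Bool) (j : ℕ) : Prop :=
  (i / D.b + j < (i + s - 1) / D.b + 1 ∨
    D.foundPos l c (i / D.b) j ≠ D.newPos n i s l inp c (i / D.b) j) ∧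
  i / D.b + j < n / D.b + 1

theorem newRank_lt (h : Room D W n L l S) {inp : ℕ → ℕ} (hinp : ∀ x, inp x < D.q)
    (c : ℕ → Bool) (k₀ k : ℕ) : D.newRank n i s l inp c k₀ k < D.q ^ D.b :=
  h.rank_lt _ (digitsVal_lt (newDigit_lt h.q_pos hinp _ _) _)

theorem eval_overflow {ρ : ℕ → ℕ} {r : ℕ → ℕ} {k : ℕ} (h : Room D W n L l S) (h27 : ρ 27 = r k)
    (h6 : ρ 6 = 2 ^ l) :
    (Expr.lit 1 - Expr.bin .lt (.reg 27) (.reg 6)).eval W ρ = overflows l r k := by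
  have m1 : ∀ x ≤ 7 * S, x % W = x := fun x hx => Nat.mod_eq_of_lt (h.le_word hx)
  have hS2 := h.two_le
  rw [Expr.eval_sub, Expr.eval_lit, Expr.eval_lt, Expr.eval_reg, Expr.eval_reg, h27, h6,
    overflows, m1 1 (by omega)]
  by_cases hc : 2 ^ l ≤ r k
  · simp [hc, not_lt.2 hc, m1 1 (by omega)]
  · simp [hc, not_le.1 hc, m1 1 (by omega)]

/-- A bound for the time per block of `recompute`. -/
def recomputeTime (D : Coder) : ℕ :=
  D.loadTime + 100 * (D.b + 1) + 100 + (Expr.table D.rank (.reg 18) (D.q ^ D.b)).cost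

/-- After `m` rounds, the first number at which nothing is unsettled, registers `9` and `17` hold
the positions of the old and of the new queue, and array `0` the `m` new block numbers. -/
theorem wp_recompute (h : Room D W n L l S) (hE : Env D n L i s l σ) (hi : i + s ≤ n)
    (hinp : ∀ x, σ.inp x < D.q) (h8 : σ.reg 8 = i / D.b)
    (h9 : σ.reg 9 = D.foundPos l σ.code (i / D.b) 0)
    (hQ : ∀ τ m, (∀ j < m, D.Unsettled n i s l σ.inp σ.code j) →
      ¬ D.Unsettled n i s l σ.inp σ.code m → Env D n L i s l τ → τ.reg 8 = i / D.b + m →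
      τ.reg 9 = D.foundPos l σ.code (i / D.b) m →
      τ.reg 17 = D.newPos n i s l σ.inp σ.code (i / D.b) m →
      τ.reg 21 = D.newPos n i s l σ.inp σ.code (i / D.b) 0 →
      (∀ j < m, τ.mem 0 (i / D.b + j) =
        D.newRank n i s l σ.inp σ.code (i / D.b) (i / D.b + j)) →
      τ.code = σ.code →
      τ.reads = σ.reads +
        ∑ j ∈ Finset.range m, (1 + l + D.β * flag (l + 3) σ.code (i / D.b + j)) →
      τ.writes = σ.writes → m ≤ τ.time → τ.time ≤ σ.time + D.recomputeTime * (m + 1) → Q τ) :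
    WP W D.recompute Q σ := by
  classical
  have hS2 := h.two_le
  have hn := h.n_le
  have hb2 := h.b_pos
  have hpb := h.pow_le
  have hnb : n / D.b ≤ n := Nat.div_le_self _ _
  have m1 : ∀ x ≤ 7 * S, x % W = x := fun x hx => Nat.mod_eq_of_lt (h.le_word hx)
  have hkn₀ : i / D.b ≤ n / D.b := Nat.div_le_div_right (by omega)
  have hdt : D.recomputeTime = D.loadTime + 100 * (D.b + 1) + 100 +
    (Expr.table D.rank (.reg 18) (D.q ^ D.b)).cost := rfl
  set k₀ := i / D.b with hk₀
  set R := D.newRank n i s l σ.inp σ.code k₀ with hR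
  have hp0 := scanPos_le D.β (busy (l + 3) σ.code) (flag_le (l + 3) σ.code) k₀
  have hfp : ∀ j, D.foundPos l σ.code k₀ j ≤ (D.β + 1) * (k₀ + j) :=
    queuePos_le_mul (flag_le _ _) hp0
  have hnp : ∀ j, D.newPos n i s l σ.inp σ.code k₀ j ≤ (D.β + 1) * (k₀ + j) :=
    queuePos_le_mul (overflows_le_one _ _) hp0
  have hposS : ∀ j, k₀ + j ≤ n / D.b + 1 → (D.β + 1) * (k₀ + j) ≤ S := fun j hj => by
    have := Nat.mul_le_mul_left (D.β + 1) hj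
    have := h.pos_le
    omega
  have hex : ∃ m, ¬ D.Unsettled n i s l σ.inp σ.code m :=
    ⟨n / D.b + 1, fun hcon => by have := hcon.2; omega⟩
  have hm := Nat.find_spec hex
  have hlt : ∀ j < Nat.find hex, D.Unsettled n i s l σ.inp σ.code j := fun j hj =>
    not_not.1 (Nat.find_min hex hj)
  have hmN : k₀ + Nat.find hex ≤ n / D.b + 1 := by
    rcases Nat.eq_zero_or_pos (Nat.find hex) with h0 | h0
    · omega
    · have := (hlt (Nat.find hex - 1) (by omega)).2; omega
  -- the value of the loop condition
  have hcond : ∀ j (τ : Machine), k₀ + j ≤ n / D.b + 1 → Env D n L i s l τ → τ.reg 8 = k₀ + j →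
      τ.reg 9 = D.foundPos l σ.code k₀ j → τ.reg 17 = D.newPos n i s l σ.inp σ.code k₀ j →
      (((Expr.bin .lt (.reg 8) (.reg 14) + (.lit 1 - .bin .eq (.reg 9) (.reg 17))) *
        .bin .lt (.reg 8) (.reg 7)).eval W τ.reg ≠ 0 ↔
        D.Unsettled n i s l σ.inp σ.code j) := by
    intro j τ hj hE e8 e9 e17
    rw [Expr.eval_mul, Expr.eval_add, Expr.eval_sub, Expr.eval_lt, Expr.eval_eq, Expr.eval_lt,
      Expr.eval_lit, Expr.eval_reg, Expr.eval_reg, Expr.eval_reg, Expr.eval_reg, Expr.eval_reg, e8,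
      e9, e17, hE.r14, hE.r7, m1 1 (by omega), Unsettled, ← hk₀]
    by_cases c1 : k₀ + j < (i + s - 1) / D.b + 1 <;>
    by_cases c2 : D.foundPos l σ.code k₀ j = D.newPos n i s l σ.inp σ.code k₀ j <;>
    by_cases c3 : k₀ + j < n / D.b + 1 <;>
    simp only [c1, c2, c3, if_true, if_false, m1 1 (by omega), m1 (1 + 1) (by omega), Nat.zero_mod,
      Nat.mul_one, Nat.mul_zero, Nat.add_zero, Nat.zero_add, Nat.sub_self,
      Nat.sub_zero, ne_eq, not_true_eq_false, not_false_eq_true, true_or, or_true,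
      and_true, and_false, or_self, iff_true] <;> norm_num
  refine .seq (.instr (.seq (.instr (.loop_time (fun j τ => Env D n L i s l τ ∧ τ.reg 8 = k₀ + j ∧
    τ.reg 9 = D.foundPos l σ.code k₀ j ∧ τ.reg 17 = D.newPos n i s l σ.inp σ.code k₀ j ∧
    τ.reg 21 = D.newPos n i s l σ.inp σ.code k₀ 0 ∧
    (∀ u < j, τ.mem 0 (k₀ + u) = R (k₀ + u)) ∧ τ.code = σ.code ∧ τ.inp = σ.inp ∧
    τ.reads = σ.reads + ∑ u ∈ Finset.range j, (1 + l + D.β * flag (l + 3) σ.code (k₀ + u)) ∧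
    τ.writes = σ.writes ∧ τ.time ≤ σ.time + 4 + D.recomputeTime * j) (Nat.find hex) ?_ ?_ ?_))))
  · have hp := (hfp 0).trans (hposS 0 (by omega))
    refine ⟨hE.congr fun r hr => ?_, ?_, ?_, ?_, ?_, ?_, rfl, rfl, ?_, rfl, ?_⟩
    · have hr' : r ≠ 17 ∧ r ≠ 21 := by simp at hr ⊢; omega
      simp [Instr.run, hr']
    · simp [Instr.run, h8]
    · simp [Instr.run, h9]
    · simp [Instr.run, Expr.eval_reg, h9]
      exact m1 _ (by omega)
    · simp [Instr.run, Expr.eval_reg, h9]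
      exact m1 _ (by omega)
    · intro u hu; omega
    · simp [Instr.run]
    · simp [Instr.run, Expr.cost]
  · rintro j hj τ ⟨hE, e8, e9, e17, e21, hmem, hc, hin, hr, hw, ht⟩
    have hun := hlt j hj
    have hkn : k₀ + j ≤ n / D.b := by have := hun.2; omega
    refine ⟨(hcond j τ (by omega) hE e8 e9 e17).2 hun, ?_⟩
    set cond := (Expr.bin .lt (.reg 8) (.reg 14) + (.lit 1 - .bin .eq (.reg 9) (.reg 17))) *
        Expr.bin .lt (.reg 8) (.reg 7) with hcnd
    have hcost : cond.cost = 13 := rfl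
    have hfl := flag_le (l + 3) σ.code (k₀ + j)
    refine .seq (wp_loadBlock (k := k₀ + j) (p := D.foundPos l σ.code k₀ j) h
      (hE.congr fun r _ => rfl) e8 hkn e9 ((hfp j).trans (Nat.mul_le_mul_left _ (by omega)))
      fun τ₁ hs₁ e10 e16 hr₁ ht₁ => ?_)
    have htc : (τ.test cond).code = σ.code := hc
    have hti : (τ.test cond).inp = σ.inp := hin
    rw [htc] at e10 e16 hr₁
    have hin₁ : τ₁.inp = σ.inp := by rw [hs₁.inp, hti]
    refine .seq (wp_updateBlock (k := k₀ + j) h (hE.congr fun r hr => hs₁.reg r (by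
      simp at hr ⊢; omega)) hi (by rw [hin₁]; exact hinp) (by rw [hs₁.reg 8 (by decide)]; exact e8)
      hkn e16 ((h.unrank_lt _).le.trans hpb) fun τ₂ hs₂ hr₂ ht₂ e18 => ?_)
    rw [hin₁] at e18
    have hreg₂ : ∀ r, r ∉ [10, 11, 12, 13, 15, 16, 18, 19, 20, 23, 24, 28] →
        τ₂.reg r = τ.reg r := by
      intro r hr
      simp only [List.mem_cons, List.not_mem_nil, or_false, not_or] at hr
      rw [hs₂.reg r (by simp [hr]), hs₁.reg r (by simp [hr])]
      rfl
    have f8 : τ₂.reg 8 = k₀ + j := by rw [hreg₂ 8 (by decide), e8]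
    have f9 : τ₂.reg 9 = D.foundPos l σ.code k₀ j := by rw [hreg₂ 9 (by decide), e9]
    have f17 : τ₂.reg 17 = D.newPos n i s l σ.inp σ.code k₀ j := by rw [hreg₂ 17 (by decide), e17]
    have f6 : τ₂.reg 6 = 2 ^ l := by rw [hreg₂ 6 (by decide), hE.r6]
    have f10 : τ₂.reg 10 = flag (l + 3) σ.code (k₀ + j) := by rw [hs₂.reg 10 (by decide)]; exact e10
    have hRlt : R (k₀ + j) < D.q ^ D.b := newRank_lt h hinp _ _ _
    have hRW : R (k₀ + j) < W := h.le_word (by omega)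
    have htab : (Expr.table D.rank (.reg 18) (D.q ^ D.b)).eval W τ₂.reg = R (k₀ + j) := by
      rw [Expr.eval_table (v := τ₂.reg 18) (h.le_word (by omega)) rfl (h.le_word (by omega)).le
        (fun v hv => lt_of_lt_of_le (h.rank_lt v hv) (h.le_word (by omega)).le), e18,
        if_pos (digitsVal_lt (newDigit_lt h.q_pos hinp _ _) _), hR, newRank,
        Nat.add_sub_cancel_left]
    refine .seq (.instr (.seq (.instr (.seq (.instr (.seq (.instr (.instr ?_))))))))
    -- the configuration before the registers `9`, `17` and `8` are advanced
    set τ₃ := Instr.run W (Instr.run W τ₂ (.assign 27 (.table D.rank (.reg 18) (D.q ^ D.b))))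
      (.store 0 (.reg 8) (.reg 27)) with hτ₃
    have k27 : τ₃.reg 27 = R (k₀ + j) := by
      simp only [hτ₃, Instr.run, Function.update_self, htab, Nat.mod_eq_of_lt hRW]
    have kreg : ∀ r, r ≠ 27 → τ₃.reg r = τ₂.reg r := fun r hr => by simp [hτ₃, Instr.run, hr]
    have kmem : τ₃.mem 0 = Function.update (τ₂.mem 0) (k₀ + j) (R (k₀ + j)) := by
      simp [hτ₃, Instr.run, Expr.eval_reg, htab, Nat.mod_eq_of_lt hRW, f8]
    obtain ⟨g1, g2, g3⟩ := eval_advance (ρ := τ₃.reg) (p := 9) (e := .reg 10) h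
      (by rw [kreg 8 (by decide), f8]) hkn (by rw [kreg 9 (by decide), f9]) (hfp j)
      (by rw [Expr.eval_reg, kreg 10 (by decide), f10]) hfl
    set τ₄ := Instr.run W τ₃ (.assign 9 (D.advance 9 (.reg 10))) with hτ₄
    have qreg : ∀ r, r ≠ 9 → τ₄.reg r = τ₃.reg r := fun r hr => by simp [hτ₄, Instr.run, hr]
    obtain ⟨g1', g2', -⟩ := eval_advance (ρ := τ₄.reg) (p := 17)
      (e := .lit 1 - .bin .lt (.reg 27) (.reg 6)) (a := overflows l R (k₀ + j)) h
      (by rw [qreg 8 (by decide), kreg 8 (by decide), f8]) hkn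
      (by rw [qreg 17 (by decide), kreg 17 (by decide), f17]) (hnp j)
      (eval_overflow h (by rw [qreg 27 (by decide), k27])
        (by rw [qreg 6 (by decide), kreg 6 (by decide), f6])) (overflows_le_one _ _ _)
    refine ⟨?_, ?_, ?_, ?_, ?_, ?_, ?_, ?_, ?_, ?_, ?_⟩
    · refine hE.congr fun r hr => ?_
      have hr' : r ≠ 8 ∧ r ≠ 9 ∧ r ≠ 17 ∧ r ≠ 27 ∧
          r ∉ [10, 11, 12, 13, 15, 16, 18, 19, 20, 23, 24, 28] := by
        simp at hr ⊢; omega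
      simp only [Instr.run, Function.update_apply, hr', if_false]
      rw [qreg r hr'.2.1, kreg r hr'.2.2.2.1, hreg₂ r hr'.2.2.2.2]
    · simp only [Instr.run, Expr.eval_add, Expr.eval_reg, Expr.eval_lit, Function.update_self,
        Function.update_of_ne (show (8 : ℕ) ≠ 17 by norm_num)]
      rw [qreg 8 (by decide), kreg 8 (by decide), f8, m1 1 (by omega),
        m1 (k₀ + j + 1) (by omega), m1 (k₀ + j + 1) (by omega), Nat.add_assoc]
    · simp only [Instr.run, Function.update_of_ne (show (9 : ℕ) ≠ 17 by norm_num),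
        Function.update_of_ne (show (9 : ℕ) ≠ 8 by norm_num), hτ₄, Function.update_self, g1]
      exact m1 _ (by omega)
    · simp only [Instr.run, Function.update_of_ne (show (17 : ℕ) ≠ 8 by norm_num),
        Function.update_self]
      rw [g1']
      exact m1 _ (by omega)
    · simp only [Instr.run, Function.update_of_ne (show (21 : ℕ) ≠ 8 by norm_num),
        Function.update_of_ne (show (21 : ℕ) ≠ 17 by norm_num)]
      rw [qreg 21 (by decide), kreg 21 (by decide), hreg₂ 21 (by decide), e21]
    · intro u hu
      change τ₃.mem 0 (k₀ + u) = _
      rw [kmem]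
      by_cases huj : u = j
      · subst huj; rw [Function.update_self]
      · rw [Function.update_of_ne (by omega), hs₂.mem, hs₁.mem]
        exact hmem u (by omega)
    · change τ₂.code = σ.code
      rw [hs₂.code, hs₁.code, htc]
    · change τ₂.inp = σ.inp
      rw [hs₂.inp, hin₁]
    · change τ₂.reads = _
      rw [hr₂, hr₁, Finset.sum_range_succ]
      simp only [Machine.test]
      rw [hr]; ring
    · change τ₂.writes = σ.writes
      rw [hs₂.writes, hs₁.writes]; exact hw
    · simp only [hτ₄, hτ₃, Instr.run, advance, Expr.cost_add, Expr.cost_sub, Expr.cost_mul,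
        Expr.cost_reg, Expr.cost_lit, Expr.cost_bin]
      simp only [Machine.test, hcost] at ht₁
      rw [Nat.mul_succ]
      omega
  · rintro τ ⟨hE, e8, e9, e17, e21, hmem, hc, hin, hr, hw, ht⟩ htm
    refine ⟨not_not.1 fun hcon => hm ((hcond _ τ hmN hE e8 e9 e17).1 hcon),
      hQ _ (Nat.find hex) hlt hm (hE.congr fun r _ => rfl) e8 e9 e17 e21 hmem hc hr hw ?_ ?_⟩
    · simp only [Machine.test]; omega
    · simp only [Machine.test, Expr.cost_add, Expr.cost_sub, Expr.cost_mul, Expr.cost_reg,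
        Expr.cost_lit, Expr.cost_bin]
      rw [Nat.mul_succ]
      omega

end Coder

/-- One more rewritten record. -/
theorem rewriteCode_succ {l β k₀ p₀ p₁ j : ℕ} {c c₀ c₁ : ℕ → Bool} {r : ℕ → ℕ}
    (h₀ : c₀ = rewriteCode (l + 3) l β c r k₀ p₀ p₁ j)
    (hp : queuePos β (overflows l r) k₀ p₀ (j + 1) ≤ p₁)
    (hflag : c₁ ((k₀ + j) * (l + 3)) = decide (2 ^ l ≤ r (k₀ + j)))
    (hbusy : c₁ ((k₀ + j) * (l + 3) + 1) =
      decide (k₀ + j < queuePos β (overflows l r) k₀ p₀ j))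
    (hpay : ∀ u < l, c₁ ((k₀ + j) * (l + 3) + 3 + u) = (r (k₀ + j)).testBit u)
    (hspare : ∀ u < β * overflows l r (k₀ + j),
      c₁ ((queuePos β (overflows l r) k₀ p₀ j + u) * (l + 3) + 2) =
        (r (k₀ + j) / 2 ^ l).testBit u)
    (hrest : ∀ x, (x / (l + 3) = k₀ + j → x % (l + 3) = 2) →
      (∀ u < β * overflows l r (k₀ + j),
        x ≠ (queuePos β (overflows l r) k₀ p₀ j + u) * (l + 3) + 2) → c₁ x = c₀ x) :
    c₁ = rewriteCode (l + 3) l β c r k₀ p₀ p₁ (j + 1) := by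
  set P := queuePos β (overflows l r) k₀ p₀ with hP
  have hmono : Monotone P := queuePos_mono _ _ _ _
  have hov1 : 2 ^ l ≤ r (k₀ + j) → β * overflows l r (k₀ + j) = β := fun h => by
    rw [overflows_eq_one.2 h, Nat.mul_one]
  have hstep : P j + β * overflows l r (k₀ + j) ≤ P (j + 1) := queuePos_add_le_succ _ _ _ _ _
  have hp0 : p₀ ≤ P j := hmono (Nat.zero_le j)
  funext x
  have hxd : x / (l + 3) * (l + 3) + x % (l + 3) = x := Nat.div_add_mod' x (l + 3)
  have hxm : x % (l + 3) < l + 3 := Nat.mod_lt _ (by omega)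
  by_cases h2 : x % (l + 3) = 2
  · by_cases hu : ∃ u < β * overflows l r (k₀ + j), x = (P j + u) * (l + 3) + 2
    · obtain ⟨u, hu, rfl⟩ := hu
      have hr : 2 ^ l ≤ r (k₀ + j) := by
        by_contra hr
        rw [overflows, if_neg hr] at hu; omega
      rw [hspare u hu]
      rw [hov1 hr] at hu hstep
      rw [rewriteCode, if_pos h2, record_div _ (by omega : 2 < l + 3), if_pos ⟨by omega, by omega⟩,
        Bool.eq_iff_iff, decide_eq_true_eq]
      constructor
      · intro h
        exact ⟨j, by omega, hr, Nat.le_add_right _ _, Nat.add_lt_add_left hu _, by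
          rwa [← hP, Nat.add_sub_cancel_left]⟩
      · rintro ⟨j', hj', hr', h1, h1', h1''⟩
        rw [← hP] at h1 h1' h1''
        obtain rfl : j' = j := by
          by_contra hne
          have h3 := queuePos_add_le_succ β (overflows l r) k₀ p₀ j'
          rw [overflows_eq_one.2 hr', Nat.mul_one, ← hP] at h3
          have h4 := hmono (show j' + 1 ≤ j by omega)
          omega
        rwa [Nat.add_sub_cancel_left] at h1''
    · push Not at hu
      rw [hrest x (fun _ => h2) hu, h₀, rewriteCode, rewriteCode, if_pos h2, if_pos h2]
      split
      · rw [decide_eq_decide]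
        constructor
        · rintro ⟨j', hj', h⟩
          exact ⟨j', by omega, h⟩
        · rintro ⟨j', hj', hr', h1, h1', h1''⟩
          refine ⟨j', ?_, hr', h1, h1', h1''⟩
          by_contra hne
          obtain rfl : j' = j := by omega
          rw [← hP] at h1 h1'
          refine hu (x / (l + 3) - P j') (by rw [hov1 hr']; omega) ?_
          rw [show P j' + (x / (l + 3) - P j') = x / (l + 3) by omega, ← h2]
          exact hxd.symm
      · rfl
  · by_cases hk : x / (l + 3) = k₀ + j
    · rw [rewriteCode, if_neg h2, if_pos ⟨by omega, by omega⟩, hk, Nat.add_sub_cancel_left]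
      rw [hk] at hxd
      split
      · rename_i h0
        rw [← hflag, ← hxd, h0, Nat.add_zero]
      · split
        · rename_i h1
          rw [← hbusy, ← hxd, h1]
        · rw [← hpay _ (by omega), ← hxd]
          congr 1
          simp only [hxd]
          omega
    · rw [hrest x (fun h => absurd h hk) (fun u _ h => h2 (by
        rw [h, record_mod _ (by omega : 2 < l + 3)])), h₀, rewriteCode, rewriteCode, if_neg h2,
        if_neg h2]
      by_cases hin : k₀ ≤ x / (l + 3) ∧ x / (l + 3) < k₀ + j
      · have hin' : k₀ ≤ x / (l + 3) ∧ x / (l + 3) < k₀ + (j + 1) := by omega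
        simp only [if_pos hin, if_pos hin']
      · have hin' : ¬ (k₀ ≤ x / (l + 3) ∧ x / (l + 3) < k₀ + (j + 1)) := by omega
        simp only [if_neg hin, if_neg hin']

theorem queuePos_le_add {β : ℕ} {a : ℕ → ℕ} (ha : ∀ k, a k ≤ 1) (k₀ p₀ j : ℕ) :
    queuePos β a k₀ p₀ j ≤ max p₀ k₀ + (β + 1) * j := by
  induction j with
  | zero => exact le_max_left _ _
  | succ j ih =>
    have := Nat.mul_le_mul_left β (ha (k₀ + j))
    have h4 : j ≤ (β + 1) * j := Nat.le_mul_of_pos_left _ (by omega)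
    rw [queuePos, Nat.mul_succ]
    exact max_le (by omega) (by omega)

namespace Coder

variable {D : Coder} {W n L i s l S : ℕ} {σ : Machine} {Q : Machine → Prop}

/-- A bound for the time per block of `rewrite`. -/
def storeTime (D : Coder) : ℕ := 30 * (D.lmax + 1) + 30 * (D.β + 1) + 200

theorem wp_storeBlock {k p v : ℕ} (h : Room D W n L l S) (hE : Env D n L i s l σ)
    (h8 : σ.reg 8 = k) (hk : k ≤ n / D.b) (h17 : σ.reg 17 = p)
    (hp : p ≤ (D.β + 1) * (n / D.b + 1)) (hmem : σ.mem 0 k = v) (hv : v ≤ S)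
    (hQ : ∀ τ, (∀ r, r ∉ [10, 11, 12, 23, 24, 25, 27] → τ.reg r = σ.reg r) →
      τ.mem = σ.mem → τ.reads = σ.reads →
      τ.reg 10 = overflows l (fun _ => v) k →
      τ.writes = σ.writes + (2 + l + D.β * overflows l (fun _ => v) k) →
      τ.time + 120 ≤ σ.time + D.storeTime →
      τ.code (k * (l + 3)) = decide (2 ^ l ≤ v) → τ.code (k * (l + 3) + 1) = decide (k < p) →
      (∀ u < l, τ.code (k * (l + 3) + 3 + u) = v.testBit u) →
      (∀ u < D.β * overflows l (fun _ => v) k,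
        τ.code ((p + u) * (l + 3) + 2) = (v / 2 ^ l).testBit u) →
      (∀ x, (x / (l + 3) = k → x % (l + 3) = 2) →
        (∀ u < D.β * overflows l (fun _ => v) k, x ≠ (p + u) * (l + 3) + 2) →
        τ.code x = σ.code x) → Q τ) :
    WP W D.storeBlock Q σ := by
  have hH := h.H_le
  have hS2 := h.two_le
  have hfit := h.fits
  have hL := h.L_le
  have hn := h.n_le
  have hpos := h.pos_le
  have hl := h.l_le
  have hpl := h.pow_l_le
  have m1 : ∀ x ≤ 7 * S, x % W = x := fun x hx => Nat.mod_eq_of_lt (h.le_word hx)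
  have m2 : ∀ x ≤ 15 * (S * S), x % W = x := fun x hx => Nat.mod_eq_of_lt (h.lt_word hx)
  have hSS : 2 * S ≤ S * S := Nat.mul_le_mul_right S hS2
  have hrec : k * (l + 3) + (l + 3) ≤ S := by
    have : (k + 1) * (l + 3) ≤ (n / D.b + 1) * (l + 3) := Nat.mul_le_mul_right _ (by omega)
    rw [Nat.succ_mul] at this
    omega
  have hspare : (p + D.β) * (l + 3) ≤ S * S := Nat.mul_le_mul (by omega) hH
  rw [Nat.add_mul] at hspare
  have ha1 := overflows_le_one l (fun _ => v) k
  have haβ : D.β * overflows l (fun _ => v) k ≤ D.β := by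
    have := Nat.mul_le_mul_left D.β ha1; omega
  have hdiv : v / 2 ^ l ≤ v := Nat.div_le_self _ _
  refine .seq (.instr (.seq (.instr (.seq (.instr (.seq (.instr ?_)))))))
  set σ₁ := Instr.run W σ (.load 27 0 (.reg 8)) with hσ₁
  have a27 : σ₁.reg 27 = v := by
    simp [hσ₁, Instr.run, Expr.eval_reg, h8, hmem]; exact m1 _ (by omega)
  have areg : ∀ r, r ≠ 27 → σ₁.reg r = σ.reg r := fun r hr => by simp [hσ₁, Instr.run, hr]
  set σ₂ := Instr.run W σ₁ (.assign 10 (.lit 1 - .bin .lt (.reg 27) (.reg 6))) with hσ₂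
  have b10 : σ₂.reg 10 = overflows l (fun _ => v) k := by
    simp only [hσ₂, Instr.run, Function.update_self]
    rw [eval_overflow (r := fun _ => v) (k := k) h a27 (by rw [areg 6 (by decide), hE.r6])]
    exact m1 _ (by omega)
  have breg : ∀ r, r ≠ 27 → r ≠ 10 → σ₂.reg r = σ.reg r := fun r hr hr' => by
    rw [← areg r hr]; simp [hσ₂, Instr.run, hr']
  have b27 : σ₂.reg 27 = v := by rw [← a27]; simp [hσ₂, Instr.run]
  set σ₃ := Instr.run W σ₂ (.write (.reg 8 * .reg 4) (.reg 10)) with hσ₃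
  set σ₄ := Instr.run W σ₃ (.write (.reg 8 * .reg 4 + .lit 1) (.bin .lt (.reg 8) (.reg 17)))
    with hσ₄
  have creg : σ₄.reg = σ₂.reg := rfl
  have ccode : σ₄.code = Function.update (Function.update σ.code (k * (l + 3)) (decide (2 ^ l ≤ v)))
      (k * (l + 3) + 1) (decide (k < p)) := by
    simp only [hσ₄, hσ₃, Instr.run, Expr.eval_mul, Expr.eval_add, Expr.eval_lt, Expr.eval_reg,
      Expr.eval_lit, breg 8 (by decide) (by decide), breg 4 (by decide) (by decide),
      breg 17 (by decide) (by decide), h8, hE.r4, h17, b10, m1 (k * (l + 3)) (by omega),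
      m1 1 (by omega), m1 (k * (l + 3) + 1) (by omega)]
    have e1 : decide ((if k < p then 1 else 0) % W ≠ 0) = decide (k < p) := by
      by_cases hc : k < p
      · rw [if_pos hc, m1 1 (by omega)]; simp [hc]
      · simp [hc]
    have e2 : decide (overflows l (fun _ => v) k ≠ 0) = decide (2 ^ l ≤ v) := by
      rw [overflows]
      by_cases hc : 2 ^ l ≤ v
      · rw [if_pos hc]; simp only [hc, ne_eq, one_ne_zero, not_false_eq_true, decide_true]
      · rw [if_neg hc]; simp only [hc, ne_eq, not_true, decide_false]
    rw [e1, e2]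
    rfl
  have ctime : σ₄.time = σ.time + 22 := by
    simp [hσ₄, hσ₃, hσ₂, hσ₁, Instr.run, Expr.cost_add, Expr.cost_sub, Expr.cost_mul,
      Expr.cost_reg, Expr.cost_lit, Expr.cost_bin]
  have cwrites : σ₄.writes = σ.writes + 2 := rfl
  have creads : σ₄.reads = σ.reads := rfl
  have cmem : σ₄.mem = σ.mem := rfl
  clear_value σ₄
  refine .seq (.instr (.seq (.instr (.seq (.instr (.seq (.instr (.seq (wp_writeBits
    (p := k * (l + 3) + 3) (d := 1) (c := l) (v := v) (h.le_word (by omega)) ?_ ?_ ?_ ?_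
    (by omega) ?_ (h.le_word (by omega)) ?_)))))))))
  · simp [Instr.run, Expr.eval_add, Expr.eval_mul, Expr.eval_reg, Expr.eval_lit, creg,
      breg 8 (by decide) (by decide), breg 4 (by decide) (by decide), h8, hE.r4,
      m1 (k * (l + 3)) (by omega), m1 3 (by omega), m1 (k * (l + 3) + 3) (by omega)]
  · simp [Instr.run, Expr.eval_lit, m1 1 (by omega)]
  · simp [Instr.run, Expr.eval_reg, creg, breg 5 (by decide) (by decide), hE.r5, m1 l (by omega)]
  · simp [Instr.run, Expr.eval_reg, creg, b27]
    exact m1 _ (by omega)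
  · exact h.le_word (by omega)
  intro τ hreg hm _ _ hr hw ht hc1 hc2
  have hreg' : ∀ r, r ∉ [11, 12, 23, 24, 25] → τ.reg r = σ₂.reg r := by
    intro r hr
    simp only [List.mem_cons, List.not_mem_nil, or_false, not_or] at hr
    rw [hreg r (by simp [hr])]
    simp [Instr.run, hr, creg]
  have dtime : τ.time ≤ σ.time + 50 + 30 * (l + 1) := by
    refine ht.trans ?_
    simp [Instr.run, ctime, Expr.cost_add, Expr.cost_mul, Expr.cost_reg, Expr.cost_lit]
  have dwrites : τ.writes = σ.writes + 2 + l := by rw [hw, ← cwrites]; rfl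
  have dreads : τ.reads = σ.reads := by rw [hr, ← creads]; rfl
  have dmem : τ.mem = σ.mem := by rw [hm, ← cmem]; rfl
  have dcode : ∀ m, (∀ u < l, m ≠ k * (l + 3) + 3 + u) → τ.code m = σ₄.code m := fun m hm' =>
    hc2 m fun u hu => by rw [Nat.mul_one]; exact hm' u hu
  refine .seq (.instr (.seq (.instr (.seq (.instr (.seq (.instr (wp_writeBits
    (p := p * (l + 3) + 2) (d := l + 3) (c := D.β * overflows l (fun _ => v) k) (v := v / 2 ^ l)
    (h.le_word (by omega)) ?_ ?_ ?_ ?_ (by omega) ?_ (h.le_word (by omega)) ?_))))))))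
  · simp [Instr.run, Expr.eval_add, Expr.eval_mul, Expr.eval_reg, Expr.eval_lit,
      hreg' 17 (by decide), hreg' 4 (by decide), breg 17 (by decide) (by decide),
      breg 4 (by decide) (by decide), h17, hE.r4, m2 (p * (l + 3)) (by omega), m1 2 (by omega),
      m2 (p * (l + 3) + 2) (by omega)]
  · simp [Instr.run, Expr.eval_reg, hreg' 4 (by decide), breg 4 (by decide) (by decide), hE.r4,
      m1 (l + 3) (by omega)]
  · simp [Instr.run, Expr.eval_mul, Expr.eval_reg, Expr.eval_lit, hreg' 10 (by decide), b10,
      m1 D.β (by omega), m1 (D.β * overflows l (fun _ => v) k) (by omega)]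
  · simp [Instr.run, Expr.eval_div, Expr.eval_reg, hreg' 27 (by decide), hreg' 6 (by decide), b27,
      breg 6 (by decide) (by decide), hE.r6, m1 (v / 2 ^ l) (by omega)]
  · have := Nat.mul_le_mul_right (l + 3) haβ
    exact h.lt_word (by omega)
  intro τ' hregf hmf _ _ hrf hwf htf hcf1 hcf2
  -- the spare bits have offset `2`, so they do not collide with the rest of the record
  have hcf2' : ∀ x, x % (l + 3) ≠ 2 → τ'.code x = τ.code x := by
    intro x hx
    refine hcf2 x fun u hu hxe => hx ?_
    rw [hxe, show p * (l + 3) + 2 + u * (l + 3) = (p + u) * (l + 3) + 2 by ring,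
      record_mod _ (by omega)]
  have o0 : (k * (l + 3)) % (l + 3) = 0 := Nat.mul_mod_left _ _
  have o1 : (k * (l + 3) + 1) % (l + 3) = 1 := record_mod _ (by omega)
  refine hQ _ (fun r hr' => ?_) ?_ ?_ ?_ ?_ ?_ ?_ ?_ (fun u hu => ?_) (fun u hu => ?_)
    (fun x hx1 hx2 => ?_)
  · simp only [List.mem_cons, List.not_mem_nil, or_false, not_or] at hr'
    rw [hregf r (by simp [hr'])]
    simp only [Instr.run, Function.update_apply, hr', if_false]
    rw [hreg' r (by simp [hr']), breg r (by simp [hr']) (by simp [hr'])]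
  · rw [hmf, ← dmem]; rfl
  · rw [hrf, ← dreads]; rfl
  · rw [hregf 10 (by decide)]
    simp [Instr.run, hreg' 10 (by decide), b10]
  · rw [hwf]; simp only [Instr.run]; rw [dwrites]; ring
  · simp only [Instr.run, Expr.cost_add, Expr.cost_mul, Expr.cost_reg, Expr.cost_lit,
      Expr.cost_div] at htf
    rw [storeTime]
    omega
  · rw [hcf2' _ (by rw [o0]; omega), dcode _ (fun u hu => by omega), ccode,
      Function.update_of_ne (by omega), Function.update_self]
  · rw [hcf2' _ (by rw [o1]; omega), dcode _ (fun u hu => by omega), ccode, Function.update_self]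
  · rw [hcf2' _ (by rw [Nat.add_assoc, record_mod _ (by omega : 3 + u < l + 3)]; omega)]
    have := hc1 u hu
    rwa [Nat.mul_one] at this
  · rw [← hcf1 u hu]
    congr 1; ring
  · rw [hcf2 x fun u hu hxe => hx2 u hu (by rw [hxe]; ring)]
    change τ.code x = σ.code x
    have hne : ∀ o, o < l + 3 → o ≠ 2 → x ≠ k * (l + 3) + o := by
      intro o ho ho2 hxe
      apply ho2
      rw [← record_mod k ho, ← hxe]
      exact hx1 (by rw [hxe, record_div k ho])
    rw [dcode x fun u hu => by rw [Nat.add_assoc]; exact hne (3 + u) (by omega) (by omega), ccode,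
      Function.update_of_ne (hne 1 (by omega) (by omega)),
      Function.update_of_ne (by simpa using hne 0 (by omega) (by omega))]

theorem wp_rewrite {R : ℕ → ℕ} {p₀ po m : ℕ} (h : Room D W n L l S)
    (hE : Env D n L i s l σ) (h8 : σ.reg 8 = i / D.b + m) (hm : i / D.b + m ≤ n / D.b + 1)
    (h9 : σ.reg 9 = po) (h17 : σ.reg 17 = queuePos D.β (overflows l R) (i / D.b) p₀ m)
    (h21 : σ.reg 21 = p₀) (hp₀ : p₀ ≤ (D.β + 1) * (i / D.b))
    (hpo : po ≤ (D.β + 1) * (i / D.b + m)) (hmem : ∀ j < m, σ.mem 0 (i / D.b + j) = R (i / D.b + j))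
    (hR : ∀ k, R k ≤ S)
    (hQ : ∀ τ, τ.code = rewriteCode (l + 3) l D.β σ.code R (i / D.b) p₀
        (max po (queuePos D.β (overflows l R) (i / D.b) p₀ m)) m → τ.reads = σ.reads →
      τ.writes = σ.writes + (max po (queuePos D.β (overflows l R) (i / D.b) p₀ m) - p₀) +
        ∑ j ∈ Finset.range m, (2 + l + D.β * overflows l R (i / D.b + j)) →
      m ≤ τ.time →
      τ.time ≤ σ.time + 100 +
        30 * (max po (queuePos D.β (overflows l R) (i / D.b) p₀ m) - p₀) + D.storeTime * m →
      Q τ) :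
    WP W D.rewrite Q σ := by
  have hH := h.H_le
  have hS2 := h.two_le
  have hn := h.n_le
  have hnb : n / D.b ≤ n := Nat.div_le_self _ _
  have m1 : ∀ x ≤ 7 * S, x % W = x := fun x hx => Nat.mod_eq_of_lt (h.le_word hx)
  have m2 : ∀ x ≤ 15 * (S * S), x % W = x := fun x hx => Nat.mod_eq_of_lt (h.lt_word hx)
  have hSS : 2 * S ≤ S * S := Nat.mul_le_mul_right S hS2
  set k₀ := i / D.b with hk₀
  have hpos := h.pos_le
  have hN : (D.β + 1) * (k₀ + m) ≤ (D.β + 1) * (n / D.b + 1) := Nat.mul_le_mul_left _ hm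
  have hN0 : (D.β + 1) * k₀ ≤ (D.β + 1) * (k₀ + m) := Nat.mul_le_mul_left _ (by omega)
  have hP : ∀ j, queuePos D.β (overflows l R) k₀ p₀ j ≤ (D.β + 1) * (k₀ + j) :=
    queuePos_le_mul (overflows_le_one _ _) hp₀
  have hPm := hP m
  have hp0m := queuePos_mono D.β (overflows l R) k₀ p₀ (Nat.zero_le m)
  rw [queuePos] at hp0m
  set pn := queuePos D.β (overflows l R) k₀ p₀ m with hpn
  have hp1 : p₀ * (l + 3) ≤ S * S := Nat.mul_le_mul (by omega) hH
  have hp2 : (max po pn - p₀) * (l + 3) ≤ S * S := Nat.mul_le_mul (by omega) hH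
  refine .seq (.instr (.seq (.instr (.seq (.instr (.seq (.instr (.seq (.instr (.seq (wp_writeBits
    (p := p₀ * (l + 3) + 2) (d := l + 3) (c := max po pn - p₀) (v := 0)
    (h.le_word (by omega)) ?_ ?_ ?_ ?_ (by omega) ?_ (h.le_word (by omega)) ?_)))))))))))
  · simp [Instr.run, Expr.eval_add, Expr.eval_mul, Expr.eval_reg, Expr.eval_lit, h21, hE.r4,
      m2 (p₀ * (l + 3)) (by omega), m1 2 (by omega), m2 (p₀ * (l + 3) + 2) (by omega)]
  · simp [Instr.run, Expr.eval_reg, hE.r4, m1 (l + 3) (by omega)]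
  · simp [Instr.run, Expr.eval_add, Expr.eval_sub, Expr.eval_reg, h9, h17, h21,
      m1 (pn - po) (by omega), m1 (po + (pn - po)) (by omega),
      m1 (po + (pn - po) - p₀) (by omega)]
    omega
  · simp [Instr.run, Expr.eval_lit]
  · exact h.lt_word (by omega)
  intro τ hreg hmm _ _ hr hw ht hc1 hc2
  have hreg' : ∀ r, r ∉ [11, 12, 23, 24, 25, 29] → τ.reg r = σ.reg r := by
    intro r hr
    simp only [List.mem_cons, List.not_mem_nil, or_false, not_or] at hr
    rw [hreg r (by simp [hr])]
    simp [Instr.run, hr]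
  have e29 : τ.reg 29 = k₀ + m := by
    rw [hreg 29 (by decide)]
    simp [Instr.run, Expr.eval_reg, h8, m1 (k₀ + m) (by omega)]
  have etime : τ.time ≤ σ.time + 60 + 30 * (max po pn - p₀) := by
    refine ht.trans ?_
    simp [Instr.run, Expr.cost_add, Expr.cost_sub, Expr.cost_mul, Expr.cost_reg, Expr.cost_lit]
    omega
  have ewrites : τ.writes = σ.writes + (max po pn - p₀) := by rw [hw]; rfl
  have ereads : τ.reads = σ.reads := by rw [hr]; rfl
  have emem : τ.mem = σ.mem := by rw [hmm]; rfl
  have ecode : τ.code = rewriteCode (l + 3) l D.β σ.code R k₀ p₀ (max po pn) 0 := by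
    funext x
    have hxd : x / (l + 3) * (l + 3) + x % (l + 3) = x := Nat.div_add_mod' x (l + 3)
    rw [rewriteCode]
    split
    · rename_i hx2
      split
      · rename_i hx
        have := hc1 (x / (l + 3) - p₀) (by omega)
        rw [show p₀ * (l + 3) + 2 + (x / (l + 3) - p₀) * (l + 3) =
          (p₀ + (x / (l + 3) - p₀)) * (l + 3) + 2 by ring,
          show p₀ + (x / (l + 3) - p₀) = x / (l + 3) by omega, ← hx2, hxd] at this
        rw [this]
        simp
      · rename_i hx
        refine hc2 x fun u hu hxe => hx ?_
        rw [show p₀ * (l + 3) + 2 + u * (l + 3) = (p₀ + u) * (l + 3) + 2 by ring] at hxe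
        rw [hxe, record_div _ (by omega)]
        omega
    · rename_i hx2
      rw [if_neg (by omega)]
      refine hc2 x fun u hu hxe => hx2 ?_
      rw [show p₀ * (l + 3) + 2 + u * (l + 3) = (p₀ + u) * (l + 3) + 2 by ring] at hxe
      rw [hxe, record_mod _ (by omega)]
  refine .seq (.instr (.seq (.instr (.loop_time (fun j ρ => Env D n L i s l ρ ∧
    ρ.reg 8 = k₀ + j ∧ ρ.reg 17 = queuePos D.β (overflows l R) k₀ p₀ j ∧ ρ.reg 29 = k₀ + m ∧
    ρ.mem = σ.mem ∧ ρ.code = rewriteCode (l + 3) l D.β σ.code R k₀ p₀ (max po pn) j ∧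
    ρ.reads = σ.reads ∧ ρ.writes = σ.writes + (max po pn - p₀) +
      ∑ u ∈ Finset.range j, (2 + l + D.β * overflows l R (k₀ + u)) ∧
    ρ.time ≤ σ.time + 70 + 30 * (max po pn - p₀) + D.storeTime * j) m ?_ ?_ ?_))))
  · refine ⟨hE.congr fun r hr => ?_, ?_, ?_, ?_, emem, ecode, ereads, ?_, ?_⟩
    · have hr' : r ≠ 8 ∧ r ≠ 17 ∧ r ∉ [11, 12, 23, 24, 25, 29] := by simp at hr ⊢; omega
      simp only [Instr.run, Function.update_apply, hr', if_false]
      exact hreg' r hr'.2.2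
    · simp [Instr.run, Expr.eval_reg, hreg' 22, hE.r22]
      exact m1 _ (by omega)
    · simp [Instr.run, Expr.eval_reg, hreg' 21, h21, queuePos]
      exact m1 _ (by omega)
    · simp [Instr.run, e29]
    · simp [Instr.run, ewrites]
    · simp [Instr.run, Expr.cost_reg]; omega
  · rintro j hj ρ ⟨hEρ, e8, e17, e29', hmemρ, hcρ, hrρ, hwρ, htρ⟩
    refine ⟨by simp [Expr.eval_lt, Expr.eval_reg, e8, e29', hj, m1 1 (by omega)], ?_⟩
    set cond := Expr.bin .lt (.reg 8) (.reg 29) with hcond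
    have hcost : cond.cost = 3 := rfl
    have hkj : k₀ + j ≤ n / D.b := by omega
    have hPj := hP j
    have hNj : (D.β + 1) * (k₀ + j) ≤ (D.β + 1) * (n / D.b + 1) := Nat.mul_le_mul_left _ (by omega)
    have hov : overflows l (fun _ => R (k₀ + j)) (k₀ + j) = overflows l R (k₀ + j) := rfl
    refine .seq (wp_storeBlock (k := k₀ + j) (v := R (k₀ + j)) h (hEρ.congr fun r _ => rfl)
      e8 hkj e17
      (hPj.trans hNj) (by rw [show (ρ.test cond).mem = σ.mem from hmemρ]; exact hmem j hj)
      (hR _) fun τ₁ hreg₁ hmem₁ hr₁ e10 hw₁ ht₁ hf1 hf2 hf3 hf4 hf5 => ?_)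
    rw [hov] at e10 hw₁ hf4 hf5
    have f8 : τ₁.reg 8 = k₀ + j := by rw [hreg₁ 8 (by decide)]; exact e8
    have f17 : τ₁.reg 17 = queuePos D.β (overflows l R) k₀ p₀ j := by
      rw [hreg₁ 17 (by decide)]; exact e17
    obtain ⟨g1, g2, g3⟩ := eval_advance (ρ := τ₁.reg) (p := 17) (e := .reg 10) h f8 hkj f17 hPj
      e10 (overflows_le_one _ _ _)
    refine .seq (.instr (.instr ⟨?_, ?_, ?_, ?_, ?_, ?_, ?_, ?_, ?_⟩))
    · refine hEρ.congr fun r hr => ?_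
      have hr' : r ≠ 8 ∧ r ≠ 17 ∧ r ∉ [10, 11, 12, 23, 24, 25, 27] := by simp at hr ⊢; omega
      simp only [Instr.run, Function.update_apply, hr', if_false]
      rw [hreg₁ r hr'.2.2]
      rfl
    · simp [Instr.run, Expr.eval_add, Expr.eval_reg, Expr.eval_lit, f8, m1 1 (by omega),
        Nat.add_assoc]
      exact m1 _ (by omega)
    · simp only [Instr.run]
      rw [Function.update_of_ne (by norm_num), Function.update_self, g1, m1 _ (by omega)]
      rfl
    · simp only [Instr.run]
      rw [Function.update_of_ne (by norm_num), Function.update_of_ne (by norm_num),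
        hreg₁ 29 (by decide)]
      exact e29'
    · change τ₁.mem = σ.mem
      rw [hmem₁]; exact hmemρ
    · change τ₁.code = _
      refine rewriteCode_succ hcρ ?_ hf1 hf2 hf3 hf4 hf5
      exact le_trans (queuePos_mono _ _ _ _ (by omega)) (le_max_right _ _)
    · change τ₁.reads = σ.reads
      rw [hr₁]; exact hrρ
    · change τ₁.writes = _
      rw [hw₁, Finset.sum_range_succ]
      simp only [Machine.test]
      rw [hwρ]; ring
    · simp only [Instr.run, advance, Expr.cost_add, Expr.cost_sub, Expr.cost_mul,
        Expr.cost_reg, Expr.cost_lit]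
      simp only [Machine.test, hcost] at ht₁
      rw [Nat.mul_succ]
      omega
  · rintro ρ ⟨hEρ, e8, e17, e29', hmemρ, hcρ, hrρ, hwρ, htρ⟩ htm
    refine ⟨by simp [Expr.eval_lt, Expr.eval_reg, e8, e29'], hQ _ hcρ hrρ hwρ ?_ ?_⟩
    · simp only [Machine.test]; omega
    · simp only [Machine.test, Expr.cost_bin, Expr.cost_reg]; omega

/-- A bound for the time per block of the local updater. -/
def updateTime (D : Coder) : ℕ :=
  D.recomputeTime + D.storeTime + 30 * (D.β + 2) + 300 +
    (Expr.table (2 ^ ·) (.reg 5) (D.lmax + 1)).cost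

theorem wp_localUpdater (h : Room D W n L l S) (hi : i + s ≤ n) (hs : 1 ≤ s)
    (hinp : ∀ x, σ.inp x < D.q)
    (h0 : σ.reg 0 = n) (h1 : σ.reg 1 = L) (h2 : σ.reg 2 = i) (h3 : σ.reg 3 = s)
    (hQ : ∀ τ m, (∀ j < m, D.Unsettled n i s l σ.inp σ.code j) →
      ¬ D.Unsettled n i s l σ.inp σ.code m →
      τ.code = rewriteCode (l + 3) l D.β σ.code (D.newRank n i s l σ.inp σ.code (i / D.b))
        (i / D.b) (scanPos D.β (flag (l + 3) σ.code) (busy (l + 3) σ.code) (i / D.b))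
        (max (D.foundPos l σ.code (i / D.b) m) (D.newPos n i s l σ.inp σ.code (i / D.b) m)) m →
      τ.reads = σ.reads + 1 + 2 * scanLen (busy (l + 3) σ.code) (i / D.b) +
        ∑ j ∈ Finset.range m, (1 + l + D.β * flag (l + 3) σ.code (i / D.b + j)) →
      τ.writes = σ.writes +
        (max (D.foundPos l σ.code (i / D.b) m) (D.newPos n i s l σ.inp σ.code (i / D.b) m) -
          scanPos D.β (flag (l + 3) σ.code) (busy (l + 3) σ.code) (i / D.b)) +
        ∑ j ∈ Finset.range m, (2 + l + D.β *
          overflows l (D.newRank n i s l σ.inp σ.code (i / D.b)) (i / D.b + j)) →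
      m ≤ τ.time →
      τ.time ≤ σ.time +
        D.updateTime * (scanLen (busy (l + 3) σ.code) (i / D.b) + m + 1) → Q τ) :
    WP W D.localUpdater Q σ := by
  refine .seq (wp_setup h hi hs h0 h1 h2 h3 fun σ₁ hE₁ e8₁ _ hi₁ hc₁ _ hr₁ hw₁ ht₁ => ?_)
  refine .seq (wp_scanLeft h (by omega) hE₁ e8₁ fun σ₂ hs₂ e8₂ e9₂ hr₂ ht₂ => ?_)
  have hE₂ : Env D n L i s l σ₂ := hE₁.congr fun r hr => hs₂.reg r (by
    simp at hr ⊢; omega)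
  rw [hc₁] at e9₂ hr₂ ht₂
  have hc₂ : σ₂.code = σ.code := by rw [hs₂.code, hc₁]
  have hi₂ : σ₂.inp = σ.inp := by rw [hs₂.inp, hi₁]
  have hle : i / D.b ≤ n / D.b := Nat.div_le_div_right (by omega)
  have hp0 := scanPos_le D.β (busy (l + 3) σ.code) (flag_le (l + 3) σ.code) (i / D.b)
  have hlen := le_scanPos_add D.β (flag (l + 3) σ.code) (busy (l + 3) σ.code) (i / D.b)
  refine .seq (wp_recompute h hE₂ hi (by rw [hi₂]; exact hinp) e8₂ (by rw [hc₂]; exact e9₂)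
    fun σ₃ m hun hset hE₃ e8 e9 e17 e21 hmem hc₃ hr₃ hw₃ htm ht₃ => ?_)
  rw [hi₂, hc₂] at e17 e21 hmem hset
  rw [hc₂] at e9 hc₃ hr₃
  simp only [hi₂, hc₂] at hun
  have hmN : i / D.b + m ≤ n / D.b + 1 := by
    rcases Nat.eq_zero_or_pos m with hm0 | hm0
    · omega
    · have := (hun (m - 1) (by omega)).2; omega
  have hfp : D.foundPos l σ.code (i / D.b) m ≤ (D.β + 1) * (i / D.b + m) :=
    queuePos_le_mul (flag_le _ _) hp0 m
  have hb1 : D.foundPos l σ.code (i / D.b) m ≤ _ :=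
    queuePos_le_add (flag_le _ _) (i / D.b)
      (scanPos D.β (flag (l + 3) σ.code) (busy (l + 3) σ.code) (i / D.b)) m
  have hb2 : D.newPos n i s l σ.inp σ.code (i / D.b) m ≤ _ :=
    queuePos_le_add (overflows_le_one _ _) (i / D.b)
      (scanPos D.β (flag (l + 3) σ.code) (busy (l + 3) σ.code) (i / D.b)) m
  refine wp_rewrite (R := D.newRank n i s l σ.inp σ.code (i / D.b)) h hE₃ e8 hmN e9 e17 e21 hp0
    hfp hmem (fun k => (newRank_lt h hinp _ _ _).le.trans h.pow_le)
    fun τ hcτ hrτ hwτ hmτ htτ => ?_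
  rw [hc₃] at hcτ
  refine hQ τ m hun hset hcτ ?_ ?_ hmτ ?_
  · rw [hrτ, hr₃, hr₂, hr₁]
  · rw [hwτ, hw₃, hs₂.writes, hw₁]
    rfl
  · have hut : D.updateTime = D.recomputeTime + D.storeTime + 30 * (D.β + 2) + 300 +
      (Expr.table (2 ^ ·) (.reg 5) (D.lmax + 1)).cost := rfl
    change τ.time ≤ σ₃.time + 100 + 30 * (max (D.foundPos l σ.code (i / D.b) m)
      (D.newPos n i s l σ.inp σ.code (i / D.b) m) - _) + _ at htτ
    set len := scanLen (busy (l + 3) σ.code) (i / D.b)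
    set p₀ := scanPos D.β (flag (l + 3) σ.code) (busy (l + 3) σ.code) (i / D.b)
    set X := max (D.foundPos l σ.code (i / D.b) m) (D.newPos n i s l σ.inp σ.code (i / D.b) m)
    have hX : X - p₀ ≤ len + (D.β + 1) * m := by omega
    have hT : D.updateTime * (len + m + 1) = D.recomputeTime * m + D.storeTime * m +
        30 * ((D.β + 1) * m) + 30 * m + 300 * m +
        (Expr.table (2 ^ ·) (.reg 5) (D.lmax + 1)).cost * m + D.updateTime * len +
        D.updateTime := by
      rw [hut]; ring
    have h50 : 80 * len ≤ D.updateTime * len := Nat.mul_le_mul_right _ (by omega)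
    rw [Nat.mul_succ] at ht₃
    omega

end Coder

namespace Coder

/-! ### Correctness of the codeword operations -/

variable {D : Coder} {W n L i s l S : ℕ}

/-- The number of block `k` of the symbol sequence `d`. -/
def blockRank (D : Coder) (d : ℕ → ℕ) (k : ℕ) : ℕ :=
  D.rank (digitsVal D.q (fun u => d (k * D.b + u)) D.b)

/-- `rank` numbers the blocks with `β` bits, with inverse `unrank`; the zero block has number
zero. -/
structure Numbering (D : Coder) : Prop where
  unrank_rank : ∀ v < D.q ^ D.b, D.unrank (D.rank v) = v
  rank_zero : D.rank 0 = 0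
  pow_le : D.q ^ D.b ≤ 2 ^ D.β

/-- The code memory `c` holds the codeword of the sequence `d` of `n` symbols. -/
def Holds (D : Coder) (n L l : ℕ) (d : ℕ → ℕ) (c : ℕ → Bool) : Prop :=
  ∀ x < L, c x = codeImage (l + 3) l D.β (n / D.b + 1) (D.blockRank d) x

/-- The position of the queue before block `k`. -/
def pos (D : Coder) (l : ℕ) (d : ℕ → ℕ) (k : ℕ) : ℕ :=
  queuePos D.β (overflows l (D.blockRank d)) 0 0 k

theorem blockRank_congr {d d' : ℕ → ℕ} {k : ℕ} (h : ∀ u < D.b, d (k * D.b + u) = d' (k * D.b + u)) :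
    D.blockRank d k = D.blockRank d' k := by
  rw [blockRank, blockRank]
  congr 1
  exact Finset.sum_congr rfl fun u hu => congrArg (_ * ·) (h u (Finset.mem_range.1 hu))

theorem blockRank_lt (h : Room D W n L l S) {d : ℕ → ℕ} (hd : ∀ u, d u < D.q) (k : ℕ) :
    D.blockRank d k < D.q ^ D.b :=
  h.rank_lt _ (digitsVal_lt (fun _ => hd _) _)

theorem blockRank_eq_zero (hD : D.Numbering) (hb : 2 ≤ D.b) {d : ℕ → ℕ} (hd : ∀ u, n ≤ u → d u = 0)
    {k : ℕ} (hk : n / D.b + 1 ≤ k) : D.blockRank d k = 0 := by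
  have h1 : n < k * D.b := (Nat.div_lt_iff_lt_mul (by omega)).1 hk
  rw [blockRank, digitsVal, Finset.sum_eq_zero fun u _ => by rw [hd _ (by omega), Nat.mul_zero],
    hD.rank_zero]

theorem unrank_blockRank (hD : D.Numbering) {d : ℕ → ℕ} (hd : ∀ u, d u < D.q) {k u : ℕ}
    (hu : u < D.b) : D.unrank (D.blockRank d k) / D.q ^ u % D.q = d (k * D.b + u) := by
  rw [blockRank, hD.unrank_rank _ (digitsVal_lt (fun _ => hd _) _)]
  exact digitsVal_digit (d := fun u => d (k * D.b + u)) (fun _ => hd _) hu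

theorem pos_add (l : ℕ) (d : ℕ → ℕ) (k j : ℕ) :
    queuePos D.β (overflows l (D.blockRank d)) k (D.pos l d k) j = D.pos l d (k + j) :=
  queuePos_add _ _ _ _

section Holds

variable {d : ℕ → ℕ} {c : ℕ → Bool}

theorem record_le (h : Room D W n L l S) {k : ℕ} (hk : k < n / D.b + 1) :
    k * (l + 3) + (l + 3) ≤ L := by
  rw [← Nat.succ_mul]
  exact (Nat.mul_le_mul_right _ hk).trans h.fits

theorem flag_eq (h : Room D W n L l S) (hc : D.Holds n L l d c) {k : ℕ} (hk : k < n / D.b + 1) :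
    flag (l + 3) c k = overflows l (D.blockRank d) k := by
  have := record_le h hk
  rw [flag, hc _ (by omega), codeImage_flag (by omega), overflows]
  split <;> simp_all

theorem busy_eq (h : Room D W n L l S) (hc : D.Holds n L l d c) {k : ℕ} (hk : k < n / D.b + 1) :
    busy (l + 3) c k = decide (k < D.pos l d k) := by
  have := record_le h hk
  rw [busy, hc _ (by omega), codeImage_busy (by omega) hk]
  rfl

theorem scanPos_eq_pos (h : Room D W n L l S) (hc : D.Holds n L l d c) {k : ℕ}
    (hk : k < n / D.b + 1) : scanPos D.β (flag (l + 3) c) (busy (l + 3) c) k = D.pos l d k := by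
  rw [scanPos_congr (a' := overflows l (D.blockRank d)) (fun j hj => flag_eq h hc (by omega))
    fun j _ => rfl]
  exact scanPos_eq fun j hj => busy_eq h hc (by omega)

theorem foundPos_eq (h : Room D W n L l S) (hc : D.Holds n L l d c) {k j : ℕ}
    (hk : k < n / D.b + 1) (hj : k + j ≤ n / D.b + 1) :
    D.foundPos l c k j = D.pos l d (k + j) := by
  rw [foundPos, scanPos_eq_pos h hc hk, ← pos_add]
  exact queuePos_congr fun u hu => flag_eq h hc (by omega)

/-- The decoder that scans to the left agrees with the one that starts at the first block. -/
theorem foundSymbol_congr (h : Room D W n L l S) (hc : D.Holds n L l d c) {k x : ℕ}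
    (hk : k ≤ x / D.b) (hx : x < n) : D.foundSymbol l c k x = D.foundSymbol l c 0 x := by
  have hx' : x / D.b ≤ n / D.b := Nat.div_le_div_right hx.le
  rw [foundSymbol, foundSymbol, foundPos_eq (k := k) (j := x / D.b - k) h hc (by omega) (by omega),
    foundPos_eq (k := 0) (j := x / D.b - 0) h hc (by omega) (by omega),
    show k + (x / D.b - k) = 0 + (x / D.b - 0) by omega]

/-- If the queue does not outgrow the codeword, then every symbol is decoded correctly. -/
theorem foundSymbol_eq (h : Room D W n L l S) (hD : D.Numbering) (hd : ∀ u, d u < D.q)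
    (hc : D.Holds n L l d c) (hG : D.pos l d (n / D.b + 1) ≤ n / (D.b - 1)) {x : ℕ} (hx : x < n) :
    D.foundSymbol l c 0 x = d x := by
  have hb := h.b_pos
  have hx' : x / D.b < n / D.b + 1 := Nat.lt_succ_of_le (Nat.div_le_div_right hx.le)
  rw [foundSymbol, foundPos_eq (k := 0) (j := x / D.b - 0) h hc (Nat.succ_pos _)
    (by simpa using hx'.le), Nat.sub_zero, Nat.zero_add, pos,
    readBlock_eq hc, unrank_blockRank hD hd (Nat.mod_lt _ (by omega)), Nat.div_add_mod']
  · refine (blockRank_lt h hd _).trans_le (hD.pow_le.trans ?_)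
    exact Nat.pow_le_pow_right (by omega) (by omega)
  · exact record_le h hx'
  · intro ho
    have h1 := queuePos_spare_le (β := D.β) (overflows_eq_one.1 ho) hx'
    have h2 : n / (D.b - 1) * (l + 3) ≤ L := by
      rw [← h.recLen, mul_comm]; exact Nat.div_mul_le_self _ _
    exact (Nat.mul_le_mul_right _ (h1.trans hG)).trans h2

/-- The sequence `d` with the fragment of length `s` at position `i` replaced by `e`. -/
def replaced (d e : ℕ → ℕ) (i s x : ℕ) : ℕ := if i ≤ x ∧ x < i + s then e (x - i) else d x

variable {e : ℕ → ℕ}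

theorem newRank_eq (h : Room D W n L l S) (hd0 : ∀ u, n ≤ u → d u = 0)
    (hdec : ∀ x < n, (x < i ∨ i + s ≤ x) → i / D.b ≤ x / D.b →
      D.foundSymbol l c (i / D.b) x = d x) {k : ℕ} (hk : i / D.b ≤ k) :
    D.newRank n i s l e c (i / D.b) k = D.blockRank (replaced d e i s) k := by
  have hb := h.b_pos
  rw [newRank, blockRank]
  congr 1
  refine Finset.sum_congr rfl fun u hu => ?_
  congr 1
  have hu := Finset.mem_range.1 hu
  change _ = replaced d e i s (k * D.b + u)
  rw [newDigit, replaced]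
  split
  · rfl
  · rename_i hf
    have hdiv : (k * D.b + u) / D.b = k := record_div k hu
    have hmod : (k * D.b + u) % D.b = u := record_mod k hu
    split
    · rename_i hx
      rw [← hdec _ hx (by omega) (by omega), foundSymbol, hdiv, hmod]
    · exact (hd0 _ (by omega)).symm

theorem rewriteCode_congr {H l β : ℕ} {c : ℕ → Bool} {r r' : ℕ → ℕ} {k₀ p₀ p₁ m : ℕ}
    (h : ∀ k, k₀ ≤ k → r k = r' k) :
    rewriteCode H l β c r k₀ p₀ p₁ m = rewriteCode H l β c r' k₀ p₀ p₁ m := by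
  have hov : ∀ k, k₀ ≤ k → overflows l r k = overflows l r' k := fun k hk => by
    rw [overflows, overflows, h k hk]
  have hq : ∀ j, queuePos β (overflows l r) k₀ p₀ j = queuePos β (overflows l r') k₀ p₀ j :=
    fun j => queuePos_congr fun u _ => hov _ (by omega)
  have hr : ∀ j, r (k₀ + j) = r' (k₀ + j) := fun j => h _ (by omega)
  funext x
  simp only [rewriteCode, hq, hr]
  by_cases hx : k₀ ≤ x / H
  · simp only [h _ hx]
  · simp [hx]

theorem unsettled_le (hi : i + s ≤ n) {m : ℕ} (hm : ∀ j < m, D.Unsettled n i s l e c j) :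
    i / D.b + m ≤ n / D.b + 1 := by
  have hk : i / D.b ≤ n / D.b := Nat.div_le_div_right (by omega)
  rcases Nat.eq_zero_or_pos m with rfl | hm0
  · omega
  · have := (hm (m - 1) (by omega)).2; omega

theorem le_of_settled (hi : i + s ≤ n) {m : ℕ} (hm : ¬ D.Unsettled n i s l e c m) :
    (i + s - 1) / D.b + 1 ≤ i / D.b + m := by
  have hk : (i + s - 1) / D.b ≤ n / D.b := Nat.div_le_div_right (by omega)
  rw [Unsettled] at hm
  by_contra hlt
  exact hm ⟨Or.inl (by omega), by omega⟩

theorem newPos_eq (h : Room D W n L l S) (hc : D.Holds n L l d c)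
    (hd0 : ∀ u, n ≤ u → d u = 0) (hi : i + s ≤ n)
    (hdec : ∀ x < n, (x < i ∨ i + s ≤ x) → i / D.b ≤ x / D.b →
      D.foundSymbol l c (i / D.b) x = d x) (m : ℕ) :
    D.newPos n i s l e c (i / D.b) m = D.pos l (replaced d e i s) (i / D.b + m) := by
  have hb := h.b_pos
  have hk : i / D.b ≤ n / D.b := Nat.div_le_div_right (by omega)
  have hp : D.pos l d (i / D.b) = D.pos l (replaced d e i s) (i / D.b) := by
    refine queuePos_congr fun u hu => ?_
    have : D.blockRank d (0 + u) = D.blockRank (replaced d e i s) (0 + u) := by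
      refine blockRank_congr fun t ht => (if_neg fun hf => ?_).symm
      have h1 : (0 + u + 1) * D.b ≤ i :=
        (Nat.mul_le_mul_right _ (by omega)).trans (Nat.div_mul_le_self i D.b)
      rw [Nat.succ_mul] at h1
      omega
    rw [overflows, overflows, this]
  rw [newPos, scanPos_eq_pos h hc (by omega), hp, ← pos_add]
  exact queuePos_congr fun u _ => by
    rw [overflows, overflows, newRank_eq h hd0 hdec (by omega)]

/-- The rewritten codeword is the codeword of the updated sequence. -/
theorem holds_rewriteCode (h : Room D W n L l S) (hD : D.Numbering) (hc : D.Holds n L l d c)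
    (hd0 : ∀ u, n ≤ u → d u = 0) (hi : i + s ≤ n) (hs : 1 ≤ s)
    (hdec : ∀ x < n, (x < i ∨ i + s ≤ x) → i / D.b ≤ x / D.b →
      D.foundSymbol l c (i / D.b) x = d x) {m : ℕ}
    (hm : ∀ j < m, D.Unsettled n i s l e c j) (hm' : ¬ D.Unsettled n i s l e c m) :
    D.Holds n L l (replaced d e i s) (rewriteCode (l + 3) l D.β c
      (D.newRank n i s l e c (i / D.b)) (i / D.b)
      (scanPos D.β (flag (l + 3) c) (busy (l + 3) c) (i / D.b))
      (max (D.foundPos l c (i / D.b) m) (D.newPos n i s l e c (i / D.b) m)) m) := by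
  have hb := h.b_pos
  have hk : i / D.b ≤ n / D.b := Nat.div_le_div_right (by omega)
  have hN := unsettled_le hi hm
  have hJ := le_of_settled hi hm'
  have hr0 : ∀ u, n ≤ u → replaced d e i s u = 0 := fun u hu => by
    rw [replaced, if_neg (by omega), hd0 u hu]
  rw [rewriteCode_congr fun k hk => newRank_eq h hd0 hdec hk, scanPos_eq_pos h hc (by omega),
    foundPos_eq h hc (by omega) hN, newPos_eq h hc hd0 hi hdec]
  intro x hx
  refine rewriteCode_eq hc (fun k hk => ?_) (fun k hk => ?_) hN
    (fun k hk => blockRank_eq_zero hD hb hd0 hk) (fun k hk => blockRank_eq_zero hD hb hr0 hk)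
    (fun hlt => ?_) hx
  · refine blockRank_congr fun t ht => (if_neg fun hf => ?_).symm
    have h1 : (k + 1) * D.b ≤ i :=
      (Nat.mul_le_mul_right _ (by omega)).trans (Nat.div_mul_le_self i D.b)
    rw [Nat.succ_mul] at h1
    omega
  · refine blockRank_congr fun t ht => (if_neg fun hf => ?_).symm
    have h1 : i + s - 1 < ((i + s - 1) / D.b + 1) * D.b := Nat.lt_mul_of_div_lt
      (Nat.lt_succ_self _) (by omega)
    have h2 : ((i + s - 1) / D.b + 1) * D.b ≤ k * D.b := Nat.mul_le_mul_right _ (by omega)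
    omega
  · by_contra hne
    refine hm' ⟨Or.inr ?_, hlt⟩
    rw [foundPos_eq h hc (by omega) hN, newPos_eq h hc hd0 hi hdec]
    exact hne

/-- The empty code memory holds the codeword of the zero sequence. -/
theorem holds_zero (hD : D.Numbering) : D.Holds n L l (fun _ => 0) fun _ => false := by
  have hr : D.blockRank (fun _ => 0) = fun _ => 0 := by
    funext k; simp [blockRank, digitsVal, hD.rank_zero]
  have ho : overflows l (fun _ => 0) = fun _ => 0 := by
    funext k; simp [overflows]
  have hq : ∀ k, queuePos D.β (fun _ => 0) 0 0 k = k := by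
    intro k
    induction k with
    | zero => rfl
    | succ k ih => rw [queuePos, ih]; simp
  intro x _
  simp [codeImage, hr, ho, hq]

end Holds

end Coder

/-! ### The block scheme and its programs -/

section Symbols

variable {𝒳 : Type*} {q n s : ℕ} (sym : 𝒳 ≃ Fin q)

theorem symbols_of_lt (x : Fin n → 𝒳) {k : ℕ} (h : k < n) : symbols sym x k = sym (x ⟨k, h⟩) :=
  dif_pos h

theorem symbols_eq_zero (x : Fin n → 𝒳) {k : ℕ} (h : n ≤ k) : symbols sym x k = 0 :=
  dif_neg (by omega)

theorem symbols_lt (hq : 0 < q) (x : Fin n → 𝒳) (k : ℕ) : symbols sym x k < q := by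
  rw [symbols]
  split
  · exact Fin.is_lt _
  · exact hq

theorem symbols_splice (x : Fin n → 𝒳) {i : ℕ} (v : Fin s → 𝒳) (hi : i + s ≤ n) :
    symbols sym (splice x i v) = Coder.replaced (symbols sym x) (symbols sym v) i s := by
  funext k
  rw [Coder.replaced]
  split
  · rename_i hk
    rw [symbols_of_lt sym _ (by omega : k < n), splice, dif_pos hk,
      symbols_of_lt sym _ (by omega : k - i < s)]
  · rename_i hk
    by_cases hkn : k < n
    · rw [symbols_of_lt sym _ hkn, splice, dif_neg hk, symbols_of_lt sym _ hkn]
    · rw [symbols_eq_zero sym _ (by omega), symbols_eq_zero sym _ (by omega)]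

end Symbols

namespace Coder

variable {𝒳 : Type*} {D : Coder} {W n L i s l S n₀ κ : ℕ} {sym : 𝒳 ≃ Fin D.q}

section Scheme

variable [Nonempty 𝒳]

theorem q_pos_of_nonempty (sym : 𝒳 ≃ Fin D.q) : 0 < D.q :=
  Fin.pos (sym (Classical.arbitrary 𝒳))

/-- The compression scheme with payloads of `l` bits. -/
noncomputable def blockScheme (D : Coder) (sym : 𝒳 ≃ Fin D.q) (l n L : ℕ) :
    CompressionScheme 𝒳 n L where
  enc x m := codeImage (l + 3) l D.β (n / D.b + 1) (D.blockRank (symbols sym x)) m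
  dec c j := sym.symm ⟨D.foundSymbol l (bits c) 0 j, Nat.mod_lt _ (q_pos_of_nonempty sym)⟩

/-- The scheme for short sequences: nothing is stored. -/
noncomputable def trivialScheme (D : Coder) (sym : 𝒳 ≃ Fin D.q) (n L : ℕ) :
    CompressionScheme 𝒳 n L where
  enc _ _ := false
  dec _ _ := sym.symm ⟨0, q_pos_of_nonempty sym⟩

theorem holds_enc (x : Fin n → 𝒳) :
    D.Holds n L l (symbols sym x) (bits ((D.blockScheme sym l n L).enc x)) :=
  fun m hm => by rw [bits, dif_pos hm]; rfl

theorem decodes_iff (x : Fin n → 𝒳) : (D.blockScheme sym l n L).Decodes x ↔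
    ∀ j < n, D.foundSymbol l (bits ((D.blockScheme sym l n L).enc x)) 0 j = symbols sym x j := by
  rw [CompressionScheme.Decodes, funext_iff]
  constructor
  · intro h j hj
    rw [symbols_of_lt sym x hj, ← h ⟨j, hj⟩]
    simp [blockScheme]
  · intro h j
    have := h j j.2
    rw [symbols_of_lt sym x j.2] at this
    simp [blockScheme] at this ⊢
    rw [Equiv.symm_apply_eq]
    exact Fin.ext this

/-- A sequence is decoded correctly if its queue does not outgrow the codeword. -/
theorem decodes_of_pos_le (h : Room D W n L l S) (hD : D.Numbering) {x : Fin n → 𝒳}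
    (hG : D.pos l (symbols sym x) (n / D.b + 1) ≤ n / (D.b - 1)) :
    (D.blockScheme sym l n L).Decodes x :=
  (decodes_iff x).2 fun _ hj =>
    foundSymbol_eq h hD (symbols_lt sym (q_pos_of_nonempty sym) x) (holds_enc x) hG hj

theorem foundSymbol_of_decodes (h : Room D W n L l S) {x : Fin n → 𝒳}
    (hx : (D.blockScheme sym l n L).Decodes x) {k j : ℕ} (hj : j < n) (hk : k ≤ j / D.b) :
    D.foundSymbol l (bits ((D.blockScheme sym l n L).enc x)) k j = symbols sym x j := by
  rw [foundSymbol_congr h (holds_enc x) hk hj, (decodes_iff x).1 hx j hj]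

end Scheme

/-- Number of consecutive blocks up to block `k` that find the queue busy. -/
def busyRun (D : Coder) (l : ℕ) (d : ℕ → ℕ) (k : ℕ) : ℕ :=
  scanLen (fun j => decide (j < D.pos l d j)) k

theorem scanLen_eq_busyRun (h : Room D W n L l S) {d : ℕ → ℕ} {c : ℕ → Bool}
    (hc : D.Holds n L l d c) {k : ℕ} (hk : k < n / D.b + 1) :
    scanLen (busy (l + 3) c) k = D.busyRun l d k :=
  scanLen_congr fun j hj => busy_eq h hc (by omega)

/-- Runs `P` unless the blocklength is less than `n₀`. -/
def guarded (n₀ : ℕ) (P : Prog) : Prog :=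
  .ite (.bin .lt (.reg 0) (.lit n₀)) (.instr (.assign 3 (.reg 3))) P

/-- The four programs. The decoder decodes the fragment that is the whole sequence; the encoder
updates the whole sequence, starting from the empty codeword, which is the codeword of the zero
sequence. -/
def algorithms (D : Coder) (n₀ κ : ℕ) : Algorithms where
  κ := κ
  encoder := guarded n₀ (.instr (.assign 3 (.reg 0)) ;; D.localUpdater)
  decoder := guarded n₀ (.instr (.assign 3 (.reg 0)) ;; D.localDecoder)
  localDecoder := guarded n₀ D.localDecoder
  localUpdater := guarded n₀ D.localUpdater

theorem wp_guarded_of_le {P : Prog} {σ : Machine} {Q : Machine → Prop} (hr : σ.reg 0 = n)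
    (hn : n₀ ≤ n) (hw : n₀ < W) (h : WP W P Q { σ with time := σ.time + 4 }) :
    WP W (guarded n₀ P) Q σ := by
  refine .ite (fun hc => absurd ?_ hc) fun _ => h
  simp [Expr.eval_lt, Expr.eval_reg, Expr.eval_lit, hr, Nat.mod_eq_of_lt hw, not_lt.2 hn]

theorem wp_guarded_of_lt {P : Prog} {σ : Machine} {Q : Machine → Prop} (hr : σ.reg 0 = n)
    (hn : n < n₀) (hw : n₀ < W)
    (h : ∀ τ, τ.code = σ.code → τ.out = σ.out → τ.reads = σ.reads → τ.writes = σ.writes →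
      τ.time = σ.time + 6 → Q τ) :
    WP W (guarded n₀ P) Q σ := by
  have hn0 : 1 < W := by omega
  refine .ite (fun _ => .instr (h _ rfl rfl rfl rfl ?_)) fun hc => absurd hc ?_
  · simp [Instr.run, Machine.test, Expr.cost_bin, Expr.cost_reg, Expr.cost_lit]
  · simp [Expr.eval_lt, Expr.eval_reg, Expr.eval_lit, hr, Nat.mod_eq_of_lt hw, hn,
      Nat.mod_eq_of_lt hn0]

theorem sum_le_mul {m : ℕ} {f : ℕ → ℕ} {K : ℕ} (h : ∀ j, f j ≤ K) :
    ∑ j ∈ Finset.range m, f j ≤ m * K := by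
  simpa using Finset.sum_le_card_nsmul (Finset.range m) f K fun j _ => h j

section Runs

variable {σ : Machine} {d : ℕ → ℕ}

/-- Number of blocks that meet the fragment of length `s` at position `i`. -/
def blocks (D : Coder) (i s : ℕ) : ℕ := (i + s - 1) / D.b + 1 - i / D.b

theorem wp_decode (h : Room D W n L l S) (hi : i + s ≤ n) (hs : 1 ≤ s)
    (h0 : σ.reg 0 = n) (h1 : σ.reg 1 = L) (h2 : σ.reg 2 = i) (h3 : σ.reg 3 = s) :
    WP W D.localDecoder (fun τ => τ.code = σ.code ∧
      (∀ x < s, τ.out x = D.foundSymbol l σ.code (i / D.b) (i + x)) ∧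
      τ.reads ≤ σ.reads + 1 + 2 * scanLen (busy (l + 3) σ.code) (i / D.b) +
        D.blocks i s * (1 + l + D.β) ∧
      D.blocks i s ≤ τ.time ∧
      τ.time ≤ σ.time + D.decodeTime *
        (scanLen (busy (l + 3) σ.code) (i / D.b) + D.blocks i s + 1)) σ := by
  refine wp_localDecoder h hi hs h0 h1 h2 h3 fun τ m hm hcode hout hr hmt ht => ?_
  obtain rfl : m = D.blocks i s := by rw [blocks]; omega
  refine ⟨hcode, hout, hr.le.trans ?_, hmt, ht⟩
  refine Nat.add_le_add_left (sum_le_mul fun j => ?_) _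
  have := Nat.mul_le_mul_left D.β (flag_le (l + 3) σ.code (i / D.b + j))
  omega

theorem wp_update (h : Room D W n L l S) (hD : D.Numbering) (hi : i + s ≤ n)
    (hs : 1 ≤ s) (hinp : ∀ x, σ.inp x < D.q)
    (h0 : σ.reg 0 = n) (h1 : σ.reg 1 = L) (h2 : σ.reg 2 = i) (h3 : σ.reg 3 = s)
    (hd0 : ∀ u, n ≤ u → d u = 0) (hc : D.Holds n L l d σ.code) :
    WP W D.localUpdater (fun τ => ∃ m,
      ((∀ x < n, (x < i ∨ i + s ≤ x) → i / D.b ≤ x / D.b →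
          D.foundSymbol l σ.code (i / D.b) x = d x) →
        D.Holds n L l (replaced d σ.inp i s) τ.code ∧
        ∀ j, D.blocks i s ≤ j → j < m →
          i / D.b + j < D.pos l d (i / D.b + j) ∨
          i / D.b + j < D.pos l (replaced d σ.inp i s) (i / D.b + j)) ∧
      τ.reads + τ.writes ≤ σ.reads + σ.writes + 1 + 3 * D.busyRun l d (i / D.b) +
        m * (2 * l + 3 * D.β + 4) ∧
      D.blocks i s ≤ m ∧ i / D.b + m ≤ n / D.b + 1 ∧ m ≤ τ.time ∧
      τ.time ≤ σ.time + D.updateTime * (D.busyRun l d (i / D.b) + m + 1)) σ := by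
  have hb := h.b_pos
  have hk : i / D.b < n / D.b + 1 := Nat.lt_succ_of_le (Nat.div_le_div_right (by omega))
  refine wp_localUpdater h hi hs hinp h0 h1 h2 h3 ?_
  intro τ m hm hm' hcode hr hwr hmt ht
  have hN := unsettled_le hi hm
  have hJ := le_of_settled hi hm'
  have hlen := le_scanPos_add D.β (flag (l + 3) σ.code) (busy (l + 3) σ.code) (i / D.b)
  have hb1 : D.foundPos l σ.code (i / D.b) m ≤ _ :=
    queuePos_le_add (flag_le _ _) (i / D.b)
      (scanPos D.β (flag (l + 3) σ.code) (busy (l + 3) σ.code) (i / D.b)) m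
  have hb2 : D.newPos n i s l σ.inp σ.code (i / D.b) m ≤ _ :=
    queuePos_le_add (overflows_le_one _ _) (i / D.b)
      (scanPos D.β (flag (l + 3) σ.code) (busy (l + 3) σ.code) (i / D.b)) m
  rw [scanLen_eq_busyRun h hc hk] at hr ht hlen
  refine ⟨m, fun hdec => ⟨?_, fun j hj hjm => ?_⟩, ?_, by rw [blocks]; omega, hN, hmt, ht⟩
  · rw [hcode]
    exact holds_rewriteCode h hD hc hd0 hi hs hdec hm hm'
  · obtain ⟨h4, h5⟩ := hm j hjm
    rw [foundPos_eq h hc hk (by omega), newPos_eq h hc hd0 hi hdec] at h4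
    rw [blocks] at hj
    rcases h4 with h4 | h4
    · omega
    · have h6 : i / D.b + j ≤ D.pos l d (i / D.b + j) := by
        simpa [pos] using
          le_queuePos (β := D.β) (le_refl 0) (i / D.b + j)
      have h7 : i / D.b + j ≤ D.pos l (replaced d σ.inp i s) (i / D.b + j) := by
        simpa [pos] using
          le_queuePos (β := D.β) (le_refl 0) (i / D.b + j)
      omega
  · have s1 : ∑ j ∈ Finset.range m, (1 + l + D.β * flag (l + 3) σ.code (i / D.b + j)) ≤
        m * (1 + l + D.β) := sum_le_mul fun j => by
      have := Nat.mul_le_mul_left D.β (flag_le (l + 3) σ.code (i / D.b + j))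
      omega
    have s2 : ∑ j ∈ Finset.range m, (2 + l + D.β *
        overflows l (D.newRank n i s l σ.inp σ.code (i / D.b)) (i / D.b + j)) ≤
        m * (2 + l + D.β) := sum_le_mul fun j => by
      have := Nat.mul_le_mul_left D.β
        (overflows_le_one l (D.newRank n i s l σ.inp σ.code (i / D.b)) (i / D.b + j))
      omega
    have e : m * (2 * l + 3 * D.β + 4) =
      m * (1 + l + D.β) + m * (2 + l + D.β) + (D.β + 1) * m := by ring
    omega

end Runs

section Programs

variable [Nonempty 𝒳] {A : Algorithms}

theorem init_reg {args : List ℕ} {inp : ℕ → ℕ} {c : ℕ → Bool} {r x : ℕ}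
    (h : args.getD r 0 = x) (hx : x < W) : (Machine.init W args inp c).reg r = x := by
  rw [Machine.init]
  simp only [h]
  exact Nat.mod_eq_of_lt hx

theorem localDecoder_run (h : Room D ((D.algorithms n₀ κ).words n) n L l S) (hn : n₀ ≤ n)
    (hw : n₀ < (D.algorithms n₀ κ).words n) (hi : i + s ≤ n) (hs : 1 ≤ s) (x : Fin n → 𝒳) :
    ∃ τ, Exec ((D.algorithms n₀ κ).words n) (D.algorithms n₀ κ).localDecoder
        (locStart (D.algorithms n₀ κ) n ((D.blockScheme sym l n L).enc x) i s) τ ∧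
      ((D.blockScheme sym l n L).Decodes x → ∀ j < s, τ.out j = symbols sym x (i + j)) ∧
      τ.code = bits ((D.blockScheme sym l n L).enc x) ∧
      τ.reads ≤ 1 + 2 * D.busyRun l (symbols sym x) (i / D.b) + D.blocks i s * (1 + l + D.β) ∧
      D.blocks i s ≤ τ.time ∧
      τ.time ≤ 4 + D.decodeTime *
        (D.busyRun l (symbols sym x) (i / D.b) + D.blocks i s + 1) := by
  have hS := h.n_le
  have hL := h.L_le
  set σ := locStart (D.algorithms n₀ κ) n ((D.blockScheme sym l n L).enc x) i s with hσ
  have h0 : σ.reg 0 = n := init_reg rfl (h.le_word (by omega))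
  have hL0 : σ.reg 1 = L := init_reg rfl (h.le_word (by omega))
  have hi0 : σ.reg 2 = i := init_reg rfl (h.le_word (by omega))
  have hs0 : σ.reg 3 = s := init_reg rfl (h.le_word (by omega))
  obtain ⟨τ, h1, h2, h3, h4, h5, h6⟩ := wp_guarded_of_le h0 hn hw
    (wp_decode (σ := { σ with time := σ.time + 4 }) h hi hs h0
      hL0 hi0 hs0)
  have hk : i / D.b < n / D.b + 1 := Nat.lt_succ_of_le (Nat.div_le_div_right (by omega))
  change τ.code = bits ((D.blockScheme sym l n L).enc x) at h2
  change ∀ y < s, τ.out y = D.foundSymbol l (bits ((D.blockScheme sym l n L).enc x)) _ _ at h3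
  change τ.reads ≤ 0 + 1 + 2 * scanLen (busy (l + 3)
    (bits ((D.blockScheme sym l n L).enc x))) (i / D.b) + _ at h4
  change τ.time ≤ 0 + 4 + D.decodeTime * (scanLen (busy (l + 3)
    (bits ((D.blockScheme sym l n L).enc x))) (i / D.b) + _ + 1) at h6
  rw [scanLen_eq_busyRun h (holds_enc x) hk, Nat.zero_add] at h4 h6
  refine ⟨τ, h1, fun hx j hj => ?_, h2, h4, h5, h6⟩
  rw [h3 j hj]
  exact foundSymbol_of_decodes h hx (by omega) (Nat.div_le_div_right (by omega))

theorem decoder_run (h : Room D ((D.algorithms n₀ κ).words n) n L l S) (hn : n₀ ≤ n)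
    (hw : n₀ < (D.algorithms n₀ κ).words n) (hn1 : 1 ≤ n) (c : Fin L → Bool) :
    ∃ τ, Exec ((D.algorithms n₀ κ).words n) (D.algorithms n₀ κ).decoder
        (decStart (D.algorithms n₀ κ) n c) τ ∧
      (∀ k : Fin n, τ.out k = sym ((D.blockScheme sym l n L).dec c k)) ∧
      τ.time ≤ 6 + D.decodeTime * (n / D.b + 2) := by
  have hS := h.n_le
  have hL := h.L_le
  have hmod : n % (D.algorithms n₀ κ).words n = n := Nat.mod_eq_of_lt (h.le_word (by omega))
  set σ := decStart (D.algorithms n₀ κ) n c with hσ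
  have h0 : σ.reg 0 = n := init_reg rfl (h.le_word (by omega))
  have hL0 : σ.reg 1 = L := init_reg rfl (h.le_word (by omega))
  have h20 : σ.reg 2 = 0 := init_reg rfl (h.le_word (by omega))
  set ρ := Instr.run ((D.algorithms n₀ κ).words n) { σ with time := σ.time + 4 }
    (.assign 3 (.reg 0)) with hρ
  have hreg : ∀ r ≠ 3, ρ.reg r = σ.reg r := fun r hr => by simp [hρ, Instr.run, hr]
  obtain ⟨τ, h1, h2, h3, h4, h5, h6⟩ := wp_guarded_of_le h0 hn hw (.seq (.instr
    (wp_decode (σ := ρ) (i := 0) (s := n) h (by omega) hn1 (by rw [hreg 0 (by decide), h0])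
      (by rw [hreg 1 (by decide), hL0]) (by rw [hreg 2 (by decide), h20])
      (by simp [hρ, Instr.run, Expr.eval_reg, h0, hmod]))))
  refine ⟨τ, h1, fun k => ?_, ?_⟩
  · rw [h3 k k.2, Nat.zero_div, Nat.zero_add, show ρ.code = bits c from rfl]
    simp [blockScheme]
  · have hb : D.blocks 0 n ≤ n / D.b + 1 := by
      rw [blocks, Nat.zero_add, Nat.zero_div, Nat.sub_zero]
      exact Nat.succ_le_succ (Nat.div_le_div_right (by omega))
    refine h6.trans ?_
    rw [show ρ.time = 6 from rfl, Nat.zero_div, scanLen]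
    exact Nat.add_le_add_left (Nat.mul_le_mul_left _ (by omega)) _

theorem localUpdater_run (h : Room D ((D.algorithms n₀ κ).words n) n L l S) (hD : D.Numbering)
    (hn : n₀ ≤ n) (hw : n₀ < (D.algorithms n₀ κ).words n) (hi : i + s ≤ n) (hs : 1 ≤ s)
    (x : Fin n → 𝒳) (v : Fin s → 𝒳) :
    ∃ τ m, Exec ((D.algorithms n₀ κ).words n) (D.algorithms n₀ κ).localUpdater
        (updStart sym (D.algorithms n₀ κ) n ((D.blockScheme sym l n L).enc x) i v) τ ∧
      ((D.blockScheme sym l n L).Decodes x →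
        (∀ k : Fin L, τ.code k = (D.blockScheme sym l n L).enc (splice x i v) k) ∧
        ∀ j, D.blocks i s ≤ j → j < m →
          i / D.b + j < D.pos l (symbols sym x) (i / D.b + j) ∨
          i / D.b + j < D.pos l (symbols sym (splice x i v)) (i / D.b + j)) ∧
      τ.reads + τ.writes ≤ 1 + 3 * D.busyRun l (symbols sym x) (i / D.b) +
        m * (2 * l + 3 * D.β + 4) ∧
      D.blocks i s ≤ m ∧ i / D.b + m ≤ n / D.b + 1 ∧ m ≤ τ.time ∧
      τ.time ≤ 4 + D.updateTime * (D.busyRun l (symbols sym x) (i / D.b) + m + 1) := by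
  have hS := h.n_le
  have hL := h.L_le
  set σ := updStart sym (D.algorithms n₀ κ) n ((D.blockScheme sym l n L).enc x) i v with hσ
  have h0 : σ.reg 0 = n := init_reg rfl (h.le_word (by omega))
  have hL0 : σ.reg 1 = L := init_reg rfl (h.le_word (by omega))
  have hi0 : σ.reg 2 = i := init_reg rfl (h.le_word (by omega))
  have hs0 : σ.reg 3 = s := init_reg rfl (h.le_word (by omega))
  obtain ⟨τ, h1, m, h2, h3, h4, h5, h6, h7⟩ := wp_guarded_of_le h0 hn hw
    (wp_update (d := symbols sym x) (σ := { σ with time := σ.time + 4 }) h hD hi hs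
      (symbols_lt sym (q_pos_of_nonempty sym) v) h0 hL0 hi0 hs0
      (fun u hu => symbols_eq_zero sym x hu) (holds_enc x))
  refine ⟨τ, m, h1, fun hx => ?_, ?_, h4, h5, h6, ?_⟩
  · obtain ⟨h8, h9⟩ := h2 fun j hj _ hj' => foundSymbol_of_decodes h hx hj hj'
    change D.Holds n L l (replaced (symbols sym x) (symbols sym v) i s) τ.code at h8
    rw [← symbols_splice sym x v hi] at h8
    refine ⟨fun k => h8 k k.2, fun j hj hj' => ?_⟩
    rw [symbols_splice sym x v hi]
    exact h9 j hj hj'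
  · change _ ≤ 0 + 0 + 1 + _ + _ at h3
    omega
  · change _ ≤ 0 + 4 + _ at h7
    omega

theorem encoder_run (h : Room D ((D.algorithms n₀ κ).words n) n L l S) (hD : D.Numbering)
    (hn : n₀ ≤ n) (hw : n₀ < (D.algorithms n₀ κ).words n) (hn1 : 1 ≤ n) (x : Fin n → 𝒳) :
    ∃ τ, Exec ((D.algorithms n₀ κ).words n) (D.algorithms n₀ κ).encoder
        (encStart sym (D.algorithms n₀ κ) L x) τ ∧
      (∀ k : Fin L, τ.code k = (D.blockScheme sym l n L).enc x k) ∧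
      τ.time ≤ 6 + D.updateTime * (n / D.b + 2) := by
  have hS := h.n_le
  have hL := h.L_le
  have hmod : n % (D.algorithms n₀ κ).words n = n := Nat.mod_eq_of_lt (h.le_word (by omega))
  set σ := encStart sym (D.algorithms n₀ κ) L x with hσ
  have h0 : σ.reg 0 = n := init_reg rfl (h.le_word (by omega))
  have hL0 : σ.reg 1 = L := init_reg rfl (h.le_word (by omega))
  have h20 : σ.reg 2 = 0 := init_reg rfl (h.le_word (by omega))
  set ρ := Instr.run ((D.algorithms n₀ κ).words n) { σ with time := σ.time + 4 }
    (.assign 3 (.reg 0)) with hρ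
  have hreg : ∀ r ≠ 3, ρ.reg r = σ.reg r := fun r hr => by simp [hρ, Instr.run, hr]
  obtain ⟨τ, h1, m, h2, h3, h4, h5, h6, h7⟩ := wp_guarded_of_le h0 hn hw (.seq (.instr
    (wp_update (σ := ρ) (i := 0) (s := n) (d := fun _ => 0) h hD (by omega) hn1
      (symbols_lt sym (q_pos_of_nonempty sym) x) (by rw [hreg 0 (by decide), h0])
      (by rw [hreg 1 (by decide), hL0]) (by rw [hreg 2 (by decide), h20])
      (by simp [hρ, Instr.run, Expr.eval_reg, h0, hmod]) (fun _ _ => rfl) (holds_zero hD))))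
  refine ⟨τ, h1, fun k => ?_, ?_⟩
  · have h8 := (h2 fun j hj hj' => by omega).1
    have hx : replaced (fun _ => 0) ρ.inp 0 n = symbols sym x := by
      funext j
      rw [replaced]
      split
      · rfl
      · exact (symbols_eq_zero sym x (by omega)).symm
    rw [hx] at h8
    exact h8 k k.2
  · refine h7.trans ?_
    rw [Nat.zero_div, Nat.zero_add] at h5
    rw [show ρ.time = 6 from rfl, Nat.zero_div, busyRun, scanLen]
    exact Nat.add_le_add_left (Nat.mul_le_mul_left _ (by omega)) _

end Programs

end Coder

namespace Coder

variable {𝒳 : Type*} {D : Coder} {W n L i s l S n₀ κ : ℕ} {sym : 𝒳 ≃ Fin D.q}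

/-! ### The programs realize the schemes -/

/-- The initial configuration of any program on a short sequence. -/
theorem exec_guarded_of_lt {P : Prog} {args : List ℕ} {inp : ℕ → ℕ} {c : ℕ → Bool}
    (hn : n < n₀) (hw : n₀ < W) (h0 : args.getD 0 0 = n) :
    ∃ τ, Exec W (guarded n₀ P) (Machine.init W args inp c) τ ∧ τ.code = c ∧
      (∀ k, τ.out k = 0) ∧ τ.reads = 0 ∧ τ.writes = 0 ∧ τ.time = 6 :=
  wp_guarded_of_lt (init_reg h0 (hn.trans hw)) hn hw fun τ h1 h2 h3 h4 h5 =>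
    ⟨h1, fun k => by rw [h2]; rfl, h3, h4, h5⟩

theorem locRun_of_lt (hn : n < n₀) (hw : n₀ < (D.algorithms n₀ κ).words n)
    (C : CompressionScheme 𝒳 n L) (x : Fin n → 𝒳) (i s : ℕ) :
    (locRun (D.algorithms n₀ κ) C x i s).reads = 0 ∧
      (locRun (D.algorithms n₀ κ) C x i s).time = 6 := by
  obtain ⟨τ, h1, -, -, h2, -, h3⟩ := exec_guarded_of_lt (P := D.localDecoder)
    (args := [n, L, i, s]) (inp := fun _ => 0) (c := bits (C.enc x)) hn hw rfl
  rw [locRun, show Prog.result _ (D.algorithms n₀ κ).localDecoder (locStart _ n _ i s) = τ from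
    Exec.result_eq h1]
  exact ⟨h2, h3⟩

theorem updRun_of_lt (hn : n < n₀) (hw : n₀ < (D.algorithms n₀ κ).words n)
    (C : CompressionScheme 𝒳 n L) (x : Fin n → 𝒳) (i : ℕ) (v : Fin s → 𝒳) :
    (updRun sym (D.algorithms n₀ κ) C x i v).reads = 0 ∧
      (updRun sym (D.algorithms n₀ κ) C x i v).writes = 0 ∧
      (updRun sym (D.algorithms n₀ κ) C x i v).time = 6 := by
  obtain ⟨τ, h1, -, -, h2, h3, h4⟩ := exec_guarded_of_lt (P := D.localUpdater)
    (args := [n, L, i, s]) (inp := symbols sym v) (c := bits (C.enc x)) hn hw rfl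
  rw [updRun, show Prog.result _ (D.algorithms n₀ κ).localUpdater (updStart sym _ n _ i v) = τ from
    Exec.result_eq h1]
  exact ⟨h2, h3, h4⟩

theorem codingTime_of_lt (hn : n < n₀) (hw : n₀ < (D.algorithms n₀ κ).words n)
    (C : CompressionScheme 𝒳 n L) (x : Fin n → 𝒳) :
    codingTime sym (D.algorithms n₀ κ) C x = 12 := by
  obtain ⟨τ, h1, -, -, -, -, h3⟩ := exec_guarded_of_lt
    (P := .instr (.assign 3 (.reg 0)) ;; D.localUpdater) (args := [n, L]) (inp := symbols sym x)
    (c := fun _ => false) hn hw rfl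
  obtain ⟨ρ, g1, -, -, -, -, g3⟩ := exec_guarded_of_lt
    (P := .instr (.assign 3 (.reg 0)) ;; D.localDecoder) (args := [n, L]) (inp := fun _ => 0)
    (c := bits (C.enc x)) hn hw rfl
  rw [codingTime, show Prog.result _ (D.algorithms n₀ κ).encoder (encStart sym _ L x) = τ from
    Exec.result_eq h1, show Prog.result _ (D.algorithms n₀ κ).decoder (decStart _ n _) = ρ from
    Exec.result_eq g1, h3, g3]

variable [Nonempty 𝒳]

theorem implements_blockScheme (h : Room D ((D.algorithms n₀ κ).words n) n L l S)
    (hD : D.Numbering) (hn : n₀ ≤ n) (hw : n₀ < (D.algorithms n₀ κ).words n) (hn1 : 1 ≤ n) :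
    Implements sym (D.algorithms n₀ κ) (D.blockScheme sym l n L) where
  encoder x := by
    obtain ⟨τ, h1, h2, -⟩ := encoder_run h hD hn hw hn1 x
    exact ⟨τ, h1, h2⟩
  decoder c := by
    obtain ⟨τ, h1, h2, -⟩ := decoder_run (sym := sym) h hn hw hn1 c
    exact ⟨τ, h1, h2⟩
  localDecoder x i s hs hi := by
    obtain ⟨τ, h1, h2, h3, -⟩ := localDecoder_run h hn hw hi hs x
    refine ⟨τ, h1, fun hx => ⟨fun j => ?_, fun k => ?_⟩⟩
    · rw [h2 hx j j.2, symbols_of_lt sym x (by omega)]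
    · rw [h3, bits, dif_pos k.2]
  localUpdater x i s v hs hi := by
    obtain ⟨τ, m, h1, h2, -⟩ := localUpdater_run h hD hn hw hi hs x v
    exact ⟨τ, h1, fun hx => (h2 hx).1⟩

theorem implements_trivialScheme (hn : n < n₀) (hw : n₀ < (D.algorithms n₀ κ).words n) :
    Implements sym (D.algorithms n₀ κ) (D.trivialScheme sym n L) where
  encoder x := by
    obtain ⟨τ, h1, h2, -⟩ := exec_guarded_of_lt (args := [n, L]) hn hw rfl
    exact ⟨τ, h1, fun k => by rw [h2]; rfl⟩
  decoder c := by
    obtain ⟨τ, h1, -, h2, -⟩ := exec_guarded_of_lt (args := [n, L]) hn hw rfl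
    exact ⟨τ, h1, fun k => by rw [h2]; simp [trivialScheme]⟩
  localDecoder x i s hs hi := by
    obtain ⟨τ, h1, h3, h2, -⟩ := exec_guarded_of_lt (args := [n, L, i, s]) hn hw rfl
    refine ⟨τ, h1, fun hx => ⟨fun j => ?_, fun k => ?_⟩⟩
    · rw [h2, ← hx]; simp [trivialScheme]
    · rw [h3, bits, dif_pos k.2]
  localUpdater x i s v hs hi := by
    obtain ⟨τ, h1, h3, -⟩ := exec_guarded_of_lt (args := [n, L, i, s]) hn hw rfl
    refine ⟨τ, h1, fun _ k => ?_⟩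
    rw [h3, bits, dif_pos k.2]
    rfl

/-! ### The cost of the programs on a given sequence -/

theorem locRun_cost (h : Room D ((D.algorithms n₀ κ).words n) n L l S) (hn : n₀ ≤ n)
    (hw : n₀ < (D.algorithms n₀ κ).words n) (hi : i + s ≤ n) (hs : 1 ≤ s) (x : Fin n → 𝒳) :
    (locRun (D.algorithms n₀ κ) (D.blockScheme sym l n L) x i s).reads ≤
        1 + 2 * D.busyRun l (symbols sym x) (i / D.b) + D.blocks i s * (1 + l + D.β) ∧
      D.blocks i s ≤ (locRun (D.algorithms n₀ κ) (D.blockScheme sym l n L) x i s).time ∧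
      (locRun (D.algorithms n₀ κ) (D.blockScheme sym l n L) x i s).time ≤ 4 + D.decodeTime *
        (D.busyRun l (symbols sym x) (i / D.b) + D.blocks i s + 1) := by
  obtain ⟨τ, h1, -, -, h2⟩ := localDecoder_run h hn hw hi hs x
  rw [locRun, Exec.result_eq h1]
  exact h2

theorem updRun_cost (h : Room D ((D.algorithms n₀ κ).words n) n L l S) (hD : D.Numbering)
    (hn : n₀ ≤ n) (hw : n₀ < (D.algorithms n₀ κ).words n) (hi : i + s ≤ n) (hs : 1 ≤ s)
    (x : Fin n → 𝒳) (v : Fin s → 𝒳) :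
    ∃ m, ((D.blockScheme sym l n L).Decodes x →
        ∀ j, D.blocks i s ≤ j → j < m →
          i / D.b + j < D.pos l (symbols sym x) (i / D.b + j) ∨
          i / D.b + j < D.pos l (symbols sym (splice x i v)) (i / D.b + j)) ∧
      (updRun sym (D.algorithms n₀ κ) (D.blockScheme sym l n L) x i v).reads +
          (updRun sym (D.algorithms n₀ κ) (D.blockScheme sym l n L) x i v).writes ≤
        1 + 3 * D.busyRun l (symbols sym x) (i / D.b) + m * (2 * l + 3 * D.β + 4) ∧
      D.blocks i s ≤ m ∧ i / D.b + m ≤ n / D.b + 1 ∧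
      m ≤ (updRun sym (D.algorithms n₀ κ) (D.blockScheme sym l n L) x i v).time ∧
      (updRun sym (D.algorithms n₀ κ) (D.blockScheme sym l n L) x i v).time ≤ 4 + D.updateTime *
        (D.busyRun l (symbols sym x) (i / D.b) + m + 1) := by
  obtain ⟨τ, m, h1, h2, h3⟩ := localUpdater_run h hD hn hw hi hs x v
  rw [updRun, Exec.result_eq h1]
  exact ⟨m, fun hx => (h2 hx).2, h3⟩

theorem codingTime_le (h : Room D ((D.algorithms n₀ κ).words n) n L l S) (hD : D.Numbering)
    (hn : n₀ ≤ n) (hw : n₀ < (D.algorithms n₀ κ).words n) (hn1 : 1 ≤ n) (x : Fin n → 𝒳) :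
    codingTime sym (D.algorithms n₀ κ) (D.blockScheme sym l n L) x ≤
      12 + (D.updateTime + D.decodeTime) * (n / D.b + 2) := by
  obtain ⟨τ, h1, -, h2⟩ := encoder_run h hD hn hw hn1 x
  obtain ⟨ρ, g1, -, g2⟩ := decoder_run (sym := sym) h hn hw hn1 ((D.blockScheme sym l n L).enc x)
  rw [codingTime, Exec.result_eq h1, Exec.result_eq g1, Nat.add_mul]
  omega

end Coder

namespace Coder

variable {D : Coder} {l : ℕ} {d : ℕ → ℕ}

/-! ### The potential of the queue -/

/-- `0` if the queue is idle before block `k`; otherwise it grows exponentially with the backlog and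
with the time for which the queue has been busy. -/
noncomputable def potential (D : Coder) (l : ℕ) (d : ℕ → ℕ) (k : ℕ) : ℝ :=
  if k < D.pos l d k then
    (1 + 1 / (D.β : ℝ)) ^ (D.pos l d k - k) * (1 + 1 / (4 * D.β : ℝ)) ^ D.busyRun l d k
  else 0

theorem potential_nonneg (l : ℕ) (d : ℕ → ℕ) (k : ℕ) : 0 ≤ D.potential l d k := by
  rw [potential]
  split
  · positivity
  · exact le_rfl

theorem le_pos (l : ℕ) (d : ℕ → ℕ) (k : ℕ) : k ≤ D.pos l d k := by
  simpa [pos] using le_queuePos (β := D.β) (a := overflows l (D.blockRank d)) (le_refl 0) k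

theorem pos_succ (l : ℕ) (d : ℕ → ℕ) (k : ℕ) : D.pos l d (k + 1) =
    max (D.pos l d k + D.β * overflows l (D.blockRank d) k) (k + 1) := by
  rw [pos, queuePos, ← pos, Nat.zero_add]

theorem busyRun_succ (l : ℕ) (d : ℕ → ℕ) (k : ℕ) : D.busyRun l d (k + 1) =
    if k + 1 < D.pos l d (k + 1) then D.busyRun l d k + 1 else 0 := by
  rw [busyRun, scanLen]
  simp only [decide_eq_true_eq]
  rfl

theorem busyRun_of_idle {k : ℕ} (h : ¬ k < D.pos l d k) : D.busyRun l d k = 0 := by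
  cases k with
  | zero => rfl
  | succ k => rw [busyRun_succ, if_neg h]

theorem pos_zero (l : ℕ) (d : ℕ → ℕ) : D.pos l d 0 = 0 := rfl

theorem one_add_inv_pow_le (β : ℕ) : (1 + 1 / (β : ℝ)) ^ β ≤ 3 := by
  have h1 : (1 + 1 / (β : ℝ)) ^ β ≤ Real.exp (1 / β) ^ β := by
    refine pow_le_pow_left₀ (by positivity) ?_ _
    rw [add_comm]
    exact Real.add_one_le_exp _
  rw [← Real.exp_nat_mul] at h1
  refine h1.trans ?_
  rcases Nat.eq_zero_or_pos β with rfl | hβ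
  · simp
  · rw [mul_one_div_cancel (by positivity)]
    exact Real.exp_one_lt_three.le

/-- One step of the queue: without an overflow the potential shrinks by a factor, with an overflow
it grows by a bounded factor. -/
theorem potential_succ_le (hβ : 1 ≤ D.β) (l : ℕ) (d : ℕ → ℕ) (k : ℕ) :
    D.potential l d (k + 1) ≤ (1 - 3 / (4 * ((D.β : ℝ) + 1))) * D.potential l d k +
      overflows l (D.blockRank d) k * (4 * (D.potential l d k + 1)) := by
  have hβ' : (1 : ℝ) ≤ D.β := by exact_mod_cast hβ
  set θ : ℝ := 1 + 1 / (D.β : ℝ) with hθ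
  set γ : ℝ := 1 + 1 / (4 * D.β : ℝ) with hγ
  have hθ1 : 1 ≤ θ := by rw [hθ]; simp
  have hγ1 : 1 ≤ γ := by
    have : 0 ≤ 1 / (4 * D.β : ℝ) := by positivity
    rw [hγ]; linarith
  have hγ2 : γ ≤ 4 / 3 := by
    have : 1 / (4 * D.β : ℝ) ≤ 1 / 4 := by
      apply one_div_le_one_div_of_le <;> linarith
    rw [hγ]; linarith
  have hθβ : θ ^ D.β ≤ 3 := one_add_inv_pow_le _
  have hratio : γ = θ * (1 - 3 / (4 * ((D.β : ℝ) + 1))) := by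
    rw [hγ, hθ]; field_simp; ring
  have hU0 := potential_nonneg (D := D) l d k
  have hc : 0 ≤ 1 - 3 / (4 * ((D.β : ℝ) + 1)) := by
    rw [sub_nonneg, div_le_one (by positivity)]; linarith
  have hc1 : 1 - 3 / (4 * ((D.β : ℝ) + 1)) ≤ 1 := by
    have : 0 ≤ 3 / (4 * ((D.β : ℝ) + 1)) := by positivity
    linarith
  have hps := pos_succ (D := D) l d k
  have hle := le_pos (D := D) l d k
  have ho := overflows_le_one l (D.blockRank d) k
  by_cases hb1 : k + 1 < D.pos l d (k + 1)
  swap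
  · rw [potential, if_neg hb1]
    positivity
  have hrun := busyRun_succ (D := D) l d k
  rw [if_pos hb1] at hrun
  rw [potential, if_pos hb1, hrun, ← hθ, ← hγ]
  by_cases hb : k < D.pos l d k
  · have hU : D.potential l d k = θ ^ (D.pos l d k - k) * γ ^ D.busyRun l d k := by
      rw [potential, if_pos hb]
    obtain ⟨a, ha⟩ := Nat.exists_eq_add_of_lt hb
    have hU' : D.potential l d k = θ * (θ ^ a * γ ^ D.busyRun l d k) := by
      rw [hU, show D.pos l d k - k = a + 1 by omega, pow_succ]; ring
    rcases Nat.le_one_iff_eq_zero_or_eq_one.1 ho with h0 | h1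
    · rw [h0, show D.pos l d (k + 1) - (k + 1) = a by rw [hps, h0]; omega, pow_succ, hU', hratio]
      apply le_of_eq
      push_cast
      ring
    · rw [h1, show D.pos l d (k + 1) - (k + 1) = a + D.β by rw [hps, h1]; omega, pow_succ, pow_add]
      have hX : 0 ≤ θ ^ a * γ ^ D.busyRun l d k := by positivity
      have hXU : θ ^ a * γ ^ D.busyRun l d k ≤ D.potential l d k := by
        rw [hU']; exact le_mul_of_one_le_left hX hθ1
      calc θ ^ a * θ ^ D.β * (γ ^ D.busyRun l d k * γ)
          = θ ^ a * γ ^ D.busyRun l d k * (θ ^ D.β * γ) := by ring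
        _ ≤ D.potential l d k * (3 * (4 / 3)) := by gcongr
        _ ≤ _ := by
          push_cast
          nlinarith [mul_nonneg hc hU0]
  · have hidle : D.pos l d k = k := by omega
    have h1 : overflows l (D.blockRank d) k = 1 := by
      by_contra hne
      have h0 : overflows l (D.blockRank d) k = 0 := by omega
      rw [h0] at hps; omega
    rw [h1, busyRun_of_idle hb]
    have h2 : D.pos l d (k + 1) - (k + 1) ≤ D.β := by rw [hps, h1]; omega
    calc θ ^ (D.pos l d (k + 1) - (k + 1)) * γ ^ (0 + 1) ≤ 3 * (4 / 3) := by
          gcongr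
          · exact (pow_le_pow_right₀ hθ1 h2).trans hθβ
          · simpa using hγ2
      _ ≤ _ := by
        push_cast
        nlinarith [mul_nonneg hc hU0]

/-- The length of a busy period is bounded by the potential. -/
theorem busyRun_le_potential (hβ : 1 ≤ D.β) (l : ℕ) (d : ℕ → ℕ) (k : ℕ) :
    (D.busyRun l d k : ℝ) ≤ 4 * D.β * D.potential l d k := by
  have hβ' : (1 : ℝ) ≤ D.β := by exact_mod_cast hβ
  by_cases hb : k < D.pos l d k
  · rw [potential, if_pos hb]
    have h1 : (1 : ℝ) ≤ (1 + 1 / (D.β : ℝ)) ^ (D.pos l d k - k) := one_le_pow₀ (by simp)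
    have h2 := one_add_mul_le_pow (a := 1 / (4 * D.β : ℝ))
      (by have : 0 ≤ 1 / (4 * D.β : ℝ) := by positivity
          linarith) (D.busyRun l d k)
    have h3 : (D.busyRun l d k : ℝ) ≤ 4 * D.β * (1 + 1 / (4 * D.β : ℝ)) ^ D.busyRun l d k := by
      calc (D.busyRun l d k : ℝ) = 4 * D.β * (D.busyRun l d k * (1 / (4 * D.β : ℝ))) := by
            field_simp
        _ ≤ _ := by gcongr; linarith
    refine h3.trans ?_
    gcongr
    exact le_mul_of_one_le_left (by positivity) h1
  · rw [busyRun_of_idle hb]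
    have := potential_nonneg (D := D) l d k
    simp only [Nat.cast_zero]
    positivity

theorem lt_busyRun_of_busy {K e : ℕ} (h : ∀ j ≤ e, K + j < D.pos l d (K + j)) :
    e < D.busyRun l d (K + e) := by
  have hK : 0 < K := by
    by_contra h0
    obtain rfl : K = 0 := by omega
    simpa [pos_zero] using h 0 (Nat.zero_le _)
  obtain ⟨K, rfl⟩ := Nat.exists_eq_add_of_lt hK
  rw [Nat.zero_add] at h ⊢
  induction e with
  | zero =>
    have := h 0 le_rfl
    rw [Nat.add_zero] at this ⊢
    rw [busyRun_succ, if_pos this]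
    omega
  | succ e ih =>
    have h1 := ih fun j hj => h j (by omega)
    have h2 := h (e + 1) le_rfl
    rw [← Nat.add_assoc] at h2 ⊢
    rw [busyRun_succ, if_pos h2]
    omega

/-- If the queue has been busy since block `K`, then the potential at block `K + e` is large. -/
theorem one_le_potential_of_busy {K e : ℕ}
    (h : ∀ j ≤ e, K + j < D.pos l d (K + j)) :
    1 ≤ D.potential l d (K + e) * ((1 + 1 / (4 * D.β : ℝ))⁻¹) ^ (e + 1) := by
  have h1 := lt_busyRun_of_busy h
  have hγ : (1 : ℝ) ≤ 1 + 1 / (4 * D.β : ℝ) := by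
    have : 0 ≤ 1 / (4 * D.β : ℝ) := by positivity
    linarith
  rw [potential, if_pos (h e le_rfl), inv_pow, ← div_eq_mul_inv, le_div_iff₀ (by positivity),
    one_mul]
  calc (1 + 1 / (4 * D.β : ℝ)) ^ (e + 1) ≤ (1 + 1 / (4 * D.β : ℝ)) ^ D.busyRun l d (K + e) :=
        pow_le_pow_right₀ hγ h1
    _ ≤ _ := le_mul_of_one_le_left (by positivity) (one_le_pow₀ (by simp))

theorem geom_sum_le (hβ : 1 ≤ D.β) (m : ℕ) :
    ∑ e ∈ Finset.range m, ((1 + 1 / (4 * D.β : ℝ))⁻¹) ^ (e + 1) ≤ 4 * D.β := by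
  have hβ' : (1 : ℝ) ≤ D.β := by exact_mod_cast hβ
  set g : ℝ := (1 + 1 / (4 * D.β : ℝ))⁻¹ with hg
  have hg0 : 0 ≤ g := by positivity
  have hg1 : g * (4 * D.β + 1) = 4 * D.β := by rw [hg]; field_simp
  have key : ∀ m, ∑ e ∈ Finset.range m, g ^ (e + 1) = 4 * D.β * (1 - g ^ m) := by
    intro m
    induction m with
    | zero => simp
    | succ m ih =>
      rw [Finset.sum_range_succ, ih, pow_succ]
      linear_combination (g ^ m) * hg1
  rw [key]
  have : 0 ≤ g ^ m := by positivity
  nlinarith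

/-- A queue with the same overflows from block `K` on stays ahead if it is ahead at block `K`. -/
theorem pos_le_pos_of_le {d' : ℕ → ℕ} {K : ℕ}
    (h : ∀ k, K ≤ k → overflows l (D.blockRank d) k = overflows l (D.blockRank d') k)
    (hK : D.pos l d K ≤ D.pos l d' K) (j : ℕ) : D.pos l d (K + j) ≤ D.pos l d' (K + j) := by
  induction j with
  | zero => exact hK
  | succ j ih =>
    rw [← Nat.add_assoc, pos_succ, pos_succ, h _ (by omega)]
    omega

/-- The number of blocks for which one of two queues with the same overflows is busy is bounded by
the potentials. -/
theorem busy_count_le {d' : ℕ → ℕ} {K e : ℕ}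
    (h : ∀ k, K ≤ k → overflows l (D.blockRank d) k = overflows l (D.blockRank d') k)
    (hbusy : ∀ j < e, K + j < D.pos l d (K + j) ∨ K + j < D.pos l d' (K + j)) :
    (e : ℝ) ≤ ∑ j ∈ Finset.range e, (D.potential l d (K + j) + D.potential l d' (K + j)) *
      ((1 + 1 / (4 * D.β : ℝ))⁻¹) ^ (j + 1) := by
  have key : ∀ j < e, 1 ≤ (D.potential l d (K + j) + D.potential l d' (K + j)) *
      ((1 + 1 / (4 * D.β : ℝ))⁻¹) ^ (j + 1) := by
    intro j hj
    have hg : 0 ≤ ((1 + 1 / (4 * D.β : ℝ))⁻¹) ^ (j + 1) := by positivity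
    have h0 := mul_nonneg (potential_nonneg (D := D) l d (K + j)) hg
    have h0' := mul_nonneg (potential_nonneg (D := D) l d' (K + j)) hg
    rw [add_mul]
    rcases le_total (D.pos l d K) (D.pos l d' K) with hK | hK
    · have := one_le_potential_of_busy (D := D) (l := l) (d := d') (K := K) (e := j) fun u hu => by
        have := pos_le_pos_of_le h hK u
        have := hbusy u (by omega)
        omega
      linarith
    · have := one_le_potential_of_busy (D := D) (l := l) (d := d) (K := K) (e := j) fun u hu => by
        have := pos_le_pos_of_le (fun k hk => (h k hk).symm) hK u
        have := hbusy u (by omega)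
        omega
      linarith
  calc (e : ℝ) = ∑ j ∈ Finset.range e, (1 : ℝ) := by simp
    _ ≤ _ := Finset.sum_le_sum fun j hj => key j (Finset.mem_range.1 hj)

/-- If the queue outgrows `T`, then the potential before the last block is large. -/
theorem pow_le_potential {k T : ℕ} (hT : k + 1 + D.β ≤ T) (h : T < D.pos l d (k + 1)) :
    (1 + 1 / (D.β : ℝ)) ^ (T - k - D.β) ≤ D.potential l d k := by
  have h1 := pos_succ (D := D) l d k
  have h2 := Nat.mul_le_mul_left D.β (overflows_le_one l (D.blockRank d) k)
  have hγ : (1 : ℝ) ≤ 1 + 1 / (4 * D.β : ℝ) := by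
    have : 0 ≤ 1 / (4 * D.β : ℝ) := by positivity
    linarith
  rw [potential, if_pos (by omega)]
  calc (1 + 1 / (D.β : ℝ)) ^ (T - k - D.β) ≤ (1 + 1 / (D.β : ℝ)) ^ (D.pos l d k - k) :=
        pow_le_pow_right₀ (by simp) (by omega)
    _ ≤ _ := le_mul_of_one_le_right (by positivity) (one_le_pow₀ hγ)

end Coder

/-! ### Expectations of functions of independent symbols -/

section Splice

variable {𝒳 : Type*} {p : 𝒳 → ℝ} {n s : ℕ}

/-- The fragment of length `s` at position `i`. -/
def fragment {i : ℕ} (hi : i + s ≤ n) (x : Fin n → 𝒳) : Fin s → 𝒳 :=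
  fun j => x ⟨i + j, by omega⟩

theorem splice_splice {i : ℕ} (hi : i + s ≤ n) (x : Fin n → 𝒳) (v : Fin s → 𝒳) :
    splice (splice x i v) i (fragment hi x) = x := by
  funext k
  by_cases h : i ≤ k ∧ k < i + s
  · rw [splice, dif_pos h, fragment]
    congr 1
    exact Fin.ext (by simp; omega)
  · rw [splice, dif_neg h, splice, dif_neg h]

theorem fragment_splice {i : ℕ} (hi : i + s ≤ n) (x : Fin n → 𝒳) (v : Fin s → 𝒳) :
    fragment hi (splice x i v) = v := by
  funext j
  rw [fragment, splice, dif_pos (by simp)]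
  congr 1
  exact Fin.ext (by simp)

theorem prod_splice {i : ℕ} (hi : i + s ≤ n) (x : Fin n → 𝒳) (v : Fin s → 𝒳) :
    (∏ k, p (splice x i v k)) * ∏ j, p (fragment hi x j) = (∏ k, p (x k)) * ∏ j, p (v j) := by
  have key : ∀ y : Fin n → 𝒳, ∏ k, p (y k) =
      (∏ j, p (fragment hi y j)) *
        ∏ k ∈ Finset.univ.filter (fun k : Fin n => ¬ (i ≤ k ∧ k < i + s)), p (y k) := by
    intro y
    rw [← Finset.prod_filter_mul_prod_filter_not Finset.univ
      (fun k : Fin n => i ≤ (k : ℕ) ∧ (k : ℕ) < i + s)]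
    congr 1
    symm
    refine Finset.prod_bij (fun j _ => (⟨i + j, by omega⟩ : Fin n)) (fun j _ => by simp)
      (fun a _ b _ hab => Fin.ext (by simpa using hab)) (fun k hk => ?_) fun j _ => rfl
    have hk := (Finset.mem_filter.1 hk).2
    exact ⟨⟨k - i, by omega⟩, Finset.mem_univ _, Fin.ext (by simp; omega)⟩
  have hrest : ∏ k ∈ Finset.univ.filter (fun k : Fin n => ¬ (i ≤ k ∧ k < i + s)),
      p (splice x i v k) =
      ∏ k ∈ Finset.univ.filter (fun k : Fin n => ¬ (i ≤ k ∧ k < i + s)), p (x k) :=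
    Finset.prod_congr rfl fun k hk => by rw [splice, dif_neg (Finset.mem_filter.1 hk).2]
  rw [key (splice x i v), key x, fragment_splice, hrest]
  ring

end Splice

section Mean

variable {𝒳 : Type*} [Fintype 𝒳] {p : 𝒳 → ℝ} {n s : ℕ}

theorem weight_nonneg (hp : p ∈ stdSimplex ℝ 𝒳) (x : Fin n → 𝒳) : 0 ≤ ∏ k, p (x k) :=
  Finset.prod_nonneg fun _ _ => hp.1 _

theorem iidMean_mono (hp : p ∈ stdSimplex ℝ 𝒳) {f g : (Fin n → 𝒳) → ℝ} (h : ∀ x, f x ≤ g x) :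
    iidMean p n f ≤ iidMean p n g :=
  Finset.sum_le_sum fun x _ => mul_le_mul_of_nonneg_left (h x) (weight_nonneg hp x)

theorem iidMean_add (f g : (Fin n → 𝒳) → ℝ) :
    iidMean p n (fun x => f x + g x) = iidMean p n f + iidMean p n g := by
  simp only [iidMean, mul_add, Finset.sum_add_distrib]

theorem iidMean_mul_left (c : ℝ) (f : (Fin n → 𝒳) → ℝ) :
    iidMean p n (fun x => c * f x) = c * iidMean p n f := by
  simp only [iidMean, Finset.mul_sum, mul_left_comm]

theorem iidMean_mul_right (c : ℝ) (f : (Fin n → 𝒳) → ℝ) :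
    iidMean p n (fun x => f x * c) = iidMean p n f * c := by
  simp only [iidMean, Finset.sum_mul, mul_assoc]

theorem iidMean_const (hp : p ∈ stdSimplex ℝ 𝒳) (c : ℝ) : iidMean p n (fun _ => c) = c := by
  have h : ∑ x : Fin n → 𝒳, ∏ k, p (x k) = 1 := by
    rw [← Fintype.piFinset_univ, ← Finset.prod_univ_sum, Finset.prod_const, hp.2, one_pow]
  rw [iidMean, ← Finset.sum_mul, h, one_mul]

theorem iidMean_sum {ι : Type*} (t : Finset ι) (f : ι → (Fin n → 𝒳) → ℝ) :
    iidMean p n (fun x => ∑ j ∈ t, f j x) = ∑ j ∈ t, iidMean p n (f j) := by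
  simp only [iidMean, Finset.mul_sum]
  exact Finset.sum_comm

theorem iidMean_le (hp : p ∈ stdSimplex ℝ 𝒳) {f : (Fin n → 𝒳) → ℝ} {c : ℝ} (h : ∀ x, f x ≤ c) :
    iidMean p n f ≤ c :=
  (iidMean_mono hp h).trans_eq (iidMean_const hp c)

theorem le_iidMean (hp : p ∈ stdSimplex ℝ 𝒳) {f : (Fin n → 𝒳) → ℝ} {c : ℝ} (h : ∀ x, c ≤ f x) :
    c ≤ iidMean p n f :=
  (iidMean_const hp c).symm.trans_le (iidMean_mono hp h)

/-- Replacing a fragment by an independent copy does not change the distribution: the exchange of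
the old and the new fragment is an involution that preserves the weights. -/
theorem iidMean_splice {i : ℕ} (hi : i + s ≤ n) (F : (Fin n → 𝒳) → ℝ) (hp : p ∈ stdSimplex ℝ 𝒳) :
    iidMean p n (fun x => iidMean p s fun v => F (splice x i v)) = iidMean p n F := by
  have h1 : iidMean p n (fun x => iidMean p s fun v => F (splice x i v)) =
      ∑ z : (Fin n → 𝒳) × (Fin s → 𝒳),
        ((∏ k, p (z.1 k)) * ∏ j, p (z.2 j)) * F (splice z.1 i z.2) := by
    rw [Fintype.sum_prod_type]
    simp only [iidMean, Finset.mul_sum, mul_assoc]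
  have h2 : iidMean p n F = ∑ z : (Fin n → 𝒳) × (Fin s → 𝒳),
      ((∏ k, p (z.1 k)) * ∏ j, p (z.2 j)) * F z.1 := by
    rw [Fintype.sum_prod_type, iidMean]
    refine Finset.sum_congr rfl fun x _ => ?_
    have h3 := iidMean_const (n := s) hp 1
    simp only [iidMean, mul_one] at h3
    change _ = ∑ y : Fin s → 𝒳, ((∏ k, p (x k)) * ∏ j, p (y j)) * F x
    rw [← Finset.sum_mul, ← Finset.mul_sum, h3, mul_one]
  rw [h1, h2]
  have hinv : Function.Involutive (fun z : (Fin n → 𝒳) × (Fin s → 𝒳) =>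
      (splice z.1 i z.2, fragment hi z.1)) := fun z =>
    Prod.ext (splice_splice hi z.1 z.2) (fragment_splice hi z.1 z.2)
  refine Fintype.sum_equiv hinv.toPerm _ _ fun z => ?_
  change _ = ((∏ k, p (splice z.1 i z.2 k)) * ∏ j, p (fragment hi z.1 j)) * F (splice z.1 i z.2)
  rw [prod_splice]

end Mean

namespace Coder

variable {𝒳 : Type*} {p : 𝒳 → ℝ} {D : Coder} {W n L i s l S n₀ κ : ℕ}
  {sym : 𝒳 ≃ Fin D.q}

theorem pos_congr {d d' : ℕ → ℕ} {k : ℕ} (h : ∀ u < k * D.b, d u = d' u) :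
    D.pos l d k = D.pos l d' k := by
  refine queuePos_congr fun j hj => ?_
  have : D.blockRank d (0 + j) = D.blockRank d' (0 + j) := by
    refine blockRank_congr fun u hu => h _ ?_
    have : (0 + j + 1) * D.b ≤ k * D.b := Nat.mul_le_mul_right _ (by omega)
    rw [Nat.succ_mul] at this
    omega
  rw [overflows, overflows, this]

theorem potential_congr {d d' : ℕ → ℕ} {k : ℕ} (h : ∀ u < k * D.b, d u = d' u) :
    D.potential l d k = D.potential l d' k := by
  have hp : ∀ j ≤ k, D.pos l d j = D.pos l d' j := fun j hj =>
    pos_congr fun u hu => h u (hu.trans_le (Nat.mul_le_mul_right _ hj))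
  have hr : D.busyRun l d k = D.busyRun l d' k := scanLen_congr fun j hj => by rw [hp j hj]
  rw [potential, potential, hp k le_rfl, hr]

theorem overflows_splice (x : Fin n → 𝒳) (v : Fin D.b → 𝒳) {k : ℕ} (hk : k * D.b + D.b ≤ n) :
    overflows l (D.blockRank (symbols sym (splice x (k * D.b) v))) k =
      overflows l (D.blockRank (symbols sym v)) 0 := by
  have h : D.blockRank (symbols sym (splice x (k * D.b) v)) k =
      D.blockRank (symbols sym v) 0 := by
    rw [symbols_splice sym x v hk, blockRank, blockRank]
    congr 1
    refine Finset.sum_congr rfl fun u hu => ?_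
    have hu := Finset.mem_range.1 hu
    dsimp only
    rw [replaced, if_pos (by omega), Nat.add_sub_cancel_left, Nat.zero_mul, Nat.zero_add]
  rw [overflows, overflows, h]

variable [Fintype 𝒳]

/-- Probability that a block of source symbols overflows. -/
noncomputable def overflowProb (D : Coder) (sym : 𝒳 ≃ Fin D.q) (p : 𝒳 → ℝ) (l : ℕ) : ℝ :=
  iidMean p D.b fun v => (overflows l (D.blockRank (symbols sym v)) 0 : ℝ)

theorem overflowProb_nonneg (hp : p ∈ stdSimplex ℝ 𝒳) : 0 ≤ D.overflowProb sym p l :=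
  le_iidMean hp fun _ => Nat.cast_nonneg _

/-- The expected potential stays bounded if overflows are rare. -/
theorem mean_potential_le (hp : p ∈ stdSimplex ℝ 𝒳) (hβ : 1 ≤ D.β)
    (hδ : D.overflowProb sym p l ≤ 1 / (16 * ((D.β : ℝ) + 1))) {k : ℕ} (hk : k * D.b ≤ n) :
    iidMean p n (fun x => D.potential l (symbols sym x) k) ≤
      8 * D.overflowProb sym p l * (D.β + 1) := by
  set δ := D.overflowProb sym p l with hδ'
  have hδ0 : 0 ≤ δ := overflowProb_nonneg hp
  have hβ' : (1 : ℝ) ≤ D.β := by exact_mod_cast hβ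
  induction k with
  | zero =>
    refine (iidMean_le (c := 0) hp fun x => ?_).trans (by positivity)
    rw [potential, pos_zero, if_neg (lt_irrefl 0)]
  | succ k ih =>
    rw [Nat.succ_mul] at hk
    have ih := ih (by omega)
    set c : ℝ := 1 - 3 / (4 * ((D.β : ℝ) + 1)) with hc
    set E := iidMean p n (fun x => D.potential l (symbols sym x) k) with hE
    have hE0 : 0 ≤ E := le_iidMean hp fun x => potential_nonneg _ _ _
    have hstep : iidMean p n (fun x => D.potential l (symbols sym x) (k + 1)) ≤
        c * E + δ * (4 * (E + 1)) := by
      rw [← iidMean_splice hk _ hp]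
      calc iidMean p n (fun x => iidMean p D.b fun v =>
            D.potential l (symbols sym (splice x (k * D.b) v)) (k + 1))
          ≤ iidMean p n (fun x => c * D.potential l (symbols sym x) k +
              δ * (4 * (D.potential l (symbols sym x) k + 1))) := by
            refine iidMean_mono hp fun x => ?_
            rw [hδ', overflowProb, ← iidMean_mul_right,
              ← iidMean_const (n := D.b) hp (c * D.potential l (symbols sym x) k), ← iidMean_add]
            refine iidMean_mono hp fun v => ?_
            have h1 := potential_succ_le hβ l (symbols sym (splice x (k * D.b) v)) k
            have h2 : D.potential l (symbols sym (splice x (k * D.b) v)) k =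
                D.potential l (symbols sym x) k := potential_congr fun u hu => by
              rw [symbols_splice sym x v hk, replaced, if_neg (by omega)]
            rwa [h2, overflows_splice x v hk] at h1
        _ = c * E + δ * (4 * (E + 1)) := by
            rw [iidMean_add, iidMean_mul_left, iidMean_mul_left, iidMean_mul_left, iidMean_add,
              iidMean_const hp]
    refine hstep.trans ?_
    have h4 : 16 * δ * (D.β + 1) ≤ 1 := by
      rw [le_div_iff₀ (by positivity)] at hδ
      linarith
    have h5 : c * (4 * ((D.β : ℝ) + 1)) = 4 * (D.β + 1) - 3 := by
      rw [hc]; field_simp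
    have h6 : (c + 4 * δ) * (8 * δ * (D.β + 1)) + 4 * δ ≤ 8 * δ * (D.β + 1) := by
      have : c * (8 * δ * (D.β + 1)) = 2 * δ * (c * (4 * (D.β + 1))) := by ring
      rw [add_mul, this, h5]
      nlinarith
    have hc0 : 0 ≤ c := by
      rw [hc, sub_nonneg, div_le_one (by positivity)]; linarith
    have h7 : (c + 4 * δ) * E ≤ (c + 4 * δ) * (8 * δ * (D.β + 1)) := by gcongr
    linarith

end Coder

namespace Coder

/-! ### Expected costs -/

theorem le_mul_blocks {D : Coder} (hb : 2 ≤ D.b) {i s : ℕ} (hs : 1 ≤ s) :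
    s ≤ D.b * D.blocks i s := by
  have h1 : i + s - 1 < ((i + s - 1) / D.b + 1) * D.b :=
    Nat.lt_mul_of_div_lt (Nat.lt_succ_self _) (by omega)
  have h2 : i / D.b * D.b ≤ i := Nat.div_mul_le_self i D.b
  have h3 : i / D.b ≤ (i + s - 1) / D.b := Nat.div_le_div_right (by omega)
  rw [blocks, mul_comm, Nat.sub_mul]
  omega

theorem mul_blocks_le {D : Coder} (hb : 2 ≤ D.b) {i s : ℕ} (hs : 1 ≤ s) :
    D.b * D.blocks i s ≤ s + 2 * D.b := by
  have h1 : (i + s - 1) / D.b * D.b ≤ i + s - 1 := Nat.div_mul_le_self _ _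
  have h2 : i < (i / D.b + 1) * D.b := Nat.lt_mul_of_div_lt (Nat.lt_succ_self _) (by omega)
  rw [blocks, mul_comm, Nat.sub_mul]
  rw [Nat.add_mul] at h2 ⊢
  omega

variable {𝒳 : Type*} [Fintype 𝒳] {p : 𝒳 → ℝ} {D : Coder} {W n L i s l S n₀ κ : ℕ}
  {sym : 𝒳 ≃ Fin D.q}

/-- Blocks overflow so rarely, and the sequence is so long, that the queue is almost always idle and
outgrows the codeword with negligible probability. -/
structure Rare (D : Coder) (sym : 𝒳 ≃ Fin D.q) (p : 𝒳 → ℝ) (n l : ℕ) : Prop where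
  source : p ∈ stdSimplex ℝ 𝒳
  β_pos : 1 ≤ D.β
  overflow : D.overflowProb sym p l ≤ 1 / (64 * ((D.β : ℝ) + 1) ^ 2)
  slack : n / D.b + 1 + D.β ≤ n / (D.b - 1)
  blocks_le : ((n / D.b + 1 : ℕ) : ℝ) ≤
    (1 + 1 / (D.β : ℝ)) ^ (n / (D.b - 1) - n / D.b - D.β)

theorem Rare.mean_potential (h : Rare D sym p n l) {k : ℕ} (hk : k ≤ n / D.b) :
    iidMean p n (fun x => D.potential l (symbols sym x) k) ≤ 1 / (8 * ((D.β : ℝ) + 1)) := by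
  have hβ : (1 : ℝ) ≤ D.β := by exact_mod_cast h.β_pos
  have hδ := h.overflow
  refine (mean_potential_le h.source h.β_pos (hδ.trans ?_)
    ((Nat.mul_le_mul_right _ hk).trans (Nat.div_mul_le_self _ _))).trans ?_
  · apply one_div_le_one_div_of_le (by positivity)
    nlinarith
  · rw [le_div_iff₀ (by positivity)] at hδ ⊢
    nlinarith

theorem Rare.mean_busyRun (h : Rare D sym p n l) {k : ℕ} (hk : k ≤ n / D.b) :
    iidMean p n (fun x => (D.busyRun l (symbols sym x) k : ℝ)) ≤ 1 := by
  have hβ : (1 : ℝ) ≤ D.β := by exact_mod_cast h.β_pos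
  calc iidMean p n (fun x => (D.busyRun l (symbols sym x) k : ℝ))
      ≤ iidMean p n (fun x => 4 * D.β * D.potential l (symbols sym x) k) :=
        iidMean_mono h.source fun x => busyRun_le_potential h.β_pos _ _ _
    _ ≤ 4 * D.β * (1 / (8 * ((D.β : ℝ) + 1))) := by
        rw [iidMean_mul_left]
        have := h.mean_potential hk
        gcongr
    _ ≤ 1 := by
        rw [mul_one_div, div_le_one (by positivity)]
        linarith

variable [Nonempty 𝒳]

open Classical in
/-- A sequence that is not decoded leaves a long queue behind the last block, that is, a large
potential. -/
theorem Rare.indicator_le (hr : Rare D sym p n l) (h : Room D W n L l S) (hD : D.Numbering)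
    (x : Fin n → 𝒳) : (if (D.blockScheme sym l n L).Decodes x then (0 : ℝ) else 1) *
      (1 + 1 / (D.β : ℝ)) ^ (n / (D.b - 1) - n / D.b - D.β) ≤
        D.potential l (symbols sym x) (n / D.b) := by
  split
  · rw [zero_mul]
    exact potential_nonneg _ _ _
  · rename_i hx
    rw [one_mul]
    refine pow_le_potential (by have := hr.slack; omega) ?_
    by_contra hG
    exact hx (decodes_of_pos_le h hD (not_lt.1 hG))

theorem Rare.errorProb_le (hr : Rare D sym p n l) (h : Room D W n L l S) (hD : D.Numbering) :
    errorProb p (D.blockScheme sym l n L) ≤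
      ((1 + 1 / (D.β : ℝ)) ^ (n / (D.b - 1) - n / D.b - D.β))⁻¹ := by
  classical
  have hβ : (1 : ℝ) ≤ D.β := by exact_mod_cast hr.β_pos
  rw [← one_div, le_div_iff₀ (by positivity), errorProb, ← iidMean_mul_right]
  calc _ ≤ iidMean p n (fun x => D.potential l (symbols sym x) (n / D.b)) :=
        iidMean_mono hr.source fun x => hr.indicator_le h hD x
    _ ≤ 1 / (8 * ((D.β : ℝ) + 1)) := hr.mean_potential le_rfl
    _ ≤ 1 := by
        rw [div_le_one (by positivity)]
        linarith

/-- The expected number of blocks that an update rewrites. -/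
theorem Rare.mean_rewritten_le (hr : Rare D sym p n l) (h : Room D W n L l S) (hD : D.Numbering)
    (hi : i + s ≤ n) (hs : 1 ≤ s) {m : (Fin n → 𝒳) → (Fin s → 𝒳) → ℕ}
    (hm : ∀ x v, (D.blockScheme sym l n L).Decodes x → ∀ j, D.blocks i s ≤ j → j < m x v →
      i / D.b + j < D.pos l (symbols sym x) (i / D.b + j) ∨
      i / D.b + j < D.pos l (symbols sym (splice x i v)) (i / D.b + j))
    (hm' : ∀ x v, i / D.b + m x v ≤ n / D.b + 1) :
    iidMean p n (fun x => iidMean p s fun v => (m x v : ℝ)) ≤ D.blocks i s + 2 := by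
  classical
  have hp := hr.source
  have hb := h.b_pos
  have hβ : (1 : ℝ) ≤ D.β := by exact_mod_cast hr.β_pos
  have h3 : i / D.b ≤ (i + s - 1) / D.b := Nat.div_le_div_right (by omega)
  have h4 : (i + s - 1) / D.b ≤ n / D.b := Nat.div_le_div_right (by omega)
  set J := D.blocks i s with hJ
  have hJ' : i / D.b + J = (i + s - 1) / D.b + 1 := by rw [hJ, blocks]; omega
  set K := i / D.b + J with hK
  set g : ℝ := (1 + 1 / (4 * D.β : ℝ))⁻¹ with hg
  have hg0 : 0 ≤ g := by positivity
  set U : ℕ → (Fin n → 𝒳) → ℝ := fun k x => D.potential l (symbols sym x) k with hU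
  have hU0 : ∀ k x, 0 ≤ U k x := fun k x => potential_nonneg _ _ _
  have hpt : ∀ x v, (m x v : ℝ) ≤ J + (∑ j ∈ Finset.range (n / D.b + 1 - K),
      (U (K + j) x + U (K + j) (splice x i v)) * g ^ (j + 1) + U (n / D.b) x) := by
    intro x v
    have hsum : 0 ≤ ∑ j ∈ Finset.range (n / D.b + 1 - K),
        (U (K + j) x + U (K + j) (splice x i v)) * g ^ (j + 1) :=
      Finset.sum_nonneg fun j _ => mul_nonneg (add_nonneg (hU0 _ _) (hU0 _ _)) (by positivity)
    by_cases hx : (D.blockScheme sym l n L).Decodes x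
    · have h5 := busy_count_le (D := D) (l := l) (d := symbols sym x)
        (d' := symbols sym (splice x i v)) (K := K) (e := m x v - J) (fun k hk => ?_) fun j hj => ?_
      · have h6 : (m x v : ℝ) ≤ J + (m x v - J : ℕ) := by
          exact_mod_cast (by omega : m x v ≤ J + (m x v - J))
        have h7 : ∑ j ∈ Finset.range (m x v - J),
            (U (K + j) x + U (K + j) (splice x i v)) * g ^ (j + 1) ≤
            ∑ j ∈ Finset.range (n / D.b + 1 - K),
            (U (K + j) x + U (K + j) (splice x i v)) * g ^ (j + 1) := by
          refine Finset.sum_le_sum_of_subset_of_nonneg (fun j hj => ?_) fun j _ _ =>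
            mul_nonneg (add_nonneg (hU0 _ _) (hU0 _ _)) (by positivity)
          have := hm' x v
          rw [Finset.mem_range] at hj ⊢
          omega
        have := hU0 (n / D.b) x
        have h8 := h5.trans h7
        linarith
      · have : D.blockRank (symbols sym x) k = D.blockRank (symbols sym (splice x i v)) k := by
          refine blockRank_congr fun u _ => ?_
          have h9 : i + s - 1 < ((i + s - 1) / D.b + 1) * D.b :=
            Nat.lt_mul_of_div_lt (Nat.lt_succ_self _) (by omega)
          have h10 : ((i + s - 1) / D.b + 1) * D.b ≤ k * D.b := Nat.mul_le_mul_right _ (by omega)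
          rw [symbols_splice sym x v hi, replaced, if_neg (by omega)]
        rw [overflows, overflows, this]
      · have := hm x v hx (J + j) (by omega) (by omega)
        rwa [← Nat.add_assoc] at this
    · have h5 := hr.indicator_le h hD x
      rw [if_neg hx, one_mul] at h5
      have h6 : (m x v : ℝ) ≤ ((n / D.b + 1 : ℕ) : ℝ) := by
        exact_mod_cast (Nat.le_add_left _ _).trans (hm' x v)
      have h7 : (0 : ℝ) ≤ J := Nat.cast_nonneg _
      have h8 := hr.blocks_le.trans h5
      change _ ≤ U (n / D.b) x at h8
      linarith
  have hEU : ∀ k ≤ n / D.b, iidMean p n (U k) ≤ 1 / (8 * ((D.β : ℝ) + 1)) :=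
    fun k hk => hr.mean_potential hk
  have h8 : (0 : ℝ) < 8 * ((D.β : ℝ) + 1) := by positivity
  calc iidMean p n (fun x => iidMean p s fun v => (m x v : ℝ))
      ≤ iidMean p n (fun x => iidMean p s fun v => J + (∑ j ∈ Finset.range (n / D.b + 1 - K),
          (U (K + j) x + U (K + j) (splice x i v)) * g ^ (j + 1) + U (n / D.b) x)) :=
        iidMean_mono hp fun x => iidMean_mono hp fun v => hpt x v
    _ = J + (∑ j ∈ Finset.range (n / D.b + 1 - K),
          (iidMean p n (U (K + j)) + iidMean p n (U (K + j))) * g ^ (j + 1) +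
          iidMean p n (U (n / D.b))) := by
        simp only [iidMean_add, iidMean_sum, iidMean_mul_right, iidMean_const hp,
          iidMean_splice hi _ hp]
    _ ≤ J + (∑ j ∈ Finset.range (n / D.b + 1 - K),
          (1 / (8 * ((D.β : ℝ) + 1)) + 1 / (8 * ((D.β : ℝ) + 1))) * g ^ (j + 1) +
          1 / (8 * ((D.β : ℝ) + 1))) := by
        gcongr with j hj
        · exact hEU _ (by have := Finset.mem_range.1 hj; omega)
        · exact hEU _ (by have := Finset.mem_range.1 hj; omega)
        · exact hEU _ le_rfl
    _ ≤ J + ((1 / (8 * ((D.β : ℝ) + 1)) + 1 / (8 * ((D.β : ℝ) + 1))) * (4 * D.β) +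
          1 / (8 * ((D.β : ℝ) + 1))) := by
        rw [← Finset.mul_sum]
        have := geom_sum_le hr.β_pos (n / D.b + 1 - K)
        gcongr
    _ ≤ J + 2 := by
        have h9 : (1 / (8 * ((D.β : ℝ) + 1)) + 1 / (8 * ((D.β : ℝ) + 1))) * (4 * D.β) +
            1 / (8 * ((D.β : ℝ) + 1)) = (8 * D.β + 1) / (8 * ((D.β : ℝ) + 1)) := by ring
        rw [h9]
        have : (8 * D.β + 1) / (8 * ((D.β : ℝ) + 1)) ≤ 1 := by
          rw [div_le_one h8]; linarith
        linarith

/-- Expected number of accesses and expected time of local decoding. -/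
theorem Rare.mean_locRun (hr : Rare D sym p n l) (h : Room D ((D.algorithms n₀ κ).words n) n L l S)
    (hn : n₀ ≤ n) (hw : n₀ < (D.algorithms n₀ κ).words n) (hi : i + s ≤ n) (hs : 1 ≤ s) :
    iidMean p n (fun x =>
      ((locRun (D.algorithms n₀ κ) (D.blockScheme sym l n L) x i s).reads : ℝ)) ≤
        3 + D.blocks i s * (1 + l + D.β) ∧
    D.blocks i s ≤ meanLocalDecodeTime (D.algorithms n₀ κ) p (D.blockScheme sym l n L) i s ∧
    meanLocalDecodeTime (D.algorithms n₀ κ) p (D.blockScheme sym l n L) i s ≤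
      4 + D.decodeTime * (D.blocks i s + 2) := by
  have hp := hr.source
  have hk : i / D.b ≤ n / D.b := Nat.div_le_div_right (by omega)
  have hrun := hr.mean_busyRun hk
  refine ⟨?_, ?_, ?_⟩
  · calc _ ≤ iidMean p n (fun x => 1 + (2 * (D.busyRun l (symbols sym x) (i / D.b) : ℝ) +
          D.blocks i s * (1 + l + D.β))) := iidMean_mono hp fun x => by
            have := (locRun_cost (sym := sym) h hn hw hi hs x).1
            rw [← add_assoc]
            exact_mod_cast this
      _ = 1 + (2 * iidMean p n (fun x => (D.busyRun l (symbols sym x) (i / D.b) : ℝ)) +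
          D.blocks i s * (1 + l + D.β)) := by
            simp only [iidMean_add, iidMean_mul_left, iidMean_const hp]
      _ ≤ _ := by linarith
  · exact le_iidMean hp fun x => by exact_mod_cast (locRun_cost (sym := sym) h hn hw hi hs x).2.1
  · calc _ ≤ iidMean p n (fun x => 4 + D.decodeTime *
          ((D.busyRun l (symbols sym x) (i / D.b) : ℝ) + (D.blocks i s + 1))) :=
          iidMean_mono hp fun x => by
            have := (locRun_cost (sym := sym) h hn hw hi hs x).2.2
            rw [← add_assoc]
            exact_mod_cast this
      _ = 4 + D.decodeTime * (iidMean p n (fun x =>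
          (D.busyRun l (symbols sym x) (i / D.b) : ℝ)) + (D.blocks i s + 1)) := by
            simp only [iidMean_add, iidMean_mul_left, iidMean_const hp]
      _ ≤ 4 + D.decodeTime * (1 + (D.blocks i s + 1)) := by gcongr
      _ = _ := by ring

/-- Expected number of accesses and expected time of a local update. -/
theorem Rare.mean_updRun (hr : Rare D sym p n l) (h : Room D ((D.algorithms n₀ κ).words n) n L l S)
    (hD : D.Numbering) (hn : n₀ ≤ n) (hw : n₀ < (D.algorithms n₀ κ).words n) (hi : i + s ≤ n)
    (hs : 1 ≤ s) :
    iidMean p n (fun x => iidMean p s fun v =>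
      ((updRun sym (D.algorithms n₀ κ) (D.blockScheme sym l n L) x i v).reads : ℝ) +
        ((updRun sym (D.algorithms n₀ κ) (D.blockScheme sym l n L) x i v).writes : ℝ)) ≤
        4 + (D.blocks i s + 2) * (2 * l + 3 * D.β + 4) ∧
    D.blocks i s ≤ meanLocalUpdateTime sym (D.algorithms n₀ κ) p (D.blockScheme sym l n L) i s ∧
    meanLocalUpdateTime sym (D.algorithms n₀ κ) p (D.blockScheme sym l n L) i s ≤
      4 + D.updateTime * (D.blocks i s + 4) := by
  have hp := hr.source
  have hk : i / D.b ≤ n / D.b := Nat.div_le_div_right (by omega)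
  have hrun := hr.mean_busyRun hk
  choose m h1 h2 h3 h4 h5 h6 using fun x v => updRun_cost (sym := sym) h hD hn hw hi hs x v
  have hM := hr.mean_rewritten_le h hD hi hs h1 h4
  refine ⟨?_, ?_, ?_⟩
  · calc _ ≤ iidMean p n (fun x => iidMean p s fun v =>
          1 + (3 * (D.busyRun l (symbols sym x) (i / D.b) : ℝ) +
          m x v * (2 * l + 3 * D.β + 4))) := iidMean_mono hp fun x => iidMean_mono hp fun v => by
            have := h2 x v
            rw [← add_assoc]
            exact_mod_cast this
      _ = 1 + (3 * iidMean p n (fun x => (D.busyRun l (symbols sym x) (i / D.b) : ℝ)) +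
          iidMean p n (fun x => iidMean p s fun v => (m x v : ℝ)) * (2 * l + 3 * D.β + 4)) := by
            simp only [iidMean_add, iidMean_mul_left, iidMean_mul_right, iidMean_const hp]
      _ ≤ 1 + (3 * 1 + (D.blocks i s + 2) * (2 * l + 3 * D.β + 4)) := by gcongr
      _ = _ := by ring
  · exact le_iidMean hp fun x => le_iidMean hp fun v => by
      exact_mod_cast (h3 x v).trans (h5 x v)
  · calc _ ≤ iidMean p n (fun x => iidMean p s fun v => 4 + D.updateTime *
          ((D.busyRun l (symbols sym x) (i / D.b) : ℝ) + (m x v + 1))) :=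
          iidMean_mono hp fun x => iidMean_mono hp fun v => by
            have := h6 x v
            rw [← add_assoc]
            exact_mod_cast this
      _ = 4 + D.updateTime * (iidMean p n (fun x =>
          (D.busyRun l (symbols sym x) (i / D.b) : ℝ)) +
          (iidMean p n (fun x => iidMean p s fun v => (m x v : ℝ)) + 1)) := by
            simp only [iidMean_add, iidMean_mul_left, iidMean_const hp]
      _ ≤ 4 + D.updateTime * (1 + ((D.blocks i s + 2) + 1)) := by gcongr
      _ = _ := by ring

end Coder

/-! ### Ranking the blocks by the size of their type class -/

section TypeClass

variable {𝒳 : Type*} [Fintype 𝒳] [DecidableEq 𝒳] {b : ℕ}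

/-- The number of occurrences of each symbol in the word `v`. -/
def letterCount (v : Fin b → 𝒳) (a : 𝒳) : ℕ := (Finset.univ.filter fun j => v j = a).card

/-- The words with the same letter counts as `v`. -/
def typeClass (v : Fin b → 𝒳) : Finset (Fin b → 𝒳) :=
  Finset.univ.filter fun w => letterCount w = letterCount v

theorem mem_typeClass_self (v : Fin b → 𝒳) : v ∈ typeClass v := by simp [typeClass]

/-- There are at most `(b + 1) ^ q` type classes. -/
theorem card_typeClass_le (K : ℕ) :
    (Finset.univ.filter fun w : Fin b → 𝒳 => (typeClass w).card ≤ K).card ≤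
      (b + 1) ^ Fintype.card 𝒳 * K := by
  set s := Finset.univ.filter fun w : Fin b → 𝒳 => (typeClass w).card ≤ K
  have hc : ∀ (w : Fin b → 𝒳) a, letterCount w a < b + 1 := fun w a =>
    Nat.lt_succ_of_le ((Finset.card_le_univ _).trans_eq (Fintype.card_fin b))
  let t : (Fin b → 𝒳) → (𝒳 → Fin (b + 1)) := fun w a => ⟨letterCount w a, hc w a⟩
  have ht : ∀ w v, t w = t v → letterCount w = letterCount v := fun w v h => by
    funext a
    simpa [t] using congrFun h a
  have h1 : s.card ≤ K * (Finset.univ : Finset (𝒳 → Fin (b + 1))).card := by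
    refine Finset.card_le_mul_card_image_of_maps_to (f := t) (fun _ _ => Finset.mem_univ _) K
      fun τ _ => ?_
    rcases (s.filter fun w => t w = τ).eq_empty_or_nonempty with h | ⟨v, hv⟩
    · rw [h]; simp
    · rw [Finset.mem_filter] at hv
      refine le_trans (Finset.card_le_card fun w hw => ?_) (Finset.mem_filter.1 hv.1).2
      rw [Finset.mem_filter] at hw
      exact Finset.mem_filter.2 ⟨Finset.mem_univ _, ht _ _ (hw.2.trans hv.2.symm)⟩
  rwa [Finset.card_univ, Fintype.card_fun, Fintype.card_fin, mul_comm] at h1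

theorem prod_eq_prod_pow_letterCount (p : 𝒳 → ℝ) (v : Fin b → 𝒳) :
    ∏ j, p (v j) = ∏ a, p a ^ letterCount v a := by
  rw [← Finset.prod_fiberwise' Finset.univ v p]
  simp [letterCount]

/-- A word is at most as likely as a uniformly drawn element of its type class. -/
theorem card_typeClass_mul_prod_le {p : 𝒳 → ℝ} (hp : p ∈ stdSimplex ℝ 𝒳) (v : Fin b → 𝒳) :
    (typeClass v).card * ∏ j, p (v j) ≤ 1 := by
  have h1 : ∑ w ∈ typeClass v, ∏ j, p (w j) = (typeClass v).card * ∏ j, p (v j) := by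
    rw [Finset.sum_congr rfl fun w hw => ?_, Finset.sum_const, nsmul_eq_mul]
    rw [prod_eq_prod_pow_letterCount, prod_eq_prod_pow_letterCount, (Finset.mem_filter.1 hw).2]
  have h2 := iidMean_const (n := b) hp 1
  simp only [iidMean, mul_one] at h2
  rw [← h1, ← h2]
  exact Finset.sum_le_sum_of_subset_of_nonneg (Finset.subset_univ _)
    fun w _ _ => weight_nonneg hp w

theorem card_typeClass_equiv {𝒴 : Type*} [Fintype 𝒴] [DecidableEq 𝒴] (e : 𝒳 ≃ 𝒴)
    (v : Fin b → 𝒳) : (typeClass fun j => e (v j)).card = (typeClass v).card := by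
  symm
  refine Finset.card_bij (fun w _ j => e (w j)) (fun w hw => ?_) (fun w _ w' _ h => ?_)
    fun w hw => ?_
  · simp only [typeClass, Finset.mem_filter, Finset.mem_univ, true_and] at hw ⊢
    funext a
    have := congrFun hw (e.symm a)
    simpa [letterCount, Equiv.eq_symm_apply] using this
  · funext j
    exact e.injective (congrFun h j)
  · refine ⟨fun j => e.symm (w j), ?_, by simp⟩
    simp only [typeClass, Finset.mem_filter, Finset.mem_univ, true_and] at hw ⊢
    funext a
    have := congrFun hw (e a)
    simpa [letterCount, Equiv.symm_apply_eq] using this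

end TypeClass

/-- There is a numbering of the blocks of length `b` in which a block precedes all blocks whose type
class is larger; the zero block comes first. -/
theorem exists_rank {q : ℕ} (hq : 0 < q) (b : ℕ) : ∃ rank unrank : ℕ → ℕ,
    (∀ v < q ^ b, rank v < q ^ b) ∧ (∀ v, unrank v < q ^ b) ∧
    (∀ v, q ^ b ≤ v → unrank v = 0) ∧ (∀ v < q ^ b, unrank (rank v) = v) ∧ rank 0 = 0 ∧
    ∀ v < q ^ b, rank v ≤ (b + 1) ^ q *
      (typeClass fun j : Fin b => (⟨v / q ^ (j : ℕ) % q, Nat.mod_lt _ hq⟩ : Fin q)).card := by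
  have hqb : 0 < q ^ b := pow_pos hq b
  let word : Fin (q ^ b) → Fin b → Fin q := finFunctionFinEquiv.symm
  let f : Fin (q ^ b) → ℕ := fun u => if (u : ℕ) = 0 then 0 else (typeClass (word u)).card
  let σ := Tuple.sort f
  have hmono : Monotone (f ∘ σ) := Tuple.monotone_sort f
  have hf : ∀ u : Fin (q ^ b), f u = 0 → (u : ℕ) = 0 := fun u hu => by
    by_contra h0
    have : 0 < (typeClass (word u)).card := Finset.card_pos.2 ⟨_, mem_typeClass_self _⟩
    simp only [f, if_neg h0] at hu
    omega
  have hσ0 : (σ.symm ⟨0, hqb⟩ : ℕ) = 0 := by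
    have h1 : f (σ ⟨0, hqb⟩) ≤ f (σ (σ.symm ⟨0, hqb⟩)) := hmono (Nat.zero_le _)
    rw [Equiv.apply_symm_apply] at h1
    have h2 : σ ⟨0, hqb⟩ = ⟨0, hqb⟩ := Fin.ext (hf _ (Nat.le_zero.1 (h1.trans (by simp [f]))))
    rw [(Equiv.symm_apply_eq σ).2 h2.symm]
  -- at most this many words have a key that is not larger
  have hcount : ∀ u : Fin (q ^ b), (σ.symm u : ℕ) ≤ (b + 1) ^ q * (typeClass (word u)).card := by
    intro u
    by_cases hu : (u : ℕ) = 0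
    · rw [show u = ⟨0, hqb⟩ from Fin.ext hu, hσ0]; exact Nat.zero_le _
    have h1 : (Finset.univ.filter fun w => f w ≤ f u).card ≤
        (b + 1) ^ q * (typeClass (word u)).card + 1 := by
      have h2 := card_typeClass_le (𝒳 := Fin q) (b := b) (typeClass (word u)).card
      rw [Fintype.card_fin] at h2
      refine le_trans ?_ (Nat.succ_le_succ h2)
      calc (Finset.univ.filter fun w => f w ≤ f u).card
          ≤ (insert ⟨0, hqb⟩ ((Finset.univ.filter fun w : Fin b → Fin q =>
              (typeClass w).card ≤ (typeClass (word u)).card).image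
              finFunctionFinEquiv)).card := by
            refine Finset.card_le_card fun w hw => ?_
            rw [Finset.mem_insert]
            by_cases hw0 : (w : ℕ) = 0
            · exact Or.inl (Fin.ext hw0)
            · refine Or.inr (Finset.mem_image.2 ⟨word w, ?_, Equiv.apply_symm_apply _ _⟩)
              have := (Finset.mem_filter.1 hw).2
              simp only [f, if_neg hw0, if_neg hu] at this
              exact Finset.mem_filter.2 ⟨Finset.mem_univ _, this⟩
        _ ≤ _ := (Finset.card_insert_le _ _).trans (Nat.succ_le_succ Finset.card_image_le)
    have h3 : (Finset.Iic (σ.symm u)).card ≤ (Finset.univ.filter fun w => f w ≤ f u).card := by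
      refine Finset.card_le_card_of_injOn σ (fun j hj => ?_) σ.injective.injOn
      have h4 : f (σ j) ≤ f (σ (σ.symm u)) := hmono (Finset.mem_Iic.1 hj)
      rw [Equiv.apply_symm_apply] at h4
      simpa using h4
    rw [Fin.card_Iic] at h3
    omega
  refine ⟨fun v => if h : v < q ^ b then σ.symm ⟨v, h⟩ else 0,
    fun v => if h : v < q ^ b then σ ⟨v, h⟩ else 0, fun v hv => ?_, fun v => ?_, fun v hv => ?_,
    fun v hv => ?_, ?_, fun v hv => ?_⟩
  · simp only [dif_pos hv]; exact Fin.is_lt _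
  · dsimp only
    split
    · exact Fin.is_lt _
    · exact hqb
  · exact dif_neg (not_lt.2 hv)
  · simp [dif_pos hv]
  · simpa [dif_pos hqb] using hσ0
  · simp only [dif_pos hv]
    refine (hcount ⟨v, hv⟩).trans_eq ?_
    rfl

/-! ### The probability of an overflow -/

/-- The exponential moment of the information content of a symbol. -/
theorem sum_rpow_one_sub_le {𝒳 : Type*} [Fintype 𝒳] {p : 𝒳 → ℝ} (hp : p ∈ stdSimplex ℝ 𝒳)
    {t : ℝ} (ht0 : 0 < t) (ht : t ≤ 1 / 2) :
    ∑ a, p a ^ (1 - t) ≤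
      Real.exp (t * ∑ a, Real.negMulLog (p a) + 8 * Fintype.card 𝒳 * t ^ 2) := by
  have key : ∀ x : ℝ, 0 ≤ x → x ≤ 1 → x ^ (1 - t) ≤ x + t * Real.negMulLog x + 8 * t ^ 2 := by
    intro x hx0 hx1
    rcases hx0.eq_or_lt with rfl | hx
    · rw [Real.zero_rpow (by linarith)]
      simp; positivity
    · set y := -Real.log x with hy
      have hy0 : 0 ≤ y := neg_nonneg.2 (Real.log_nonpos hx0 hx1)
      have hxy : x = Real.exp (-y) := by rw [hy, neg_neg, Real.exp_log hx]
      have h1 : x ^ (1 - t) = Real.exp (-y) * Real.exp (t * y) := by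
        rw [hxy, ← Real.exp_mul, ← Real.exp_add]; ring_nf
      have h2 : Real.negMulLog x = Real.exp (-y) * y := by
        rw [Real.negMulLog, hxy, Real.log_exp]; ring
      rw [h1, h2, hxy]
      -- `exp u - 1 ≤ u exp u` twice
      have h3 : Real.exp (t * y) - 1 ≤ t * y * Real.exp (t * y) := by
        have := Real.add_one_le_exp (-(t * y))
        have h4 : Real.exp (-(t * y)) * Real.exp (t * y) = 1 := by
          rw [← Real.exp_add]; simp
        nlinarith [Real.exp_pos (t * y)]
      have hty : 0 ≤ t * y := by positivity
      have h5 : Real.exp (t * y) ≤ 1 + t * y + (t * y) ^ 2 * Real.exp (t * y) := by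
        nlinarith
      have h6 : y ^ 2 * Real.exp (t * y) * Real.exp (-y) ≤ 8 := by
        have h7 : Real.exp (t * y) * Real.exp (-y) ≤ Real.exp (-(y / 2)) := by
          rw [← Real.exp_add]
          apply Real.exp_le_exp.2
          nlinarith
        have h8 := Real.quadratic_le_exp_of_nonneg (x := y / 2) (by positivity)
        have h9 : Real.exp (y / 2) * Real.exp (-(y / 2)) = 1 := by
          rw [← Real.exp_add]; simp
        have h10 : y ^ 2 ≤ 8 * Real.exp (y / 2) := by nlinarith
        calc y ^ 2 * Real.exp (t * y) * Real.exp (-y)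
            = y ^ 2 * (Real.exp (t * y) * Real.exp (-y)) := by ring
          _ ≤ 8 * Real.exp (y / 2) * Real.exp (-(y / 2)) := by gcongr
          _ = 8 := by rw [mul_assoc, h9, mul_one]
      have h11 := mul_le_mul_of_nonneg_left h5 (Real.exp_pos (-y)).le
      have h12 := mul_le_mul_of_nonneg_left h6 (sq_nonneg t)
      nlinarith
  have hle : ∀ a, p a ≤ 1 := fun a => by
    rw [← hp.2]
    exact Finset.single_le_sum (fun i _ => hp.1 i) (Finset.mem_univ a)
  calc ∑ a, p a ^ (1 - t) ≤ ∑ a, (p a + t * Real.negMulLog (p a) + 8 * t ^ 2) :=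
        Finset.sum_le_sum fun a _ => key _ (hp.1 a) (hle a)
    _ = t * ∑ a, Real.negMulLog (p a) + 8 * Fintype.card 𝒳 * t ^ 2 + 1 := by
        rw [Finset.sum_add_distrib, Finset.sum_add_distrib, hp.2, ← Finset.mul_sum]
        simp
        ring
    _ ≤ _ := Real.add_one_le_exp _

namespace Coder

variable {𝒳 : Type*} [Fintype 𝒳] {p : 𝒳 → ℝ} {D : Coder} {l : ℕ} {sym : 𝒳 ≃ Fin D.q}

/-- The numbers of the blocks are bounded by the sizes of the type classes. -/
def RankBound (D : Coder) : Prop :=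
  ∀ w : Fin D.b → Fin D.q,
    D.rank (digitsVal D.q (fun u => if h : u < D.b then (w ⟨u, h⟩ : ℕ) else 0) D.b) ≤
      (D.b + 1) ^ D.q * (typeClass w).card

theorem prod_le_of_overflow (hR : D.RankBound) (hp : p ∈ stdSimplex ℝ 𝒳) (v : Fin D.b → 𝒳)
    (ho : overflows l (D.blockRank (symbols sym v)) 0 = 1) :
    ∏ j, p (v j) ≤ ((D.b : ℝ) + 1) ^ D.q / 2 ^ l := by
  classical
  have h1 := overflows_eq_one.1 ho
  have h2 := hR fun j => sym (v j)
  have h3 : D.blockRank (symbols sym v) 0 = D.rank (digitsVal D.q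
      (fun u => if h : u < D.b then (sym (v ⟨u, h⟩) : ℕ) else 0) D.b) := by
    rw [blockRank]
    simp only [Nat.zero_mul, Nat.zero_add]
    rfl
  rw [card_typeClass_equiv sym v] at h2
  have h4 : (2 : ℝ) ^ l ≤ ((D.b : ℝ) + 1) ^ D.q * (typeClass v).card := by
    rw [h3] at h1
    exact_mod_cast h1.trans h2
  have h5 := card_typeClass_mul_prod_le hp v
  have h6 : 0 ≤ ∏ j, p (v j) := weight_nonneg hp v
  rw [le_div_iff₀ (by positivity)]
  calc (∏ j, p (v j)) * 2 ^ l
      ≤ (∏ j, p (v j)) * (((D.b : ℝ) + 1) ^ D.q * (typeClass v).card) := by gcongr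
    _ = ((D.b : ℝ) + 1) ^ D.q * ((typeClass v).card * ∏ j, p (v j)) := by ring
    _ ≤ ((D.b : ℝ) + 1) ^ D.q * 1 := by gcongr
    _ = _ := mul_one _

/-- Markov's inequality for the exponential moment of the information content of a block. -/
theorem overflowProb_le (hR : D.RankBound) (hp : p ∈ stdSimplex ℝ 𝒳) {t : ℝ} (ht0 : 0 < t)
    (ht : t ≤ 1 / 2) : D.overflowProb sym p l ≤
      (((D.b : ℝ) + 1) ^ D.q / 2 ^ l) ^ t * (∑ a, p a ^ (1 - t)) ^ D.b := by
  set A : ℝ := ((D.b : ℝ) + 1) ^ D.q / 2 ^ l with hA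
  have hA0 : 0 < A := by positivity
  have h1 : ∀ v : Fin D.b → 𝒳, (∏ j, p (v j)) *
      (overflows l (D.blockRank (symbols sym v)) 0 : ℝ) ≤ A ^ t * ∏ j, p (v j) ^ (1 - t) := by
    intro v
    have h2 : 0 ≤ ∏ j, p (v j) := weight_nonneg hp v
    rw [Real.finsetProd_rpow _ _ fun j _ => hp.1 _]
    rcases Nat.le_one_iff_eq_zero_or_eq_one.1
      (overflows_le_one l (D.blockRank (symbols sym v)) 0) with h0 | h0
    · rw [h0]
      simp only [Nat.cast_zero, mul_zero]
      positivity
    · rw [h0, Nat.cast_one, mul_one]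
      have h3 := prod_le_of_overflow hR hp v h0
      calc ∏ j, p (v j) = (∏ j, p (v j)) ^ t * (∏ j, p (v j)) ^ (1 - t) := by
            rw [← Real.rpow_add_of_nonneg h2 ht0.le (by linarith), add_sub_cancel, Real.rpow_one]
        _ ≤ A ^ t * (∏ j, p (v j)) ^ (1 - t) := by gcongr
  calc D.overflowProb sym p l ≤ ∑ v : Fin D.b → 𝒳, A ^ t * ∏ j, p (v j) ^ (1 - t) :=
        Finset.sum_le_sum fun v _ => h1 v
    _ = _ := by
        rw [← Finset.mul_sum, ← Fintype.piFinset_univ,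
          ← Finset.prod_univ_sum (fun _ => Finset.univ) (fun _ a => p a ^ (1 - t)),
          Finset.prod_const, Finset.card_univ, Fintype.card_fin]

end Coder

/-! ### The choice of the parameters -/

theorem one_le_localScale {ε : ℝ} (h0 : 0 < ε) (h1 : ε < 1 / 2) :
    (1 / ε) ^ 2 ≤ localScale ε ∧ 1 ≤ localScale ε := by
  have hX : 2 ≤ 1 / ε := by
    rw [le_div_iff₀ h0]; linarith
  have hl : 1 ≤ Real.logb 2 (1 / ε) := by
    rw [Real.le_logb_iff_rpow_le (by norm_num) (by positivity), Real.rpow_one]; exact hX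
  have h2 : (1 / ε) ^ 2 ≤ localScale ε := by
    rw [localScale, ← one_div_pow]
    exact le_mul_of_one_le_right (by positivity) hl
  exact ⟨h2, le_trans (by nlinarith) h2⟩

/-- With a large constant in the block length, the spared rate covers the cost of the ranks and
blocks overflow rarely. -/
theorem exists_block_constant {q : ℕ} (hq : 1 ≤ q) : ∃ C : ℝ, 1 ≤ C ∧ ∀ ε : ℝ, 0 < ε → ε < 1 / 2 →
    ∀ b : ℕ, C * localScale ε ≤ b → b ≤ C * localScale ε + 1 →
      q * Real.log (b + 1) + (q + 6) ≤ 44 / 100 * (b * ε) ∧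
      64 * ((b * q : ℝ) + 1) ^ 2 ≤ Real.exp (b * ε ^ 2 / (512 * q)) := by
  have hq' : (1 : ℝ) ≤ q := by exact_mod_cast hq
  have htend := tendsto_pow_const_div_const_pow_of_one_lt 2 (r := (2 : ℝ)) (by norm_num)
  obtain ⟨M, hM1, hM2⟩ := ((htend.eventually
    (gt_mem_nhds (show (0 : ℝ) < 1 / (2 ^ 34 * q ^ 4) by positivity))).and
    (eventually_ge_atTop ((3 * (5 * q + 6)) ^ 2))).exists
  have hMpos : (1 : ℝ) ≤ M := by
    have : 1 ≤ M := le_trans (Nat.one_le_pow _ _ (by omega)) hM2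
    exact_mod_cast this
  have hM2' : (3 * (5 * (q : ℝ) + 6)) ^ 2 ≤ M := by exact_mod_cast hM2
  have hM1' : 2 ^ 34 * (q : ℝ) ^ 4 * M ^ 2 ≤ 2 ^ M := by
    rw [div_lt_div_iff₀ (by positivity) (by positivity)] at hM1
    linarith
  set C : ℝ := 512 * q * M with hC
  have hCM : (M : ℝ) ≤ C := by rw [hC]; nlinarith
  refine ⟨C, hMpos.trans hCM, fun ε h0 h1 b hb hb' => ?_⟩
  obtain ⟨hls2, hls1⟩ := one_le_localScale h0 h1
  set X := 1 / ε with hX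
  have hXε : X * ε = 1 := by rw [hX]; field_simp
  have hX2 : 2 ≤ X := by
    rw [hX, le_div_iff₀ h0]; linarith
  have hC0 : 0 ≤ C := by linarith
  have hls : localScale ε = X ^ 2 * Real.logb 2 X := by rw [localScale, hX, one_div_pow]
  constructor
  · set y := √(b : ℝ) with hy
    have hyy : y * y = b := Real.mul_self_sqrt (Nat.cast_nonneg _)
    have hy0 : 0 ≤ y := Real.sqrt_nonneg _
    have hyX : 3 * (5 * q + 6) * X ≤ y := by
      apply Real.le_sqrt_of_sq_le
      calc (3 * (5 * (q : ℝ) + 6) * X) ^ 2 = (3 * (5 * (q : ℝ) + 6)) ^ 2 * X ^ 2 := by ring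
        _ ≤ C * localScale ε := by
            have := hM2'.trans hCM
            gcongr
        _ ≤ b := hb
    have hy1 : 1 ≤ y := by nlinarith
    have hyε : 3 * (5 * q + 6) ≤ y * ε := by
      calc 3 * (5 * (q : ℝ) + 6) = 3 * (5 * q + 6) * X * ε := by rw [mul_assoc, hXε, mul_one]
        _ ≤ y * ε := by gcongr
    have hlog : Real.log (b + 1) ≤ 4 * y := by
      have h2 := Real.log_le_rpow_div (x := (b : ℝ) + 1) (ε := 1 / 2) (by positivity) (by norm_num)
      rw [← Real.sqrt_eq_rpow] at h2
      have h3 : √((b : ℝ) + 1) ≤ 2 * y := by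
        rw [Real.sqrt_le_left (by positivity)]
        nlinarith
      linarith
    have h4 : q * Real.log (b + 1) ≤ q * (4 * y) := by gcongr
    have h5 : (3 * (5 * q + 6)) * y ≤ y * ε * y := by gcongr
    have h6 : (b : ℝ) * ε = y * ε * y := by rw [← hyy]; ring
    rw [h6]
    nlinarith
  · have hlogb : Real.log X ≤ Real.logb 2 X := by
      rw [Real.logb, le_div_iff₀ (Real.log_pos (by norm_num))]
      have := Real.log_two_lt_d9
      exact mul_le_of_le_one_right (Real.log_nonneg (by linarith)) (by linarith)
    have hexp : X ^ M ≤ Real.exp (b * ε ^ 2 / (512 * q)) := by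
      rw [← Real.exp_log (show 0 < X by linarith), ← Real.exp_nat_mul]
      apply Real.exp_le_exp.2
      rw [le_div_iff₀ (by positivity)]
      calc M * Real.log X * (512 * q) ≤ M * Real.logb 2 X * (512 * q) := by gcongr
        _ = C * (X ^ 2 * Real.logb 2 X) * ε ^ 2 := by
            rw [hC]
            linear_combination (-(512 * q * M * Real.logb 2 X) * (X * ε + 1)) * hXε
        _ ≤ b * ε ^ 2 := by rw [← hls]; gcongr
    refine le_trans ?_ hexp
    have hls3 : localScale ε ≤ 2 * X ^ 3 := by
      have h2 : Real.logb 2 X ≤ 2 * X := by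
        rw [Real.logb, div_le_iff₀ (Real.log_pos (by norm_num))]
        have h3 := Real.log_two_gt_d9
        have h4 := Real.log_le_sub_one_of_pos (show 0 < X by linarith)
        nlinarith
      rw [hls]
      calc X ^ 2 * Real.logb 2 X ≤ X ^ 2 * (2 * X) := by gcongr
        _ = 2 * X ^ 3 := by ring
    have hX3 : 1 ≤ X ^ 3 := one_le_pow₀ (by linarith)
    have hCX : 1 ≤ C * X ^ 3 := by nlinarith
    have hbq : (b * q : ℝ) + 1 ≤ 4 * (C * q * X ^ 3) := by
      have h2 : (b : ℝ) ≤ 2 * (C * X ^ 3) + 1 := by nlinarith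
      have h3 : (b * q : ℝ) ≤ (2 * (C * X ^ 3) + 1) * q := by gcongr
      nlinarith
    have hM6 : 6 ≤ M :=
      le_trans (by omega) ((Nat.le_self_pow two_ne_zero (3 * (5 * q + 6))).trans hM2)
    calc 64 * ((b * q : ℝ) + 1) ^ 2 ≤ 64 * (4 * (C * q * X ^ 3)) ^ 2 := by gcongr
      _ = (2 ^ 34 * (q : ℝ) ^ 4 * M ^ 2) * X ^ 6 / 2 ^ 6 := by rw [hC]; ring
      _ ≤ 2 ^ M * X ^ 6 / 2 ^ 6 := by gcongr
      _ = 2 ^ (M - 6) * X ^ 6 := by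
          rw [pow_sub₀ _ (by norm_num) hM6]; ring
      _ ≤ X ^ (M - 6) * X ^ 6 := by gcongr
      _ = X ^ M := by rw [← pow_add, Nat.sub_add_cancel hM6]

/-- The codeword has linearly many more records than there are blocks. -/
theorem exists_growth {b β : ℕ} (hb : 2 ≤ b) (hβ : 1 ≤ β) : ∃ a : ℝ, 0 < a ∧ ∀ᶠ n : ℕ in atTop,
    n / b + 1 + β ≤ n / (b - 1) ∧ ((n / b + 1 : ℕ) : ℝ) ≤ Real.exp (a * n) ∧
      Real.exp (a * n) ≤ (1 + 1 / (β : ℝ)) ^ (n / (b - 1) - n / b - β) := by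
  have hβ' : (1 : ℝ) ≤ β := by exact_mod_cast hβ
  have hb' : (2 : ℝ) ≤ b := by exact_mod_cast hb
  set θ : ℝ := 1 + 1 / (β : ℝ) with hθ
  have hθ1 : 1 < θ := by
    have : 0 < 1 / (β : ℝ) := by positivity
    rw [hθ]; linarith
  have hlog : 0 < Real.log θ := Real.log_pos hθ1
  set a : ℝ := Real.log θ / (2 * b ^ 2) with ha
  have ha0 : 0 < a := by positivity
  refine ⟨a, ha0, ?_⟩
  have h1 : ∀ᶠ n : ℕ in atTop, (n : ℝ) + 1 ≤ Real.exp (a * n) := by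
    have h2 := Real.tendsto_pow_mul_exp_neg_atTop_nhds_zero 1
    have h3 : Tendsto (fun n : ℕ => a * (n : ℝ)) atTop atTop :=
      tendsto_natCast_atTop_atTop.const_mul_atTop ha0
    filter_upwards [(h2.comp h3).eventually (gt_mem_nhds (show 0 < a / 2 by positivity)),
      eventually_ge_atTop 1] with n hn hn1
    simp only [Function.comp, pow_one] at hn
    rw [Real.exp_neg, ← div_eq_mul_inv, div_lt_iff₀ (Real.exp_pos _)] at hn
    have hn1' : (1 : ℝ) ≤ n := by exact_mod_cast hn1
    have h4 : a * (2 * n) < a * Real.exp (a * n) := by linarith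
    have h5 := lt_of_mul_lt_mul_left h4 ha0.le
    linarith
  filter_upwards [h1, eventually_ge_atTop (4 * b ^ 2 * (β + 2))] with n hn1 hn
  have hu : n / b * b ≤ n := Nat.div_mul_le_self n b
  have hu' : n < (n / b + 1) * b := Nat.lt_mul_of_div_lt (Nat.lt_succ_self _) (by omega)
  set w := n / (2 * b ^ 2) with hw
  have hw1 : w * (2 * b ^ 2) ≤ n := Nat.div_mul_le_self _ _
  have hw2 : n < (w + 1) * (2 * b ^ 2) := Nat.lt_mul_of_div_lt (Nat.lt_succ_self _) (by positivity)
  clear_value w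
  have hE : n / b + (w + 1 + β) ≤ n / (b - 1) := by
    obtain ⟨e, rfl⟩ : ∃ e, b = e + 1 := ⟨b - 1, by omega⟩
    rw [Nat.le_div_iff_mul_le (by omega), Nat.add_sub_cancel]
    set u := n / (e + 1)
    have h5 : (w + 1 + β) * e ≤ u := by
      refine Nat.le_of_mul_le_mul_right (c := e + 1) ?_ (by omega)
      have h6 : (w + 1 + β) * e * (e + 1) ≤ (w + 1 + β) * (e + 1) ^ 2 := by
        rw [mul_assoc, sq]
        exact Nat.mul_le_mul_left _ (Nat.mul_le_mul_right _ (Nat.le_succ e))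
      have h7 : e + 1 ≤ (e + 1) ^ 2 := Nat.le_self_pow two_ne_zero _
      have h8 : (w + 1 + β) * (e + 1) ^ 2 * 2 = w * (2 * (e + 1) ^ 2) +
        2 * ((e + 1) ^ 2 * (β + 1)) := by ring
      have h9 : 4 * (e + 1) ^ 2 * (β + 2) = 4 * ((e + 1) ^ 2 * (β + 1)) + 4 * (e + 1) ^ 2 := by
        ring
      have h10 : (u + 1) * (e + 1) = u * (e + 1) + (e + 1) := by ring
      omega
    rw [Nat.add_mul]
    have h11 : u * (e + 1) = u * e + u := by ring
    omega
  refine ⟨(show n / b + 1 + β ≤ n / b + (w + 1 + β) by omega).trans hE, ?_, ?_⟩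
  · refine le_trans ?_ hn1
    have : n / b ≤ n := Nat.div_le_self _ _
    exact_mod_cast Nat.succ_le_succ this
  · have h7 : (n : ℝ) / (2 * b ^ 2) ≤ ((w + 1 : ℕ) : ℝ) := by
      rw [div_le_iff₀ (by positivity)]
      exact_mod_cast hw2.le
    calc Real.exp (a * n) = Real.exp (n / (2 * b ^ 2) * Real.log θ) := by
          rw [ha]; ring_nf
      _ ≤ Real.exp (((w + 1 : ℕ) : ℝ) * Real.log θ) := by gcongr
      _ = θ ^ (w + 1) := by rw [Real.exp_nat_mul, Real.exp_log (by linarith)]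
      _ ≤ _ := pow_le_pow_right₀ hθ1.le (by omega)

/-- An exponentially small probability is far below the bound that is asked for. -/
theorem eventually_exp_neg_le {a : ℝ} (ha : 0 < a) : ∀ᶠ n : ℕ in atTop,
    Real.exp (-(a * n)) ≤ (2 : ℝ) ^ (-(2 : ℝ) ^ (1 * √(Real.logb 2 n))) := by
  obtain ⟨k, hk⟩ := exists_nat_ge (1 / a ^ 2)
  filter_upwards [eventually_ge_atTop 16, eventually_ge_atTop k] with n hn hnk
  have hn' : (16 : ℝ) ≤ n := by exact_mod_cast hn
  have hlog : 4 ≤ Real.logb 2 n := by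
    rw [Real.le_logb_iff_rpow_le (by norm_num) (by linarith)]
    norm_num
    exact hn
  set y := √(Real.logb 2 n) with hy
  have hyy : y * y = Real.logb 2 n := Real.mul_self_sqrt (by linarith)
  have hy2 : 2 ≤ y := Real.le_sqrt_of_sq_le (by linarith)
  have h1 : (2 : ℝ) ^ (1 * y) ≤ √n := by
    apply Real.le_sqrt_of_sq_le
    rw [← Real.rpow_natCast, ← Real.rpow_mul (by norm_num)]
    calc (2 : ℝ) ^ (1 * y * (2 : ℕ)) ≤ 2 ^ Real.logb 2 n :=
          Real.rpow_le_rpow_of_exponent_le (by norm_num) (by push_cast; nlinarith)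
      _ = n := Real.rpow_logb (by norm_num) (by norm_num) (by linarith)
  have h2 : √(n : ℝ) ≤ a * n := by
    have h3 : √(n : ℝ) * √n = n := Real.mul_self_sqrt (by linarith)
    have h4 : 1 / a ≤ √(n : ℝ) := by
      apply Real.le_sqrt_of_sq_le
      rw [one_div_pow]
      exact hk.trans (by exact_mod_cast hnk)
    rw [div_le_iff₀ ha] at h4
    have := Real.sqrt_nonneg (n : ℝ)
    nlinarith
  calc Real.exp (-(a * n)) ≤ Real.exp (-(2 : ℝ) ^ (1 * y)) := Real.exp_le_exp.2 (by linarith)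
    _ ≤ Real.exp (Real.log 2 * -(2 : ℝ) ^ (1 * y)) := by
        apply Real.exp_le_exp.2
        have h5 := Real.log_two_lt_d9
        have h6 : (0 : ℝ) < 2 ^ (1 * y) := by positivity
        nlinarith
    _ = _ := (Real.rpow_def_of_pos (by norm_num) _).symm

namespace Coder

/-- The properties of the parameters that make the block scheme work at all rates `R ≥ ε`: blocks
are long enough for `ε`, sequences of at least `n₀` symbols are long enough for the block length,
and words are long enough. -/
structure Suitable (D : Coder) (ε : ℝ) (n₀ κ : ℕ) (a : ℝ) : Prop where
  numbering : D.Numbering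
  rankBound : D.RankBound
  rank_lt : ∀ v < D.q ^ D.b, D.rank v < D.q ^ D.b
  unrank_lt : ∀ v, D.unrank v < D.q ^ D.b
  unrank_eq_zero : ∀ v, D.q ^ D.b ≤ v → D.unrank v = 0
  q_pos : 1 ≤ D.q
  two_le_b : 2 ≤ D.b
  β_eq : D.β = D.b * D.q
  lmax_eq : D.lmax = D.b * (D.q + 1)
  spared : D.q * Real.log (D.b + 1) + (D.q + 6) ≤ 44 / 100 * (D.b * ε)
  rare : 64 * ((D.b * D.q : ℝ) + 1) ^ 2 ≤ Real.exp (D.b * ε ^ 2 / (512 * D.q))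
  one_le : 1 ≤ n₀
  lt_words : ∀ n, 1 ≤ n → n₀ < 2 ^ (κ * Nat.size n)
  words : ∀ n, 1 ≤ n → 16 * ((2 ^ (4 * (D.b * (D.q + 1)) + 4) * n) *
    (2 ^ (4 * (D.b * (D.q + 1)) + 4) * n)) ≤ 2 ^ (κ * Nat.size n)
  slack : ∀ n, n₀ ≤ n → n / D.b + 1 + D.β ≤ n / (D.b - 1)
  blocks_le : ∀ n, n₀ ≤ n → ((n / D.b + 1 : ℕ) : ℝ) ≤
    (1 + 1 / (D.β : ℝ)) ^ (n / (D.b - 1) - n / D.b - D.β)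
  growth_pos : 0 < a
  growth : ∀ n : ℕ, n₀ ≤ n →
    Real.exp (a * n) ≤ (1 + 1 / (D.β : ℝ)) ^ (n / (D.b - 1) - n / D.b - D.β)

/-- Suitable parameters for `ε`, with block length proportional to `localScale ε`. -/
theorem exists_suitable {q : ℕ} (hq : 1 ≤ q) : ∃ C : ℝ, 1 ≤ C ∧ ∀ ε : ℝ,
    ∃ (b : ℕ) (rank unrank : ℕ → ℕ) (n₀ κ : ℕ) (a : ℝ), 0 < ε → ε < 1 / 2 →
      b ≤ C * localScale ε ∧
      Suitable ⟨b, q, b * q, b * (q + 1), rank, unrank⟩ ε n₀ κ a := by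
  obtain ⟨C, hC1, hC⟩ := exists_block_constant hq
  refine ⟨C + 1, by linarith, fun ε => ?_⟩
  by_cases hε : 0 < ε ∧ ε < 1 / 2
  swap
  · exact ⟨0, id, id, 0, 0, 0, fun h0 h1 => absurd ⟨h0, h1⟩ hε⟩
  obtain ⟨hls2, hls1⟩ := one_le_localScale hε.1 hε.2
  have hC0 : 0 ≤ C * localScale ε := by positivity
  set b := ⌈C * localScale ε⌉₊ with hb
  have hb1 : C * localScale ε ≤ b := Nat.le_ceil _
  have hb2 : (b : ℝ) ≤ C * localScale ε + 1 := (Nat.ceil_lt_add_one hC0).le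
  obtain ⟨hspared, hrare⟩ := hC ε hε.1 hε.2 b hb1 hb2
  have hX : 2 ≤ 1 / ε := by
    rw [le_div_iff₀ hε.1]; linarith [hε.2]
  have hb2' : 2 ≤ b := by
    have : (2 : ℝ) ≤ b := by nlinarith
    exact_mod_cast this
  have hβ : 1 ≤ b * q := Nat.mul_pos (by omega) hq
  obtain ⟨rank, unrank, h1, h2, h3, h4, h5, h6⟩ := exists_rank hq b
  obtain ⟨a, ha, hgrow⟩ := exists_growth hb2' hβ
  obtain ⟨n₁, hn₁⟩ := eventually_atTop.1 hgrow
  set n₀ := max n₁ 1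
  set B := 4 * (b * (q + 1)) + 4
  have hsize : ∀ n, 1 ≤ n → 1 ≤ Nat.size n := fun n hn => Nat.size_pos.2 hn
  refine ⟨b, rank, unrank, n₀, 2 * B + 6 + n₀, a, fun _ _ => ⟨?_, ?_⟩⟩
  · rw [add_mul]; linarith
  refine ⟨⟨h4, h5, ?_⟩, ?_, h1, h2, h3, hq, hb2', rfl, rfl, hspared, hrare, le_max_right _ _,
    fun n hn => ?_, fun n hn => ?_, fun n hn => ?_, fun n hn => ?_, ha, fun n hn => ?_⟩
  · calc q ^ b ≤ (2 ^ q) ^ b := Nat.pow_le_pow_left Nat.lt_two_pow_self.le _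
      _ = 2 ^ (b * q) := by rw [← pow_mul, mul_comm]
  · intro w
    set d : ℕ → ℕ := fun u => if h : u < b then (w ⟨u, h⟩ : ℕ) else 0 with hd
    have hdq : ∀ u, d u < q := fun u => by
      simp only [hd]
      split
      · exact Fin.is_lt _
      · exact hq
    refine (h6 _ (digitsVal_lt hdq b)).trans_eq ?_
    refine congrArg (fun w => (b + 1) ^ q * (typeClass w).card) (funext fun j => Fin.ext ?_)
    change digitsVal q d b / q ^ (j : ℕ) % q = w j
    rw [digitsVal_digit hdq j.2]
    exact dif_pos j.2
  · calc n₀ < 2 ^ n₀ := Nat.lt_two_pow_self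
      _ ≤ _ := Nat.pow_le_pow_right (by norm_num) (by nlinarith [hsize n hn])
  · have h7 : n ≤ 2 ^ Nat.size n := (Nat.lt_size_self n).le
    calc 16 * ((2 ^ B * n) * (2 ^ B * n))
        ≤ 16 * ((2 ^ B * 2 ^ Nat.size n) * (2 ^ B * 2 ^ Nat.size n)) := by gcongr
      _ = 2 ^ (2 * B + 4 + 2 * Nat.size n) := by ring
      _ ≤ _ := Nat.pow_le_pow_right (by norm_num) (by nlinarith [hsize n hn])
  · exact (hn₁ n ((le_max_left _ _).trans hn)).1
  · obtain ⟨-, h8, h9⟩ := hn₁ n ((le_max_left _ _).trans hn)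
    exact h8.trans h9
  · exact (hn₁ n ((le_max_left _ _).trans hn)).2.2

namespace Suitable

variable {D : Coder} {ε a R : ℝ} {n₀ κ n : ℕ}

/-- The payload length is the record length minus the three extra bits, and the record length is
about `(b - 1) R`. -/
theorem le_recordLength (h : Suitable D ε n₀ κ a) (hR : 0 ≤ R) (hn : n₀ ≤ n) :
    ((D.b : ℝ) - 1) * R - 2 ≤ (⌊n * R⌋₊ / (n / (D.b - 1)) : ℕ) := by
  have hb := h.two_le_b
  have hs := h.slack n hn
  set T := n / (D.b - 1)
  set L := ⌊n * R⌋₊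
  have hT1 : T * (D.b - 1) ≤ n := Nat.div_mul_le_self _ _
  have hT0 : 0 < T := by
    have := Nat.zero_le (n / D.b); omega
  have hL : (n : ℝ) * R < L + 1 := Nat.lt_floor_add_one _
  have hdiv : L + 1 ≤ (L / T + 1) * T := Nat.lt_mul_of_div_lt (Nat.lt_succ_self _) hT0
  have hdiv' : (L : ℝ) + 1 ≤ ((L / T : ℕ) + 1) * T := by exact_mod_cast hdiv
  have hT1' : (T : ℝ) * (D.b - 1) ≤ n := by
    rw [← Nat.cast_one, ← Nat.cast_sub (by omega)]
    exact_mod_cast hT1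
  have hT0' : (0 : ℝ) < T := by exact_mod_cast hT0
  have h1 : T * (((D.b : ℝ) - 1) * R) ≤ T * ((L / T : ℕ) + 1) := by
    calc T * (((D.b : ℝ) - 1) * R) = T * (D.b - 1) * R := by ring
      _ ≤ n * R := by gcongr
      _ ≤ T * ((L / T : ℕ) + 1) := by linarith
  have h2 := le_of_mul_le_mul_left h1 hT0'
  linarith

theorem three_le_recordLength (h : Suitable D ε n₀ κ a) (hε : 0 < ε) (hR : ε ≤ R) (hn : n₀ ≤ n)
    (hε1 : ε < 1 / 2) : 3 ≤ ⌊n * R⌋₊ / (n / (D.b - 1)) := by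
  have h1 := h.le_recordLength (R := R) (by linarith) hn
  have h2 := h.spared
  have hb : (2 : ℝ) ≤ D.b := by exact_mod_cast h.two_le_b
  have hq : (1 : ℝ) ≤ D.q := by exact_mod_cast h.q_pos
  have h3 : 0 ≤ D.q * Real.log (D.b + 1) :=
    mul_nonneg (by linarith) (Real.log_nonneg (by linarith))
  have h4 : ((D.b : ℝ) - 1) * ε ≤ ((D.b : ℝ) - 1) * R :=
    mul_le_mul_of_nonneg_left hR (by linarith)
  have : (3 : ℝ) ≤ (⌊n * R⌋₊ / (n / (D.b - 1)) : ℕ) := by linarith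
  exact_mod_cast this

/-- The payload length is at most `lmax`, the range of the table of powers of two. -/
theorem payload_le (h : Suitable D ε n₀ κ a) (hn : n₀ ≤ n) {L : ℕ} (hL : L ≤ n * (D.q + 1)) :
    L / (n / (D.b - 1)) - 3 ≤ D.lmax := by
  have hb := h.two_le_b
  have hs := h.slack n hn
  refine (Nat.sub_le _ _).trans (Nat.div_le_of_le_mul ?_)
  have h1 : n < (n / D.b + 1) * D.b := Nat.lt_mul_of_div_lt (Nat.lt_succ_self _) (by omega)
  rw [h.lmax_eq, ← mul_assoc]
  refine hL.trans (Nat.mul_le_mul_right _ (h1.le.trans (Nat.mul_le_mul_right _ (by omega))))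

/-- All numbers that the programs compute fit into words. -/
theorem room (h : Suitable D ε n₀ κ a) (hε : 0 < ε) (hε1 : ε < 1 / 2) (hR : ε ≤ R)
    (hR' : R ≤ Real.logb 2 D.q + ε) (hn : n₀ ≤ n) :
    Room D (2 ^ (κ * Nat.size n)) n ⌊n * R⌋₊ (⌊n * R⌋₊ / (n / (D.b - 1)) - 3)
      (2 ^ (4 * (D.b * (D.q + 1)) + 4) * n) := by
  have hn1 := h.one_le.trans hn
  have hb := h.two_le_b
  have hq := h.q_pos
  have h3 := h.three_le_recordLength hε hR hn hε1
  have hs := h.slack n hn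
  have hL : ⌊n * R⌋₊ ≤ n * (D.q + 1) := by
    apply Nat.floor_le_of_le
    push_cast
    have h4 : Real.logb 2 D.q ≤ D.q := by
      rw [Real.logb_le_iff_le_rpow (by norm_num) (by exact_mod_cast hq), Real.rpow_natCast]
      exact_mod_cast Nat.lt_two_pow_self.le
    gcongr
    linarith
  have hrec : ⌊n * R⌋₊ / (n / (D.b - 1)) - 3 + 3 = ⌊n * R⌋₊ / (n / (D.b - 1)) :=
    Nat.sub_add_cancel h3
  set e := D.b * (D.q + 1) with he
  have hbq : D.b * D.q ≤ e := Nat.mul_le_mul_left _ (by omega)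
  have hbe : D.b ≤ e := Nat.le_mul_of_pos_right _ (by omega)
  have hqe : D.q ≤ e := (Nat.le_succ _).trans (Nat.le_mul_of_pos_left _ (by omega))
  have he2 : e < 2 ^ e := Nat.lt_two_pow_self
  have hpow : (2 : ℕ) ^ (4 * e + 4) = 16 * (2 ^ e * 2 ^ e * (2 ^ e * 2 ^ e)) := by ring
  have hle : ∀ x, x ≤ 16 * 2 ^ e → ∀ m, 1 ≤ m → x ≤ 2 ^ (4 * e + 4) * m := fun x hx m hm => by
    have h5 : 1 ≤ 2 ^ e := Nat.one_le_two_pow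
    have h6 : (2 : ℕ) ^ (e + 4) ≤ 2 ^ (4 * e + 4) := Nat.pow_le_pow_right (by norm_num) (by omega)
    rw [pow_add] at h6
    exact (hx.trans (by omega)).trans (Nat.le_mul_of_pos_right _ hm)
  refine ⟨h.words n hn1, hle 2 (by omega) n hn1, hb, hq, ?_, ?_, h.payload_le hn hL, ?_,
    hrec.symm, ?_, hle _ (by omega) n hn1, hle _ (by omega) n hn1, ?_, ?_, ?_, h.rank_lt,
    h.unrank_lt, h.unrank_eq_zero⟩
  · exact Nat.le_mul_of_pos_left _ (by positivity)
  · refine hL.trans ?_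
    rw [mul_comm]
    refine Nat.mul_le_mul_right _ ?_
    have := hle (D.q + 1) (by omega) 1 le_rfl
    omega
  · rw [h.lmax_eq, ← he]
    exact hle _ (by omega) n hn1
  · rw [hrec]
    refine (Nat.mul_le_mul_right _ (by omega)).trans (Nat.mul_div_le _ _)
  · refine hle _ (le_trans h.numbering.pow_le ?_) n hn1
    rw [h.β_eq]
    have := Nat.pow_le_pow_right (show 0 < 2 by norm_num) hbq
    omega
  · rw [h.β_eq]
    refine hle _ ?_ n hn1
    have := Nat.pow_le_pow_right (show 0 < 2 by norm_num) hbq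
    omega
  · rw [h.β_eq]
    have h7 : n / D.b + 1 ≤ 2 * n := by
      have := Nat.div_le_self n D.b; omega
    have h8 : (D.b * D.q + 1) * (n / D.b + 1) ≤ (e + 1) * (2 * n) :=
      Nat.mul_le_mul (by omega) h7
    have h9 : e ≤ e * n := Nat.le_mul_of_pos_right _ hn1
    have h10 : (e + 1) * (2 * n) + e * n ≤ 2 ^ (4 * e + 4) * n := by
      have h11 := hle (3 * e + 2) (by omega) 1 le_rfl
      rw [mul_one] at h11
      have := Nat.mul_le_mul_right n h11
      linarith
    omega

variable {𝒳 : Type*} [Fintype 𝒳] {p : 𝒳 → ℝ} {sym : 𝒳 ≃ Fin D.q}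

/-- The source coding estimate: at every rate `R ≥ H(p) + ε` overflows are rare. The exponent `t` of
the Markov inequality is proportional to `ε`, which balances its gain `t ε b` against the loss
`t ^ 2 b`. -/
theorem rare_overflow (h : Suitable D ε n₀ κ a) (hε : 0 < ε) (hε1 : ε < 1 / 2)
    (hp : p ∈ stdSimplex ℝ 𝒳) (hR : entropyBits p + ε ≤ R) (hn : n₀ ≤ n) :
    Rare D sym p n (⌊n * R⌋₊ / (n / (D.b - 1)) - 3) := by
  have hb : (2 : ℝ) ≤ D.b := by exact_mod_cast h.two_le_b
  have hq : (1 : ℝ) ≤ D.q := by exact_mod_cast h.q_pos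
  have hcard : Fintype.card 𝒳 = D.q := (Fintype.card_congr sym).trans (Fintype.card_fin _)
  set E := ∑ x, Real.negMulLog (p x) with hE
  have hle : ∀ x, p x ≤ 1 := fun x => by
    rw [← hp.2]
    exact Finset.single_le_sum (fun i _ => hp.1 i) (Finset.mem_univ x)
  have hE0 : 0 ≤ E := Finset.sum_nonneg fun x _ => Real.negMulLog_nonneg (hp.1 x) (hle x)
  have hEq : E ≤ D.q := by
    have h1 : ∀ x, Real.negMulLog (p x) ≤ 1 := fun x =>
      (Real.negMulLog_le_one_sub_self (hp.1 x)).trans (by linarith [hp.1 x])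
    calc E ≤ ∑ _x : 𝒳, (1 : ℝ) := Finset.sum_le_sum fun x _ => h1 x
      _ = D.q := by rw [Finset.sum_const, Finset.card_univ, hcard]; simp
  have hl2 := Real.log_two_gt_d9
  have hl2' := Real.log_two_lt_d9
  have hH : entropyBits p * Real.log 2 = E := by
    rw [entropyBits, ← Finset.sum_div, div_mul_cancel₀ _ (by linarith)]
  have hH0 : 0 ≤ entropyBits p := by
    rw [entropyBits, ← Finset.sum_div]
    exact div_nonneg hE0 (by linarith)
  set l := ⌊n * R⌋₊ / (n / (D.b - 1)) - 3 with hl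
  have h3 := h.three_le_recordLength hε (by linarith : ε ≤ R) hn hε1
  have hlR : ((D.b : ℝ) - 1) * (entropyBits p + ε) - 5 ≤ l := by
    have h4 := h.le_recordLength (R := R) (by linarith) hn
    rw [hl, Nat.cast_sub h3]
    have h5 : ((D.b : ℝ) - 1) * (entropyBits p + ε) ≤ ((D.b : ℝ) - 1) * R :=
      mul_le_mul_of_nonneg_left hR (by linarith)
    push_cast
    linarith
  -- the payload exceeds the information content of a typical block and the cost of the rank
  have hpay : D.q * Real.log (D.b + 1) + D.b * (E + ε / 4) ≤ l * Real.log 2 := by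
    have h6 := mul_le_mul_of_nonneg_right hlR (by linarith : 0 ≤ Real.log 2)
    have h7 : (((D.b : ℝ) - 1) * (entropyBits p + ε) - 5) * Real.log 2 =
        D.b * E + D.b * ε * Real.log 2 - E - (ε + 5) * Real.log 2 := by
      rw [← hH]; ring
    have h8 : (D.b : ℝ) * ε * (69 / 100) ≤ D.b * ε * Real.log 2 := by
      gcongr
      linarith
    have h9 := h.spared
    nlinarith
  set t := ε / (64 * D.q) with ht
  have ht0 : 0 < t := by positivity
  have htq : t * D.q = ε / 64 := by rw [ht]; field_simp
  have ht1 : t ≤ 1 / 2 := by nlinarith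
  have hbound : D.overflowProb sym p l ≤ Real.exp (-(D.b * ε ^ 2 / (512 * D.q))) := by
    refine (overflowProb_le h.rankBound hp ht0 ht1).trans ?_
    have h10 : (((D.b : ℝ) + 1) ^ D.q / 2 ^ l) ^ t =
        Real.exp ((D.q * Real.log (D.b + 1) - l * Real.log 2) * t) := by
      rw [Real.rpow_def_of_pos (by positivity), Real.log_div (by positivity) (by positivity),
        Real.log_pow, Real.log_pow]
    have h11 : (∑ x, p x ^ (1 - t)) ^ D.b ≤ Real.exp (D.b * (t * E + 8 * D.q * t ^ 2)) := by
      rw [Real.exp_nat_mul]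
      refine pow_le_pow_left₀ (Finset.sum_nonneg fun x _ => Real.rpow_nonneg (hp.1 x) _) ?_ _
      rw [← hcard]
      exact sum_rpow_one_sub_le hp ht0 ht1
    calc _ ≤ Real.exp ((D.q * Real.log (D.b + 1) - l * Real.log 2) * t) *
          Real.exp (D.b * (t * E + 8 * D.q * t ^ 2)) := by
          rw [h10]; gcongr
      _ = Real.exp ((D.q * Real.log (D.b + 1) - l * Real.log 2) * t +
          D.b * (t * E + 8 * D.q * t ^ 2)) := (Real.exp_add _ _).symm
      _ ≤ _ := by
          apply Real.exp_le_exp.2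
          have h12 := mul_le_mul_of_nonneg_right hpay ht0.le
          have h13 : (D.b : ℝ) * ε ^ 2 / (512 * D.q) = D.b * (t * ε) / 8 := by
            rw [ht]; field_simp; ring
          have h14 : (D.b : ℝ) * (8 * D.q * t ^ 2) = D.b * (t * ε) / 8 := by
            rw [show (D.b : ℝ) * (8 * D.q * t ^ 2) = D.b * (8 * t * (t * D.q)) by ring, htq]; ring
          rw [h13]
          linarith
  refine ⟨hp, ?_, ?_, h.slack n hn, h.blocks_le n hn⟩
  · rw [h.β_eq]
    exact Nat.mul_pos (by have := h.two_le_b; omega) h.q_pos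
  · refine hbound.trans ?_
    rw [Real.exp_neg, ← one_div, h.β_eq]
    push_cast
    exact one_div_le_one_div_of_le (by positivity) h.rare

end Suitable

end Coder

namespace Coder

/-! ### The scheme and its performance -/

variable {𝒳 : Type*} [Nonempty 𝒳] {D : Coder} {ε a R : ℝ} {n₀ κ n s i : ℕ}

/-- The scheme for all blocklengths: short sequences are not stored at all. -/
noncomputable def scheme (D : Coder) (n₀ : ℕ) (sym : 𝒳 ≃ Fin D.q) (n L : ℕ) :
    CompressionScheme 𝒳 n L :=
  if n < n₀ then D.trivialScheme sym n L else D.blockScheme sym (L / (n / (D.b - 1)) - 3) n L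

theorem scheme_of_lt (sym : 𝒳 ≃ Fin D.q) (hn : n < n₀) (L : ℕ) :
    D.scheme n₀ sym n L = D.trivialScheme sym n L := if_pos hn

theorem scheme_of_le (sym : 𝒳 ≃ Fin D.q) (hn : n₀ ≤ n) (L : ℕ) :
    D.scheme n₀ sym n L = D.blockScheme sym (L / (n / (D.b - 1)) - 3) n L := if_neg (not_lt.2 hn)

namespace Suitable

theorem implements (h : Suitable D ε n₀ κ a) (hε : 0 < ε) (hε1 : ε < 1 / 2) (hR : ε ≤ R)
    (hR' : R ≤ Real.logb 2 D.q + ε) (hn : 1 ≤ n) (sym : 𝒳 ≃ Fin D.q) :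
    Implements sym (D.algorithms n₀ κ) (D.scheme n₀ sym n ⌊n * R⌋₊) := by
  rcases lt_or_ge n n₀ with hlt | hle
  · rw [scheme_of_lt sym hlt]
    exact implements_trivialScheme hlt (h.lt_words n hn)
  · rw [scheme_of_le sym hle]
    exact implements_blockScheme (h.room hε hε1 hR hR' hle) h.numbering hle (h.lt_words n hn) hn

theorem codingTime_le (h : Suitable D ε n₀ κ a) (hε : 0 < ε) (hε1 : ε < 1 / 2) (hR0 : ε ≤ R)
    (hR' : R ≤ Real.logb 2 D.q + ε) (sym : 𝒳 ≃ Fin D.q) (hn : 2 ≤ n) (x : Fin n → 𝒳) :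
    (codingTime sym (D.algorithms n₀ κ) (D.scheme n₀ sym n ⌊n * R⌋₊) x : ℝ) ≤
      (12 + 2 * (D.updateTime + D.decodeTime)) * (n * Real.logb 2 n) := by
  have hn1 : 1 ≤ n := by omega
  have hlog : 1 ≤ Real.logb 2 n := by
    rw [Real.le_logb_iff_rpow_le (by norm_num) (by positivity), Real.rpow_one]
    exact_mod_cast hn
  have key : codingTime sym (D.algorithms n₀ κ) (D.scheme n₀ sym n ⌊n * R⌋₊) x ≤
      (12 + 2 * (D.updateTime + D.decodeTime)) * n := by
    rcases lt_or_ge n n₀ with hlt | hle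
    · rw [codingTime_of_lt hlt (h.lt_words n hn1)]
      exact (Nat.le_add_right _ _).trans (Nat.le_mul_of_pos_right _ hn1)
    · rw [scheme_of_le sym hle]
      refine (Coder.codingTime_le (h.room hε hε1 hR0 hR' hle) h.numbering hle
        (h.lt_words n hn1) hn1 x).trans ?_
      have h1 : n / D.b + 2 ≤ 2 * n := by
        have h2 : n / D.b ≤ n / 2 := Nat.div_le_div_left h.two_le_b (by norm_num)
        omega
      calc 12 + (D.updateTime + D.decodeTime) * (n / D.b + 2)
          ≤ 12 * n + (D.updateTime + D.decodeTime) * (2 * n) := by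
            gcongr
            omega
        _ = _ := by ring
  calc (codingTime sym (D.algorithms n₀ κ) (D.scheme n₀ sym n ⌊n * R⌋₊) x : ℝ)
      ≤ (12 + 2 * (D.updateTime + D.decodeTime)) * n := by exact_mod_cast key
    _ ≤ _ := by
        gcongr
        exact le_mul_of_one_le_right (by positivity) hlog

variable [Fintype 𝒳] {p : 𝒳 → ℝ}

theorem eventually_errorProb_le (h : Suitable D ε n₀ κ a) (hε : 0 < ε) (hε1 : ε < 1 / 2)
    (hp : p ∈ stdSimplex ℝ 𝒳) (hR : entropyBits p + ε ≤ R) (hR0 : ε ≤ R)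
    (hR' : R ≤ Real.logb 2 D.q + ε) (sym : 𝒳 ≃ Fin D.q) : ∀ᶠ n : ℕ in atTop,
      errorProb p (D.scheme n₀ sym n ⌊n * R⌋₊) ≤
        (2 : ℝ) ^ (-(2 : ℝ) ^ (1 * √(Real.logb 2 n))) := by
  filter_upwards [eventually_ge_atTop n₀, eventually_exp_neg_le h.growth_pos] with n hn hn'
  rw [scheme_of_le sym hn]
  refine le_trans ?_ hn'
  refine ((h.rare_overflow (sym := sym) hε hε1 hp hR hn).errorProb_le
    (h.room hε hε1 hR0 hR' hn) h.numbering).trans ?_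
  rw [Real.exp_neg]
  exact inv_anti₀ (Real.exp_pos _) (h.growth n hn)

/-- The payload of a record is bounded by the block length. -/
theorem payload_le_mul (h : Suitable D ε n₀ κ a) (hε : 0 < ε) (hε1 : ε < 1 / 2) (hR : ε ≤ R)
    (hR' : R ≤ Real.logb 2 D.q + ε) (hn : n₀ ≤ n) :
    ((⌊n * R⌋₊ / (n / (D.b - 1)) - 3 : ℕ) : ℝ) ≤ D.b * (D.q + 1) := by
  have := (h.room hε hε1 hR hR' hn).l_le
  rw [h.lmax_eq] at this
  exact_mod_cast this

theorem blocks_bounds (h : Suitable D ε n₀ κ a) (hs : 1 ≤ s) (i : ℕ) :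
    (s : ℝ) ≤ D.b * D.blocks i s ∧ (D.b : ℝ) * D.blocks i s ≤ s + 2 * D.b ∧
      (D.blocks i s : ℝ) ≤ s + 2 := by
  have hb : (2 : ℝ) ≤ D.b := by exact_mod_cast h.two_le_b
  have h1 : (s : ℝ) ≤ D.b * D.blocks i s := by exact_mod_cast le_mul_blocks h.two_le_b hs
  have h2 : (D.b : ℝ) * D.blocks i s ≤ s + 2 * D.b := by
    exact_mod_cast mul_blocks_le h.two_le_b hs
  refine ⟨h1, h2, ?_⟩
  have hs0 : (0 : ℝ) ≤ s := Nat.cast_nonneg _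
  nlinarith

theorem avgLocalDecodability_le (h : Suitable D ε n₀ κ a) (hε : 0 < ε) (hε1 : ε < 1 / 2)
    (hp : p ∈ stdSimplex ℝ 𝒳) (hR : entropyBits p + ε ≤ R) (hR0 : ε ≤ R)
    (hR' : R ≤ Real.logb 2 D.q + ε) (sym : 𝒳 ≃ Fin D.q) (hs : 1 ≤ s) (hsn : s ≤ n) :
    avgLocalDecodability (D.algorithms n₀ κ) p (D.scheme n₀ sym n ⌊n * R⌋₊) s ≤
      3 + (s + 2 * D.b) * (2 * D.q + 2) := by
  have hn1 : 1 ≤ n := hs.trans hsn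
  have hb : (2 : ℝ) ≤ D.b := by exact_mod_cast h.two_le_b
  refine ciSup_le fun i => ?_
  have hi : (i : ℕ) + s ≤ n := by omega
  rcases lt_or_ge n n₀ with hlt | hle
  · simp only [(locRun_of_lt hlt (h.lt_words n hn1) _ _ _ _).1, Nat.cast_zero,
      iidMean_const hp]
    positivity
  · rw [scheme_of_le sym hle]
    refine ((h.rare_overflow hε hε1 hp hR hle).mean_locRun (h.room hε hε1 hR0 hR' hle) hle
      (h.lt_words n hn1) hi hs).1.trans ?_
    obtain ⟨-, hJ, -⟩ := h.blocks_bounds hs (i : ℕ)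
    have hl := h.payload_le_mul hε hε1 hR0 hR' hle
    set l := ⌊n * R⌋₊ / (n / (D.b - 1)) - 3
    have h1 : (1 : ℝ) + l + D.β ≤ D.b * (2 * D.q + 2) := by
      rw [h.β_eq]
      push_cast
      linarith
    calc (3 : ℝ) + D.blocks i s * (1 + l + D.β)
        ≤ 3 + D.blocks i s * (D.b * (2 * D.q + 2)) := by gcongr
      _ = 3 + D.b * D.blocks i s * (2 * D.q + 2) := by ring
      _ ≤ _ := by gcongr

theorem avgUpdateEfficiency_le (h : Suitable D ε n₀ κ a) (hε : 0 < ε) (hε1 : ε < 1 / 2)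
    (hp : p ∈ stdSimplex ℝ 𝒳) (hR : entropyBits p + ε ≤ R) (hR0 : ε ≤ R)
    (hR' : R ≤ Real.logb 2 D.q + ε) (sym : 𝒳 ≃ Fin D.q) (hs : 1 ≤ s) (hsn : s ≤ n) :
    avgUpdateEfficiency sym (D.algorithms n₀ κ) p (D.scheme n₀ sym n ⌊n * R⌋₊) s ≤
      4 + (s + 4 * D.b) * (5 * D.q + 4) := by
  have hn1 : 1 ≤ n := hs.trans hsn
  have hb : (2 : ℝ) ≤ D.b := by exact_mod_cast h.two_le_b
  refine ciSup_le fun i => ?_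
  have hi : (i : ℕ) + s ≤ n := by omega
  rcases lt_or_ge n n₀ with hlt | hle
  · simp only [(updRun_of_lt hlt (h.lt_words n hn1) _ _ _ _).1,
      (updRun_of_lt hlt (h.lt_words n hn1) _ _ _ _).2.1, Nat.cast_zero, add_zero,
      iidMean_const hp]
    positivity
  · rw [scheme_of_le sym hle]
    refine ((h.rare_overflow hε hε1 hp hR hle).mean_updRun (h.room hε hε1 hR0 hR' hle)
      h.numbering hle (h.lt_words n hn1) hi hs).1.trans ?_
    obtain ⟨-, hJ, -⟩ := h.blocks_bounds hs (i : ℕ)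
    have hl := h.payload_le_mul hε hε1 hR0 hR' hle
    set l := ⌊n * R⌋₊ / (n / (D.b - 1)) - 3
    have h1 : (2 : ℝ) * l + 3 * D.β + 4 ≤ D.b * (5 * D.q + 4) := by
      rw [h.β_eq]
      push_cast
      linarith
    calc (4 : ℝ) + (D.blocks i s + 2) * (2 * l + 3 * D.β + 4)
        ≤ 4 + (D.blocks i s + 2) * (D.b * (5 * D.q + 4)) := by gcongr
      _ = 4 + (D.b * D.blocks i s + 2 * D.b) * (5 * D.q + 4) := by ring
      _ ≤ 4 + (s + 4 * D.b) * (5 * D.q + 4) := by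
          have h2 : (D.b : ℝ) * D.blocks i s + 2 * D.b ≤ s + 4 * D.b := by linarith
          exact add_le_add_right (mul_le_mul_of_nonneg_right h2 (by positivity)) _

theorem meanTime_bounds (h : Suitable D ε n₀ κ a) (hε : 0 < ε) (hε1 : ε < 1 / 2)
    (hp : p ∈ stdSimplex ℝ 𝒳) (hR : entropyBits p + ε ≤ R) (hR0 : ε ≤ R)
    (hR' : R ≤ Real.logb 2 D.q + ε) (sym : 𝒳 ≃ Fin D.q) (hs : 1 ≤ s) (hi : i + s ≤ n) :
    1 / ((D.b : ℝ) + n₀) * s ≤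
        meanLocalDecodeTime (D.algorithms n₀ κ) p (D.scheme n₀ sym n ⌊n * R⌋₊) i s ∧
      meanLocalDecodeTime (D.algorithms n₀ κ) p (D.scheme n₀ sym n ⌊n * R⌋₊) i s ≤
        (6 + 5 * D.decodeTime + 7 * D.updateTime) * s ∧
      1 / ((D.b : ℝ) + n₀) * s ≤
        meanLocalUpdateTime sym (D.algorithms n₀ κ) p (D.scheme n₀ sym n ⌊n * R⌋₊) i s ∧
      meanLocalUpdateTime sym (D.algorithms n₀ κ) p (D.scheme n₀ sym n ⌊n * R⌋₊) i s ≤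
        (6 + 5 * D.decodeTime + 7 * D.updateTime) * s := by
  have hn1 : 1 ≤ n := by omega
  have hb : (2 : ℝ) ≤ D.b := by exact_mod_cast h.two_le_b
  have hs1 : (1 : ℝ) ≤ s := by exact_mod_cast hs
  have hn0 : (0 : ℝ) ≤ n₀ := Nat.cast_nonneg _
  have hdt : (0 : ℝ) ≤ D.decodeTime := Nat.cast_nonneg _
  have hut : (0 : ℝ) ≤ D.updateTime := Nat.cast_nonneg _
  have hdts := mul_le_mul_of_nonneg_left hs1 hdt
  have huts := mul_le_mul_of_nonneg_left hs1 hut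
  rcases lt_or_ge n n₀ with hlt | hle
  · have hw := h.lt_words n hn1
    have h1 : 1 / ((D.b : ℝ) + n₀) * s ≤ 6 := by
      rw [one_div_mul_eq_div, div_le_iff₀ (by linarith)]
      have : (s : ℝ) ≤ n₀ := by exact_mod_cast (by omega : s ≤ n₀)
      linarith
    have h2 : (6 : ℝ) ≤ (6 + 5 * D.decodeTime + 7 * D.updateTime) * s := by nlinarith
    simp only [meanLocalDecodeTime, meanLocalUpdateTime, (locRun_of_lt hlt hw _ _ _ _).2,
      (updRun_of_lt hlt hw _ _ _ _).2.2, iidMean_const hp]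
    exact ⟨h1, h2, h1, h2⟩
  · rw [scheme_of_le sym hle]
    obtain ⟨hJ, -, hJ'⟩ := h.blocks_bounds hs i
    have h1 : 1 / ((D.b : ℝ) + n₀) * s ≤ D.blocks i s := by
      rw [one_div_mul_eq_div, div_le_iff₀ (by linarith)]
      have : (0 : ℝ) ≤ D.blocks i s * n₀ := by positivity
      linarith
    have hrare := h.rare_overflow (sym := sym) hε hε1 hp hR hle
    have hroom := h.room hε hε1 hR0 hR' hle
    obtain ⟨-, h2, h3⟩ := hrare.mean_locRun hroom hle (h.lt_words n hn1) hi hs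
    obtain ⟨-, h4, h5⟩ := hrare.mean_updRun hroom h.numbering hle (h.lt_words n hn1) hi hs
    have h6 := mul_le_mul_of_nonneg_left hJ' hdt
    have h7 := mul_le_mul_of_nonneg_left hJ' hut
    exact ⟨h1.trans h2, h3.trans (by linarith), h1.trans h4, h5.trans (by linarith)⟩

end Suitable

end Coder

theorem theorem2 {𝒳 : Type*} [Fintype 𝒳] [Nonempty 𝒳] (sym : 𝒳 ≃ Fin (Fintype.card 𝒳)) :
    ∃ (A : ℝ → Algorithms) (C : ℝ → ∀ n L : ℕ, CompressionScheme 𝒳 n L),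
      -- the programs for `ε` realize the schemes for `ε`, at all blocklengths and all rates
      (∀ ε : ℝ, 0 < ε → ε < 1 / 2 →
        ∀ R : ℝ, ε ≤ R → R ≤ Real.logb 2 (Fintype.card 𝒳) + ε → ∀ n : ℕ, 1 ≤ n →
          Implements sym (A ε) (C ε n ⌊n * R⌋₊)) ∧
      ∀ p ∈ stdSimplex ℝ 𝒳, ∃ α₁ α₁' α₁'' α₂ α₂' α₂'' : ℝ,
        0 < α₁ ∧ 0 < α₁' ∧ 0 < α₁'' ∧ 0 < α₂ ∧ 0 < α₂' ∧ 0 < α₂'' ∧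
        ∀ ε : ℝ, 0 < ε → ε < 1 / 2 →
          ∃ c K t T : ℝ, 0 < c ∧ 0 < K ∧ 0 < t ∧ 0 < T ∧
            -- every admissible rate; `R = entropyBits p + ε` is the smallest one
            ∀ R : ℝ, entropyBits p + ε ≤ R → R ≤ Real.logb 2 (Fintype.card 𝒳) + ε →
              -- probability of error
              (∀ᶠ n : ℕ in atTop,
                errorProb p (C ε n ⌊n * R⌋₊) ≤
                  (2 : ℝ) ^ (-(2 : ℝ) ^ (c * √(Real.logb 2 n)))) ∧
              -- average local decodability and update efficiency
              (∀ n s : ℕ, 1 ≤ s → s ≤ n →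
                ((s : ℝ) ≤ α₁'' * localScale ε →
                  avgLocalDecodability (A ε) p (C ε n ⌊n * R⌋₊) s ≤ α₁ * localScale ε) ∧
                (α₁'' * localScale ε < (s : ℝ) →
                  avgLocalDecodability (A ε) p (C ε n ⌊n * R⌋₊) s ≤ α₁' * s) ∧
                ((s : ℝ) ≤ α₂'' * localScale ε →
                  avgUpdateEfficiency sym (A ε) p (C ε n ⌊n * R⌋₊) s ≤ α₂ * localScale ε) ∧
                (α₂'' * localScale ε < (s : ℝ) →
                  avgUpdateEfficiency sym (A ε) p (C ε n ⌊n * R⌋₊) s ≤ α₂' * s)) ∧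
              -- total time of encoding and decoding
              (∀ n : ℕ, 2 ≤ n → ∀ x : Fin n → 𝒳,
                (codingTime sym (A ε) (C ε n ⌊n * R⌋₊) x : ℝ) ≤ K * (n * Real.logb 2 n)) ∧
              -- expected time of local decoding and of local updating
              (∀ n s i : ℕ, 1 ≤ s → i + s ≤ n →
                t * s ≤ meanLocalDecodeTime (A ε) p (C ε n ⌊n * R⌋₊) i s ∧
                meanLocalDecodeTime (A ε) p (C ε n ⌊n * R⌋₊) i s ≤ T * s ∧
                t * s ≤ meanLocalUpdateTime sym (A ε) p (C ε n ⌊n * R⌋₊) i s ∧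
                meanLocalUpdateTime sym (A ε) p (C ε n ⌊n * R⌋₊) i s ≤ T * s) := by
  obtain ⟨B, hB1, hB⟩ := Coder.exists_suitable (q := Fintype.card 𝒳) Fintype.card_pos
  choose b rank unrank n₀ κ a hS using hB
  let D : ℝ → Coder := fun ε =>
    ⟨b ε, Fintype.card 𝒳, b ε * Fintype.card 𝒳, b ε * (Fintype.card 𝒳 + 1), rank ε, unrank ε⟩
  have hD : ∀ ε, 0 < ε → ε < 1 / 2 → (D ε).Suitable ε (n₀ ε) (κ ε) (a ε) :=
    fun ε h0 h1 => (hS ε h0 h1).2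
  refine ⟨fun ε => (D ε).algorithms (n₀ ε) (κ ε), fun ε => (D ε).scheme (n₀ ε) sym,
    fun ε h0 h1 R hR hR' n hn => (hD ε h0 h1).implements h0 h1 hR hR' hn sym, fun p hp => ?_⟩
  set q : ℝ := (Fintype.card 𝒳 : ℝ) with hq
  have hq0 : 0 ≤ q := Nat.cast_nonneg _
  refine ⟨3 + (1 + 2 * B) * (2 * q + 2), 3 + (1 + 2 * B) * (2 * q + 2), 1,
    4 + (1 + 4 * B) * (5 * q + 4), 4 + (1 + 4 * B) * (5 * q + 4), 1, by positivity, by positivity,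
    one_pos, by positivity, by positivity, one_pos, fun ε h0 h1 => ?_⟩
  have h := hD ε h0 h1
  have hb : (b ε : ℝ) ≤ B * localScale ε := (hS ε h0 h1).1
  have hb2 : (2 : ℝ) ≤ b ε := by exact_mod_cast h.two_le_b
  obtain ⟨-, hls⟩ := one_le_localScale h0 h1
  refine ⟨1, 12 + 2 * ((D ε).updateTime + (D ε).decodeTime), 1 / ((b ε : ℝ) + n₀ ε),
    6 + 5 * (D ε).decodeTime + 7 * (D ε).updateTime, one_pos, by positivity, by positivity,
    by positivity, fun R hR hR' => ?_⟩
  have hH0 : 0 ≤ entropyBits p := by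
    refine Finset.sum_nonneg fun x _ => div_nonneg (Real.negMulLog_nonneg (hp.1 x) ?_)
      (Real.log_nonneg (by norm_num))
    rw [← hp.2]
    exact Finset.single_le_sum (fun i _ => hp.1 i) (Finset.mem_univ x)
  have hR0 : ε ≤ R := by linarith
  have hscale : ∀ c d e y s : ℝ, 0 ≤ c → 0 ≤ d → 0 ≤ e → 1 ≤ y → s ≤ y → localScale ε ≤ y →
      c + (s + d * b ε) * e ≤ (c + (1 + d * B) * e) * y := by
    intro c d e y s hc hd he hy hs hl
    have h2 : c ≤ c * y := le_mul_of_one_le_right hc hy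
    have h3 : (b ε : ℝ) ≤ B * y := hb.trans (by gcongr)
    have h4 : (s + d * b ε) * e ≤ (y + d * (B * y)) * e := by gcongr
    linarith
  refine ⟨h.eventually_errorProb_le h0 h1 hp hR hR0 hR' sym, fun n s hs hsn => ?_,
    fun n hn x => h.codingTime_le h0 h1 hR0 hR' sym hn x,
    fun n s i hs hi => h.meanTime_bounds h0 h1 hp hR hR0 hR' sym hs hi⟩
  have hd := h.avgLocalDecodability_le h0 h1 hp hR hR0 hR' sym hs hsn
  have hu := h.avgUpdateEfficiency_le h0 h1 hp hR hR0 hR' sym hs hsn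
  have hs1 : (1 : ℝ) ≤ s := by exact_mod_cast hs
  simp only [one_mul]
  exact ⟨fun hsl => hd.trans (hscale 3 2 _ _ _ (by norm_num) (by norm_num) (by positivity) hls
      hsl le_rfl),
    fun hsl => hd.trans (hscale 3 2 _ _ _ (by norm_num) (by norm_num) (by positivity) hs1
      le_rfl hsl.le),
    fun hsl => hu.trans (hscale 4 4 _ _ _ (by norm_num) (by norm_num) (by positivity) hls
      hsl le_rfl),
    fun hsl => hu.trans (hscale 4 4 _ _ _ (by norm_num) (by norm_num) (by positivity) hs1
      le_rfl hsl.le)⟩
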